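/- Let $\alpha\in(0,1)$. Put $m_j=2\lfloor j^{1/\alpha}\rfloor$ for $j\ge 0$, $m_{-1}=-1$, and $I_j=(m_{j-1},m_j]\cap\mathbb Z$, so that $(I_j)_{j\ge0}$ partitions $\{0,1,2,\dots\}$; let $c_k=\exp(-2^j)$ for $k\in I_j$. Let $(\varepsilon_k)_{k\ge0}$ be i.i.d. real random variables with $p:=\mathbb P(\varepsilon_k>0)\in(0,1)$, $\mathbb E|\varepsilon_k|\le 1$, and such that for some constant $C_0>0$ one has $\mathbb P(|\varepsilon_k|\le t)\le C_0t$ for all $t\ge0$. Let $R_n$ be the number of real roots of $f_n(z)=\sum_{k=0}^n c_k\varepsilon_kz^k$ (the result holds both when roots are counted with multiplicity and when they are counted without; $R_n:=0$ on the null event $f_n\equiv0$). Let $j_*=j_*(n)=\max\{j: I_j\cap\{0,\dots,n\}\ne\emptyset\}$, and let $S_n$ be the number of sign changes (consecutive pairs with negative product) in the finite sequence $\varepsilon_{m_0},\varepsilon_{m_1},\dots,\varepsilon_{m_{j_*-1}},\varepsilon_n$. Then there is an absolute constant $C>0$ such that the event $|R_n-2S_n|\le C(\log n)^{1/\alpha}$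 holds with overwhelming probability, i.e. for every $\kappa>0$ there is $C_\kappa>0$ such that $\mathbb P\bigl(|R_n-2S_n|\le C(\log n)^{1/\alpha}\bigr)\ge 1-C_\kappa n^{-\kappa}$ for all $n>C_\kappa$. Moreover, there are constants $c_p,c_p'>0$ depending only on $p$ such that, as $n\to\infty$, $$\mathbb E R_n\sim c_p\,(n/2)^\alpha,\qquad \operatorname{Var}R_n\sim c_p'\,(n/2)^\alpha,\qquad \frac{R_n}{c_p\,(n/2)^\alpha}\to1\ \text{ almost surely},$$ and $$\frac{R_n-\mathbb E R_n}{\sqrt{\operatorname{Var}R_n}}\longrightarrow \mathcal N(0,1)\quad\text{in distribution.}$$ -/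

import Mathlib

open MeasureTheory ProbabilityTheory Filter Topology Polynomial

noncomputable section

namespace RandomPoly

/-- The block endpoints `m_j = 2 ⌊j ^ (1/α)⌋`. -/
def m (α : ℝ) (j : ℕ) : ℕ := 2 * ⌊(j : ℝ) ^ (1 / α)⌋₊

/-- The blocks `I_j = (m_{j-1}, m_j]` of non-negative integers, with the convention `m_{-1} = -1`. -/
def block (α : ℝ) : ℕ → Set ℕ
  | 0 => Set.Iic (m α 0)
  | j + 1 => Set.Ioc (m α j) (m α (j + 1))

/-- The index `j` of the block that contains `k`. -/
def blockIndex (α : ℝ) (k : ℕ) : ℕ := sInf {j | k ∈ block α j}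

/-- The deterministic coefficients: `c_k = exp (-2 ^ j)` for `k ∈ I_j`. -/
def coeff (α : ℝ) (k : ℕ) : ℝ := Real.exp (-(2 : ℝ) ^ blockIndex α k)

/-- `j_* = max {j : I_j ∩ {0, …, n} ≠ ∅}`. -/
def jStar (α : ℝ) (n : ℕ) : ℕ := sSup {j | (block α j ∩ Set.Iic n).Nonempty}

theorem m_strictMono {α : ℝ} (h0 : 0 < α) (h1 : α < 1) : StrictMono (m α) := by
  refine strictMono_nat_of_lt_succ fun j => ?_
  have hα : 1 ≤ 1 / α := by rw [le_div_iff₀ h0]; linarith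
  have hj : (0 : ℝ) ≤ (j : ℝ) := Nat.cast_nonneg j
  have h2 : (j : ℝ) ^ (1 / α) + 1 ≤ ((j : ℝ) + 1) ^ (1 / α) := by
    have hsup := Real.add_rpow_le_rpow_add hj (zero_le_one' ℝ) hα
    simpa using hsup
  have h3 := Nat.floor_le_floor h2
  rw [Nat.floor_add_one (Real.rpow_nonneg hj _)] at h3
  simp only [m, Nat.cast_add, Nat.cast_one]
  omega

/-- Every `k` lies in exactly one block, namely the one with index `blockIndex α k`. -/
theorem mem_block_iff {α : ℝ} (h0 : 0 < α) (h1 : α < 1) (k j : ℕ) :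
    k ∈ block α j ↔ blockIndex α k = j := by
  have hm := m_strictMono h0 h1
  have huniq : ∀ i j, k ∈ block α i → k ∈ block α j → ¬ i < j := by
    intro i j hi hj hij
    obtain ⟨j, rfl⟩ : ∃ l, j = l + 1 := ⟨j - 1, by omega⟩
    have hle : k ≤ m α i := by
      cases i with
      | zero => exact hi
      | succ i => exact hi.2
    have := hm.monotone (show i ≤ j by omega)
    have := hj.1
    omega
  have hex : ∃ j, k ∈ block α j := by
    have h : ∃ j, k ≤ m α j := ⟨k, hm.le_apply⟩
    classical
    refine ⟨Nat.find h, ?_⟩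
    have hs := Nat.find_spec h
    rcases hf : Nat.find h with _ | i
    · rw [hf] at hs; exact hs
    · rw [hf] at hs
      exact ⟨not_le.1 (Nat.find_min h (by omega)), hs⟩
  have hmem : k ∈ block α (blockIndex α k) := Nat.sInf_mem (s := {j | k ∈ block α j}) hex
  constructor
  · intro hk
    have h2 := huniq _ _ hk hmem
    have h3 := huniq _ _ hmem hk
    omega
  · rintro rfl
    exact hmem

/-- `j_*` is a genuine maximum: it is the index of the block of `n`. -/
theorem isGreatest_jStar {α : ℝ} (h0 : 0 < α) (h1 : α < 1) (n : ℕ) :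
    IsGreatest {j | (block α j ∩ Set.Iic n).Nonempty} (jStar α n) ∧
      jStar α n = blockIndex α n := by
  have hm := m_strictMono h0 h1
  have hg : IsGreatest {j | (block α j ∩ Set.Iic n).Nonempty} (blockIndex α n) := by
    have hn := (mem_block_iff h0 h1 n _).2 rfl
    refine ⟨⟨n, hn, le_refl n⟩, ?_⟩
    rintro j ⟨k, hk, hkn⟩
    have hle : n ≤ m α (blockIndex α n) := by
      rcases hb : blockIndex α n with _ | i
      · rw [hb] at hn; exact hn
      · rw [hb] at hn; exact hn.2
    cases j with
    | zero => exact Nat.zero_le _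
    | succ j =>
      have h2 : m α j < k := hk.1
      have h3 : k ≤ n := hkn
      exact hm.lt_iff_lt.1 (lt_of_lt_of_le h2 (h3.trans hle))
  have he : jStar α n = blockIndex α n := hg.csSup_eq
  exact ⟨he ▸ hg, he⟩

variable {Ω : Type*}

/-- The random polynomial `f_n(z) = ∑_{k=0}^n c_k ε_k z^k`. -/
def f (α : ℝ) (ε : ℕ → Ω → ℝ) (n : ℕ) (ω : Ω) : ℝ[X] :=
  ∑ k ∈ Finset.range (n + 1), C (coeff α k * ε k ω) * X ^ k

/-- The number of real roots of `f_n`, counted with multiplicity. -/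
def numRoots (α : ℝ) (ε : ℕ → Ω → ℝ) (n : ℕ) (ω : Ω) : ℕ :=
  (f α ε n ω).roots.card

/-- The number of distinct real roots of `f_n`. -/
def numDistinctRoots (α : ℝ) (ε : ℕ → Ω → ℝ) (n : ℕ) (ω : Ω) : ℕ :=
  (f α ε n ω).roots.toFinset.card

/-- The finite sequence `ε_{m_0}, …, ε_{m_{j_* - 1}}, ε_n`, with entries indexed by `0, …, j_*`
(the value at larger indices is not used). -/
def endpointSeq (α : ℝ) (ε : ℕ → Ω → ℝ) (n : ℕ) (ω : Ω) (j : ℕ) : ℝ :=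
  if j < jStar α n then ε (m α j) ω else ε n ω

/-- `S_n`: the number of sign changes between consecutive entries of
`ε_{m_0}, …, ε_{m_{j_* - 1}}, ε_n`. -/
def numSignChanges (α : ℝ) (ε : ℕ → Ω → ℝ) (n : ℕ) (ω : Ω) : ℕ :=
  {j ∈ Finset.range (jStar α n) |
    endpointSeq α ε n ω j * endpointSeq α ε n ω (j + 1) < 0}.card

/-- The standing assumption on the i.i.d. real random variables `ε_k`; `p` is `P(ε_k > 0)`. -/
structure Admissible [MeasurableSpace Ω] (P : Measure Ω) (ε : ℕ → Ω → ℝ) (p : ℝ) : Prop where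
  measurable : ∀ k, Measurable (ε k)
  indep : iIndepFun ε P
  identDistrib : ∀ k, IdentDistrib (ε k) (ε 0) P P
  prob_pos : P.real {ω | 0 < ε 0 ω} = p
  p_pos : 0 < p
  p_lt_one : p < 1
  integrable : Integrable (ε 0) P
  mean_abs_le : ∫ ω, |ε 0 ω| ∂P ≤ 1
  anticoncentration : ∃ C₀ : ℝ, 0 < C₀ ∧ ∀ t : ℝ, 0 ≤ t → P.real {ω | |ε 0 ω| ≤ t} ≤ C₀ * t

/-- The events `E n` hold with overwhelming probability. -/
def WithOverwhelmingProb [MeasurableSpace Ω] (P : Measure Ω) (E : ℕ → Set Ω) : Prop :=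
  ∀ κ : ℝ, 0 < κ → ∃ Cκ : ℝ, 0 < Cκ ∧ ∀ n : ℕ, Cκ < (n : ℝ) →
    1 - Cκ * (n : ℝ) ^ (-κ) ≤ P.real (E n)

end RandomPoly

end

/-! The proof is a Newton polygon argument followed by limit theorems for the sign changes of an
i.i.d. sequence. Write J for j_*.

Deterministic part. Suppose that |ε_k| lies between n^(-A) and n^A for all k ≤ n. At x = e^t the
logarithm of the k-th term of f_n is then -2^j + k t + O(log n), where j is the index of the block
of k. Inside a block the coefficient c_k is constant, so for t > 0 large the last index of the block
wins, and only the vertices v_j = m_j (j < J) and v_J = n compete. The edge from v_l to v_(l+1) has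
slope 2^l / (v_(l+1) - v_l); since the block lengths grow only polynomially, the slopes grow
geometrically and from index log n on they are separated by more than any multiple of log n
(`eventually_slope_gap`). Hence there are radii ρ_j at which the term of index v_j dominates, and
between ρ_j and ρ_(j+1) only the terms of v_j and v_(j+1) matter (`eventually_dominated`). If their
signs agree there is no root; if they differ there is exactly one root, and it is simple. In |x| ≤
ρ_(j₀), with j₀ = ⌊log n⌋, the derivative of order v_(j₀) does not vanish, so Rolle's theorem leaves
at most v_(j₀) = O((log n)^(1/α)) roots. Negative roots are those of f_n(-x): since the m_j are
even, its vertex coefficients have the same signs, except perhaps the last. So R_n = 2 S_n + O((log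
n)^(1/α)) for both ways of counting roots (`eventually_abs_card_roots_sub_le`).

Probabilistic part. The assumption on |ε_k| fails with probability O(n^(1-A)), by the small-ball
hypothesis and Markov's inequality; A is free, which gives overwhelming probability. The signs of
the ε_(v_j) are independent Bernoulli variables, and J ~ (n/2)^α. With q = 2p(1-p), the number of
changes among J+1 such signs is q J plus a martingale of variance q(2-3q) J plus a bounded term
(`changes_eq`, `integral_changesMart_sq`). As R_n ≤ n, the exceptional event for A = 3 contributes
O(1) to the second moment of R_n - 2 S_n, so that error is negligible in L² and mean and variance
follow (`MainPart`), with c_p = 2q and c_p' = 4q(2-3q). The almost sure limit comes from the strong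
law on pairs of signs and Borel–Cantelli. The normal limit comes from an explicit generating
function of the number of changes (`tendsto_genFun`), transferred to R_n by Slutsky's theorem. -/

namespace RandomPoly

/-! ### Counting real roots: simple roots on an interval and Rolle's bound -/

/-- The roots of `p` satisfying `Q` are simple and there are exactly `k` of them. -/
def SimpleCount (p : ℝ[X]) (Q : ℝ → Prop) (k : ℕ) : Prop :=
  (∀ x, Q x → p.rootMultiplicity x ≤ 1) ∧ ∀ [DecidablePred Q], p.roots.countP Q = k

theorem SimpleCount.of_ne_zero {p : ℝ[X]} {Q : ℝ → Prop} (h : ∀ x, Q x → p.eval x ≠ 0) :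
    SimpleCount p Q 0 := by
  refine ⟨fun x hx => ?_, ?_⟩
  · rw [rootMultiplicity_eq_zero (h x hx)]; exact zero_le_one
  · intro _
    rw [Multiset.countP_eq_zero]
    intro x hx hQ
    exact h x hQ (isRoot_of_mem_roots hx)

theorem SimpleCount.or {p : ℝ[X]} {Q R S : ℝ → Prop} {k l : ℕ} (h₁ : SimpleCount p Q k)
    (h₂ : SimpleCount p R l) (hd : ∀ x, Q x → ¬ R x) (hS : ∀ x, S x ↔ Q x ∨ R x) :
    SimpleCount p S (k + l) := by
  classical
  refine ⟨fun x hx => ?_, ?_⟩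
  · rcases (hS x).1 hx with h | h
    exacts [h₁.1 x h, h₂.1 x h]
  · intro _
    rw [← h₁.2, ← h₂.2]
    generalize p.roots = s
    induction s using Multiset.induction_on with
    | empty => simp
    | cons x s ih =>
      have := hd x
      have := hS x
      simp only [Multiset.countP_cons, ih]
      by_cases hQ : Q x <;> by_cases hR : R x <;> simp_all <;> omega

/-- If `x p' - w p` has constant sign on `[a, b]` and `p` changes sign accordingly, then `p` has
exactly one root in `(a, b]`, and this root is simple. -/
theorem SimpleCount.one {p : ℝ[X]} {a b w c : ℝ} (ha : 0 < a) (hab : a ≤ b)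
    (hw : ∀ x, a ≤ x → x ≤ b → 0 < c * (x * p.derivative.eval x - w * p.eval x))
    (hpa : c * p.eval a < 0) (hpb : 0 < c * p.eval b) :
    SimpleCount p (fun x => a < x ∧ x ≤ b) 1 := by
  have hp0 : p ≠ 0 := by rintro rfl; simp at hpa
  have hsimple : ∀ x, a < x ∧ x ≤ b → p.rootMultiplicity x ≤ 1 := by
    rintro x ⟨h1, h2⟩
    by_contra h
    have h3 : 1 < p.rootMultiplicity x := by omega
    rw [one_lt_rootMultiplicity_iff_isRoot hp0] at h3
    have := hw x h1.le h2
    rw [h3.1.eq_zero, h3.2.eq_zero] at this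
    simp at this
  refine ⟨hsimple, ?_⟩
  -- The derivative of x^(-w) p(x) is x^(-w-1) (x p' - w p), so `hw` makes g strictly monotone. The
  -- factor x^(-w) does not affect the zeros on the positive axis.
  set g : ℝ → ℝ := fun x => x ^ (-w) * (c * p.eval x) with hg
  have hmono : StrictMonoOn g (Set.Icc a b) := by
    have hd : ∀ x, 0 < x → HasDerivAt g
        (x ^ (-w - 1) * (c * (x * p.derivative.eval x - w * p.eval x))) x := by
      intro x hx
      have h1 := (Real.hasDerivAt_rpow_const (x := x) (p := -w) (Or.inl hx.ne'))
      have h2 := (p.hasDerivAt x).const_mul c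
      refine HasDerivAt.congr_deriv (f := g) (h1.mul h2) ?_
      have h3 : x ^ (-w) = x ^ (-w - 1) * x := by
        rw [← Real.rpow_add_one hx.ne']; ring_nf
      rw [h3]; ring
    refine strictMonoOn_of_deriv_pos (convex_Icc a b) ?_ ?_
    · intro x hx
      exact (hd x (ha.trans_le hx.1)).continuousAt.continuousWithinAt
    · intro x hx
      rw [interior_Icc] at hx
      have hx0 : 0 < x := ha.trans hx.1
      rw [(hd x hx0).deriv]
      exact mul_pos (Real.rpow_pos_of_pos hx0 _) (hw x hx.1.le hx.2.le)
  have hcont : ContinuousOn (fun x => c * p.eval x) (Set.Icc a b) :=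
    (p.continuous.const_smul c).continuousOn
  obtain ⟨r, hr, hr0⟩ := intermediate_value_Icc hab hcont ⟨hpa.le, hpb.le⟩
  have hc : c ≠ 0 := by rintro rfl; simp at hpa
  have hr0' : p.eval r = 0 := by simpa [hc] using hr0
  have har : a < r := by
    rcases hr.1.eq_or_lt with h | h
    · subst h; rw [hr0'] at hpa; simp at hpa
    · exact h
  intro _
  have huniq : ∀ x ∈ p.roots, (a < x ∧ x ≤ b) ↔ r = x := by
    intro x hx
    constructor
    · rintro ⟨h1, h2⟩
      have hx0 : p.eval x = 0 := isRoot_of_mem_roots hx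
      apply hmono.injOn hr ⟨h1.le, h2⟩
      simp [hg, hr0', hx0]
    · rintro rfl
      exact ⟨har, hr.2⟩
  rw [Multiset.countP_congr rfl fun x hx => propext (huniq x hx)]
  have h1 : p.roots.count r = 1 := by
    rw [count_roots]
    have h2 := hsimple r ⟨har, hr.2⟩
    have h3 : 0 < p.rootMultiplicity r := (rootMultiplicity_pos hp0).2 hr0'
    omega
  exact h1

/-- Local form of Rolle's bound, with multiplicities. -/
theorem countP_roots_le_derivative (p : ℝ[X]) (a b : ℝ) :
    p.roots.countP (fun x => a ≤ x ∧ x ≤ b) ≤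
      p.derivative.roots.countP (fun x => a ≤ x ∧ x ≤ b) + 1 := by
  classical
  rcases eq_or_ne (derivative p) 0 with hp' | hp'
  · rw [eq_C_of_derivative_eq_zero hp']
    simp
  have hp : p ≠ 0 := ne_of_apply_ne derivative (by rwa [derivative_zero])
  have hcount : ∀ q : ℝ[X], q.roots.countP (fun x => a ≤ x ∧ x ≤ b) =
      ∑ x ∈ q.roots.toFinset with a ≤ x ∧ x ≤ b, q.rootMultiplicity x := by
    intro q
    rw [Multiset.countP_eq_card_filter, ← Multiset.toFinset_sum_count_eq, Multiset.toFinset_filter]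
    refine Finset.sum_congr rfl fun x hx => ?_
    rw [Multiset.count_filter_of_pos (p := fun x => a ≤ x ∧ x ≤ b) (Finset.mem_filter.1 hx).2, count_roots]
  set A := {x ∈ p.roots.toFinset | a ≤ x ∧ x ≤ b} with hA
  set B := {x ∈ p.derivative.roots.toFinset | a ≤ x ∧ x ≤ b} with hB
  have hmemA : ∀ x, x ∈ A ↔ p.IsRoot x ∧ a ≤ x ∧ x ≤ b := by
    intro x; simp [hA, hp]
  have hmemB : ∀ x, x ∈ B ↔ p.derivative.IsRoot x ∧ a ≤ x ∧ x ≤ b := by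
    intro x; simp [hB, hp']
  -- Rolle puts a root of p' strictly between two neighbouring elements of A, and such a root is not
  -- in A. At the points of A itself, differentiation lowers the multiplicity by at most one.
  have hcard : A.card ≤ (B \ A).card + 1 := by
    refine Finset.card_le_sdiff_of_interleaved fun x hx y hy hxy hxy' => ?_
    rw [hmemA] at hx hy
    obtain ⟨z, hz1, hz2⟩ := exists_deriv_eq_zero hxy p.continuousOn (hx.1.trans hy.1.symm)
    refine ⟨z, (hmemB z).2 ⟨?_, hx.2.1.trans hz1.1.le, hz1.2.le.trans hy.2.2⟩, hz1⟩
    rwa [IsRoot, ← p.deriv]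
  rw [hcount, hcount, ← hA, ← hB]
  calc ∑ x ∈ A, p.rootMultiplicity x
      = (∑ x ∈ A, (p.rootMultiplicity x - 1)) + A.card := by
        rw [Finset.card_eq_sum_ones, ← Finset.sum_add_distrib]
        refine Finset.sum_congr rfl fun x hx => ?_
        have : 0 < p.rootMultiplicity x := (rootMultiplicity_pos hp).2 ((hmemA x).1 hx).1
        omega
    _ ≤ (∑ x ∈ A, p.derivative.rootMultiplicity x) +
          ((∑ x ∈ B \ A, p.derivative.rootMultiplicity x) + 1) := by
        refine add_le_add (Finset.sum_le_sum fun x _ =>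
          rootMultiplicity_sub_one_le_derivative_rootMultiplicity _ _) (hcard.trans ?_)
        rw [Finset.card_eq_sum_ones]
        gcongr with x hx
        exact Nat.succ_le_iff.2 ((rootMultiplicity_pos hp').2
          ((hmemB x).1 (Finset.mem_sdiff.1 hx).1).1)
    _ = (∑ x ∈ B, p.derivative.rootMultiplicity x) + 1 := by
        rw [← add_assoc, ← Finset.sum_union Finset.disjoint_sdiff, Finset.union_sdiff_self_eq_union,
          ← Finset.sum_subset Finset.subset_union_right]
        intro x hx hxB
        rw [rootMultiplicity_eq_zero]
        intro h
        rcases Finset.mem_union.1 hx with h1 | h1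
        · exact hxB ((hmemB x).2 ⟨h, ((hmemA x).1 h1).2⟩)
        · exact hxB h1

/-- Each differentiation loses at most one root of the interval, and none is left after v of them.
-/
theorem countP_roots_le_of_iterate_derivative_ne_zero (v : ℕ) (p : ℝ[X]) (a b : ℝ)
    (h : ∀ x, a ≤ x → x ≤ b → (derivative^[v] p).eval x ≠ 0) :
    p.roots.countP (fun x => a ≤ x ∧ x ≤ b) ≤ v := by
  induction v generalizing p with
  | zero =>
    rw [Nat.le_zero, Multiset.countP_eq_zero]
    rintro x hx ⟨h1, h2⟩
    exact h x h1 h2 (isRoot_of_mem_roots hx)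
  | succ v ih =>
    have := ih p.derivative (by simpa using h)
    exact (countP_roots_le_derivative p a b).trans (by omega)

/-! ### Polynomials dominated by the terms at the vertices of a Newton polygon -/

/-- The polynomial `∑_{k ≤ n} a_k X^k`. -/
noncomputable def ofCoeffs (a : ℕ → ℝ) (n : ℕ) : ℝ[X] :=
  ∑ k ∈ Finset.range (n + 1), C (a k) * X ^ k

theorem eval_ofCoeffs (a : ℕ → ℝ) (n : ℕ) (x : ℝ) :
    (ofCoeffs a n).eval x = ∑ k ∈ Finset.range (n + 1), a k * x ^ k := by
  simp [ofCoeffs, eval_finsetSum]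

/-- The Euler operator x d/dx is diagonal on monomials, so that x p' - w p weights the k-th term by
k - w. -/
theorem mul_eval_derivative_ofCoeffs (a : ℕ → ℝ) (n : ℕ) (x : ℝ) :
    x * (ofCoeffs a n).derivative.eval x = ∑ k ∈ Finset.range (n + 1), k * (a k * x ^ k) := by
  simp only [ofCoeffs, derivative_sum, eval_finsetSum, Finset.mul_sum]
  refine Finset.sum_congr rfl fun k _ => ?_
  rcases k with _ | k
  · simp
  · rw [derivative_C_mul_X_pow]
    simp [pow_succ]; ring

theorem eval_hasseDeriv_ofCoeffs (a : ℕ → ℝ) (n v : ℕ) (x : ℝ) :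
    (hasseDeriv v (ofCoeffs a n)).eval x =
      ∑ k ∈ Finset.range (n + 1), (k.choose v : ℝ) * a k * x ^ (k - v) := by
  simp only [ofCoeffs, map_sum, eval_finsetSum]
  refine Finset.sum_congr rfl fun k _ => ?_
  rw [C_mul_X_pow_eq_monomial, hasseDeriv_monomial, eval_monomial]

theorem comp_neg_X_ofCoeffs (a : ℕ → ℝ) (n : ℕ) :
    (ofCoeffs a n).comp (-X) = ofCoeffs (fun k => (-1) ^ k * a k) n := by
  refine Polynomial.funext fun x => ?_
  rw [eval_comp, eval_ofCoeffs, eval_ofCoeffs]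
  refine Finset.sum_congr rfl fun k _ => ?_
  rw [eval_neg, eval_X, neg_pow]
  ring

/-- The coefficients `a_k`, `k ≤ n`, are dominated by those at the vertices `v_{j₀} < ⋯ < v_J = n`:
at the radius `ρ_j` the term of index `v_j` dominates all others, and from radius `ρ_j` on the term
of index `v_{j+1}` dominates those of index in `(v_j, v_{j+1})`. -/
structure Dominated (a : ℕ → ℝ) (n : ℕ) (v : ℕ → ℕ) (ρ : ℕ → ℝ) (j₀ J : ℕ) (δ : ℝ) : Prop where
  le : j₀ ≤ J
  strictMono : ∀ j, j₀ ≤ j → j < J → v j < v (j + 1)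
  last : v J = n
  radius_pos : ∀ j, j₀ ≤ j → j ≤ J → 0 < ρ j
  radius_lt : ∀ j, j₀ ≤ j → j < J → ρ j < ρ (j + 1)
  ne_zero : ∀ j, j₀ ≤ j → j ≤ J → a (v j) ≠ 0
  dom : ∀ j, j₀ ≤ j → j ≤ J → ∀ k ≤ n, k ≠ v j →
    |a k| * ρ j ^ k ≤ δ * (|a (v j)| * ρ j ^ v j)
  dom_first : ∀ k ≤ n, v j₀ < k → |a k| * ρ j₀ ^ k ≤ δ ^ (k - v j₀) * (|a (v j₀)| * ρ j₀ ^ v j₀)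
  dom_between : ∀ j, j₀ ≤ j → j < J → ∀ k, v j < k → k < v (j + 1) → ∀ x, ρ j ≤ x →
    |a k| * x ^ k ≤ δ * (|a (v (j + 1))| * x ^ v (j + 1))
  pos : 0 < δ
  small : 4 * ((n : ℝ) + 1) ^ 2 * δ ≤ 1

namespace Dominated

variable {a : ℕ → ℝ} {n : ℕ} {v : ℕ → ℕ} {ρ : ℕ → ℝ} {j₀ J : ℕ} {δ : ℝ}

theorem alternate (h : Dominated a n v ρ j₀ J δ) :
    Dominated (fun k => (-1) ^ k * a k) n v ρ j₀ J δ := by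
  have habs : ∀ k, |(-1) ^ k * a k| = |a k| := fun k => by simp [abs_mul]
  refine ⟨h.le, h.strictMono, h.last, h.radius_pos, h.radius_lt, fun j h1 h2 => ?_, ?_, ?_, ?_,
    h.pos, h.small⟩
  · exact mul_ne_zero (by simp) (h.ne_zero j h1 h2)
  all_goals simp only [habs]
  exacts [h.dom, h.dom_first, h.dom_between]

theorem v_le (h : Dominated a n v ρ j₀ J δ) {j : ℕ} (h1 : j₀ ≤ j) (h2 : j ≤ J) : v j ≤ n := by
  have key : ∀ i, j ≤ i → i ≤ J → v j ≤ v i := by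
    intro i hi
    induction i, hi using Nat.le_induction with
    | base => exact fun _ => le_rfl
    | succ i hi ih => exact fun h3 => (ih (by omega)).trans (h.strictMono i (by omega) h3).le
  exact h.last ▸ key J h2 le_rfl

/-- All terms are bounded by those at the two neighbouring vertices. -/
theorem le_max (h : Dominated a n v ρ j₀ J δ) {j : ℕ} (h1 : j₀ ≤ j) (h2 : j < J) {x : ℝ}
    (hx1 : ρ j ≤ x) (hx2 : x ≤ ρ (j + 1)) {k : ℕ} (hk : k ≤ n) (hk1 : k ≠ v j)
    (hk2 : k ≠ v (j + 1)) :
    |a k| * x ^ k ≤ δ * max (|a (v j)| * x ^ v j) (|a (v (j + 1))| * x ^ v (j + 1)) := by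
  have hρ := h.radius_pos j h1 h2.le
  have hρ' := h.radius_pos (j + 1) (by omega) h2
  have hx0 : 0 < x := hρ.trans_le hx1
  have hδ := h.pos
  -- Indices below v_j lose ground to v_j as x increases from ρ_j, and indices above v_(j+1) lose
  -- ground to v_(j+1) as x decreases from ρ_(j+1). Those strictly between are covered by
  -- `dom_between` at every x ≥ ρ_j.
  rcases lt_trichotomy k (v j) with hlt | heq | hgt
  · refine le_trans ?_ (mul_le_mul_of_nonneg_left (le_max_left _ _) hδ.le)
    have hd := h.dom j h1 h2.le k hk hk1
    have hy : 1 ≤ x / ρ j := (one_le_div hρ).2 hx1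
    have hxy : x = ρ j * (x / ρ j) := by field_simp
    rw [hxy, mul_pow, mul_pow, ← mul_assoc, ← mul_assoc, ← mul_assoc]
    rw [← mul_assoc] at hd
    refine mul_le_mul hd (pow_le_pow_right₀ hy hlt.le) (by positivity) (by positivity)
  · exact absurd heq hk1
  · refine le_trans ?_ (mul_le_mul_of_nonneg_left (le_max_right _ _) hδ.le)
    rcases lt_or_gt_of_ne hk2 with hlt | hgt2
    · exact h.dom_between j h1 h2 k hgt hlt x hx1
    · have hd := h.dom (j + 1) (by omega) h2 k hk hk2
      have hy : x / ρ (j + 1) ≤ 1 := (div_le_one hρ').2 hx2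
      have hy0 : 0 ≤ x / ρ (j + 1) := by positivity
      have hxy : x = ρ (j + 1) * (x / ρ (j + 1)) := by field_simp
      rw [hxy, mul_pow, mul_pow, ← mul_assoc, ← mul_assoc, ← mul_assoc]
      rw [← mul_assoc] at hd
      refine mul_le_mul hd (pow_le_pow_of_le_one hy0 hy hgt2.le) (by positivity) (by positivity)

/-- One factor n+1 in the smallness of δ pays for the number of terms, the other for a weight such
as |k - w| on each term. The constant 4 leaves room against the vertex terms. -/
theorem sum_le {s : Finset ℕ} {b : ℕ → ℝ} {n : ℕ} {δ M : ℝ} (hs : s ⊆ Finset.range (n + 1))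
    (hδ : 0 < δ) (hsmall : 4 * ((n : ℝ) + 1) ^ 2 * δ ≤ 1) (hM : 0 ≤ M)
    (hb : ∀ k ∈ s, |b k| ≤ (n + 1) * (δ * M)) :
    |∑ k ∈ s, b k| ≤ M / 4 := by
  calc |∑ k ∈ s, b k| ≤ ∑ k ∈ s, |b k| := Finset.abs_sum_le_sum_abs _ _
    _ ≤ s.card • ((n + 1) * (δ * M)) := Finset.sum_le_card_nsmul _ _ _ hb
    _ ≤ (n + 1 : ℝ) * ((n + 1) * (δ * M)) := by
      rw [nsmul_eq_mul]
      have : (s.card : ℝ) ≤ n + 1 := by exact_mod_cast (Finset.card_le_card hs).trans (by simp)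
      gcongr
    _ ≤ M / 4 := by nlinarith

/-- At a radius where the term of index `v` dominates, `p` has the sign of that term. -/
theorem _root_.RandomPoly.mul_eval_ofCoeffs_pos {v : ℕ} (hv : v ≤ n) {x : ℝ} (hx : 0 < x)
    (hδ : 0 < δ) (hsmall : 4 * ((n : ℝ) + 1) ^ 2 * δ ≤ 1) (ha : a v ≠ 0)
    (hdom : ∀ k ≤ n, k ≠ v → |a k| * x ^ k ≤ δ * (|a v| * x ^ v)) :
    0 < a v * (ofCoeffs a n).eval x := by
  have hM : 0 < |a v| * x ^ v := by positivity
  have hsum := sum_le (s := (Finset.range (n + 1)).erase v) (b := fun k => a k * x ^ k)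
    (Finset.erase_subset _ _) hδ hsmall hM.le (by
      intro k hk
      rw [Finset.mem_erase, Finset.mem_range] at hk
      rw [abs_mul, abs_pow, abs_of_pos hx]
      refine (hdom k (by omega) hk.1).trans ?_
      have : 0 ≤ δ * (|a v| * x ^ v) := by positivity
      nlinarith [(Nat.cast_nonneg n : (0 : ℝ) ≤ n)])
  rw [eval_ofCoeffs, ← Finset.add_sum_erase _ _ (Finset.mem_range.2 (Nat.lt_succ_of_le hv))]
  set E := ∑ k ∈ (Finset.range (n + 1)).erase v, a k * x ^ k
  have h1 : |a v * E| ≤ |a v| * (|a v| * x ^ v / 4) := by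
    rw [abs_mul]; gcongr
  have h2 : a v * (a v * x ^ v) = |a v| * (|a v| * x ^ v) := by
    rw [← mul_assoc, ← mul_assoc, abs_mul_abs_self]
  have h3 : 0 < |a v| * (|a v| * x ^ v) := by positivity
  rw [mul_add, h2]
  have := neg_abs_le (a v * E)
  linarith

theorem mul_eval_pos (h : Dominated a n v ρ j₀ J δ) {j : ℕ} (h1 : j₀ ≤ j) (h2 : j ≤ J) :
    0 < a (v j) * (ofCoeffs a n).eval (ρ j) :=
  mul_eval_ofCoeffs_pos (h.v_le h1 h2) (h.radius_pos j h1 h2) h.pos h.small (h.ne_zero j h1 h2)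
    (h.dom j h1 h2)

theorem sum_pair_split {v v' : ℕ} (hne : v ≠ v') (hv : v ≤ n) (hv' : v' ≤ n) (b : ℕ → ℝ) :
    ∑ k ∈ Finset.range (n + 1), b k =
      b v + b v' + ∑ k ∈ ((Finset.range (n + 1)).erase v).erase v', b k := by
  rw [← Finset.add_sum_erase _ b (Finset.mem_range.2 (Nat.lt_succ_of_le hv)),
    ← Finset.add_sum_erase ((Finset.range (n + 1)).erase v) b
      (Finset.mem_erase.2 ⟨hne.symm, Finset.mem_range.2 (Nat.lt_succ_of_le hv')⟩), add_assoc]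

/-- With equal signs the two vertex terms add up in absolute value to T + T', while the rest of the
polynomial is at most max(T, T')/4. -/
theorem simpleCount_zero (h : Dominated a n v ρ j₀ J δ) {j : ℕ} (h1 : j₀ ≤ j) (h2 : j < J)
    (hs : ¬ a (v j) * a (v (j + 1)) < 0) :
    SimpleCount (ofCoeffs a n) (fun x => ρ j < x ∧ x ≤ ρ (j + 1)) 0 := by
  refine SimpleCount.of_ne_zero ?_
  rintro x ⟨hx1, hx2⟩ h0
  have hx : 0 < x := (h.radius_pos j h1 h2.le).trans hx1
  have ha := h.ne_zero j h1 h2.le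
  have ha' := h.ne_zero (j + 1) (by omega) h2
  have hvv := h.strictMono j h1 h2
  have hpos : 0 < a (v j) * a (v (j + 1)) := lt_of_le_of_ne (not_lt.1 hs) (mul_ne_zero ha ha').symm
  set T := |a (v j)| * x ^ v j with hT
  set T' := |a (v (j + 1))| * x ^ v (j + 1) with hT'
  have hTpos : 0 < T := by positivity
  have hTpos' : 0 < T' := by positivity
  have hM : max T T' ≤ T + T' := max_le (by linarith) (by linarith)
  have hsum := sum_le (s := ((Finset.range (n + 1)).erase (v j)).erase (v (j + 1)))
    (b := fun k => a k * x ^ k) (M := max T T')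
    ((Finset.erase_subset _ _).trans (Finset.erase_subset _ _)) h.pos h.small
    (le_max_of_le_left hTpos.le) (by
      intro k hk
      rw [Finset.mem_erase, Finset.mem_erase, Finset.mem_range] at hk
      rw [abs_mul, abs_pow, abs_of_pos hx]
      refine (h.le_max h1 h2 hx1.le hx2 (by omega) hk.2.1 hk.1).trans ?_
      have : 0 ≤ δ * max T T' := mul_nonneg h.pos.le (le_max_of_le_left hTpos.le)
      nlinarith [(Nat.cast_nonneg n : (0 : ℝ) ≤ n)])
  rw [eval_ofCoeffs, sum_pair_split hvv.ne (h.v_le h1 h2.le) (h.v_le (by omega) h2)] at h0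
  have habs : |a (v j) * x ^ v j + a (v (j + 1)) * x ^ v (j + 1)| = T + T' := by
    rw [(abs_add_eq_add_abs_iff _ _).2]
    · simp [hT, hT', abs_mul, abs_of_pos hx]
    · rw [← mul_nonneg_iff]
      have : 0 ≤ (a (v j) * a (v (j + 1))) * (x ^ v j * x ^ v (j + 1)) := by positivity
      linarith
  rw [eq_neg_of_add_eq_zero_left h0, abs_neg] at habs
  linarith

/-- Let w be the midpoint of the two exponents. In x p' - w p the two vertex terms get opposite
weights, which combine with their opposite signs to give at least (T + T')/2 in absolute value. The
rest is at most (T + T')/4, so `SimpleCount.one` applies. -/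
theorem simpleCount_one (h : Dominated a n v ρ j₀ J δ) {j : ℕ} (h1 : j₀ ≤ j) (h2 : j < J)
    (hs : a (v j) * a (v (j + 1)) < 0) :
    SimpleCount (ofCoeffs a n) (fun x => ρ j < x ∧ x ≤ ρ (j + 1)) 1 := by
  have ha := h.ne_zero j h1 h2.le
  have ha' := h.ne_zero (j + 1) (by omega) h2
  have hvv := h.strictMono j h1 h2
  refine SimpleCount.one (w := ((v j : ℝ) + v (j + 1)) / 2) (c := a (v (j + 1)))
    (h.radius_pos j h1 h2.le) (h.radius_lt j h1 h2).le ?_ ?_ (h.mul_eval_pos (by omega) h2)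
  · intro x hx1 hx2
    have hx : 0 < x := (h.radius_pos j h1 h2.le).trans_le hx1
    set T := |a (v j)| * x ^ v j with hT
    set T' := |a (v (j + 1))| * x ^ v (j + 1) with hT'
    set w := ((v j : ℝ) + v (j + 1)) / 2 with hw
    have hTpos : 0 < T := by positivity
    have hTpos' : 0 < T' := by positivity
    have hM : max T T' ≤ T + T' := max_le (by linarith) (by linarith)
    have hvn : (v (j + 1) : ℝ) ≤ n := by exact_mod_cast h.v_le (by omega : j₀ ≤ j + 1) h2
    have hvv' : (v j : ℝ) + 1 ≤ v (j + 1) := by exact_mod_cast hvv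
    have hv0 : (0 : ℝ) ≤ v j := Nat.cast_nonneg _
    have hsum := sum_le (s := ((Finset.range (n + 1)).erase (v j)).erase (v (j + 1)))
      (b := fun k => (k - w) * (a k * x ^ k)) (M := max T T')
      ((Finset.erase_subset _ _).trans (Finset.erase_subset _ _)) h.pos h.small
      (le_max_of_le_left hTpos.le) (by
        intro k hk
        rw [Finset.mem_erase, Finset.mem_erase, Finset.mem_range] at hk
        have hkn : (k : ℝ) ≤ n := by exact_mod_cast (by omega : k ≤ n)
        have hk0 : (0 : ℝ) ≤ k := Nat.cast_nonneg _
        rw [abs_mul, abs_mul, abs_pow, abs_of_pos hx]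
        refine mul_le_mul ?_ (h.le_max h1 h2 hx1 hx2 (by omega) hk.2.1 hk.1) (by positivity)
          (by positivity)
        rw [abs_le]
        constructor <;> linarith)
    have heq : x * (ofCoeffs a n).derivative.eval x - w * (ofCoeffs a n).eval x =
        ∑ k ∈ Finset.range (n + 1), ((k : ℝ) - w) * (a k * x ^ k) := by
      rw [mul_eval_derivative_ofCoeffs, eval_ofCoeffs, Finset.mul_sum, ← Finset.sum_sub_distrib]
      exact Finset.sum_congr rfl fun k _ => by ring
    rw [heq, sum_pair_split hvv.ne (h.v_le h1 h2.le) (h.v_le (by omega) h2)]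
    set E := ∑ k ∈ ((Finset.range (n + 1)).erase (v j)).erase (v (j + 1)),
      ((k : ℝ) - w) * (a k * x ^ k)
    have e1 : a (v (j + 1)) * (a (v (j + 1)) * x ^ v (j + 1)) = |a (v (j + 1))| * T' := by
      rw [hT', ← mul_assoc, ← mul_assoc, abs_mul_abs_self]
    have e2 : a (v (j + 1)) * (a (v j) * x ^ v j) = -(|a (v (j + 1))| * T) := by
      rw [hT, ← mul_assoc, ← mul_assoc, ← abs_mul, mul_comm (a (v (j + 1))), abs_of_neg hs]
      ring
    have e3 : |a (v (j + 1)) * E| ≤ |a (v (j + 1))| * ((T + T') / 4) := by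
      rw [abs_mul]; gcongr; linarith
    have e4 := neg_abs_le (a (v (j + 1)) * E)
    have e5 : a (v (j + 1)) * ((↑(v j) - w) * (a (v j) * x ^ v j) +
        (↑(v (j + 1)) - w) * (a (v (j + 1)) * x ^ v (j + 1)) + E) =
        ((v (j + 1) : ℝ) - v j) / 2 * (|a (v (j + 1))| * (T + T')) + a (v (j + 1)) * E := by
      have : a (v (j + 1)) * ((↑(v j) - w) * (a (v j) * x ^ v j) +
        (↑(v (j + 1)) - w) * (a (v (j + 1)) * x ^ v (j + 1)) + E) =
        (↑(v j) - w) * (a (v (j + 1)) * (a (v j) * x ^ v j)) +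
        (↑(v (j + 1)) - w) * (a (v (j + 1)) * (a (v (j + 1)) * x ^ v (j + 1))) +
          a (v (j + 1)) * E := by ring
      rw [this, e1, e2, hw]; ring
    rw [e5]
    have e6 : 0 < |a (v (j + 1))| * (T + T') := by positivity
    nlinarith
  · have h3 := h.mul_eval_pos h1 h2.le
    have h4 : 0 < a (v j) * a (v j) := mul_self_pos.2 ha
    by_contra hcon
    rw [not_lt] at hcon
    have : (a (v j) * a (v (j + 1))) * (a (v j) * (ofCoeffs a n).eval (ρ j)) < 0 :=
      mul_neg_of_neg_of_pos hs h3
    have : 0 ≤ (a (v j) * a (v j)) * (a (v (j + 1)) * (ofCoeffs a n).eval (ρ j)) :=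
      mul_nonneg h4.le hcon
    linarith

/-- The roots in `(ρ_{j₀}, ∞)` are simple, and as many as there are sign changes along the
vertices. -/
theorem simpleCount_Ioi (h : Dominated a n v ρ j₀ J δ) :
    SimpleCount (ofCoeffs a n) (fun x => ρ j₀ < x)
      {j ∈ Finset.Ico j₀ J | a (v j) * a (v (j + 1)) < 0}.card := by
  have hmono : ∀ i, j₀ ≤ i → i ≤ J → ρ j₀ ≤ ρ i := by
    intro i hi
    induction i, hi using Nat.le_induction with
    | base => exact fun _ => le_rfl
    | succ i hi ih => exact fun h3 => (ih (by omega)).trans (h.radius_lt i hi h3).le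
  have key : ∀ i, j₀ ≤ i → i ≤ J → SimpleCount (ofCoeffs a n) (fun x => ρ j₀ < x ∧ x ≤ ρ i)
      {j ∈ Finset.Ico j₀ i | a (v j) * a (v (j + 1)) < 0}.card := by
    intro i hi
    induction i, hi using Nat.le_induction with
    | base =>
      intro _
      simp only [Finset.Ico_self, Finset.filter_empty, Finset.card_empty]
      exact SimpleCount.of_ne_zero fun x hx => absurd hx.1 (not_lt.2 hx.2)
    | succ i hi ih =>
      intro h3
      have hspl : ∀ x, (ρ j₀ < x ∧ x ≤ ρ (i + 1)) ↔
          (ρ j₀ < x ∧ x ≤ ρ i) ∨ (ρ i < x ∧ x ≤ ρ (i + 1)) := by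
        intro x
        have h4 := h.radius_lt i hi h3
        have h5 := hmono i hi (by omega)
        constructor
        · rintro ⟨h6, h7⟩
          rcases le_or_gt x (ρ i) with h8 | h8
          exacts [Or.inl ⟨h6, h8⟩, Or.inr ⟨h8, h7⟩]
        · rintro (⟨h6, h7⟩ | ⟨h6, h7⟩)
          exacts [⟨h6, h7.trans h4.le⟩, ⟨h5.trans_lt h6, h7⟩]
      rw [← Finset.insert_Ico_right_eq_Ico_add_one hi, Finset.filter_insert]
      split_ifs with hs
      · rw [Finset.card_insert_of_notMem (by simp)]
        exact (ih (by omega)).or (h.simpleCount_one hi h3 hs)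
          (fun x hx hx' => absurd hx'.1 (not_lt.2 hx.2)) hspl
      · exact (ih (by omega)).or (h.simpleCount_zero hi h3 hs)
          (fun x hx hx' => absurd hx'.1 (not_lt.2 hx.2)) hspl
  -- The last vertex n is the top exponent, so its domination at ρ_J persists at all larger x.
  have hlast : SimpleCount (ofCoeffs a n) (fun x => ρ J < x) 0 := by
    refine SimpleCount.of_ne_zero fun x hx h0 => ?_
    have hρ := h.radius_pos J h.le le_rfl
    have hx0 : 0 < x := hρ.trans hx
    have := mul_eval_ofCoeffs_pos (a := a) (h.v_le h.le le_rfl) hx0 h.pos h.small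
      (h.ne_zero J h.le le_rfl) (by
        intro k hk hkv
        have hd := h.dom J h.le le_rfl k hk hkv
        have hy : 1 ≤ x / ρ J := (one_le_div hρ).2 hx.le
        have hxy : x = ρ J * (x / ρ J) := by field_simp
        have hpos := h.pos
        rw [hxy, mul_pow, mul_pow, ← mul_assoc, ← mul_assoc, ← mul_assoc]
        rw [← mul_assoc] at hd
        refine mul_le_mul hd (pow_le_pow_right₀ hy (h.last ▸ hk)) (by positivity) (by positivity))
    rw [h0] at this
    simp at this
  have := (key J h.le le_rfl).or hlast (S := fun x => ρ j₀ < x)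
    (fun x hx hx' => absurd hx' (not_lt.2 hx.2)) (by
      intro x
      have h5 := hmono J h.le le_rfl
      constructor
      · intro h6
        rcases le_or_gt x (ρ J) with h8 | h8
        exacts [Or.inl ⟨h6, h8⟩, Or.inr h8]
      · rintro (h6 | h6)
        exacts [h6.1, h5.trans_lt h6])
  simpa using this

/-- There are at most `v_{j₀}` roots in `[-ρ_{j₀}, ρ_{j₀}]`. -/
theorem countP_le (h : Dominated a n v ρ j₀ J δ) :
    (ofCoeffs a n).roots.countP (fun x => -ρ j₀ ≤ x ∧ x ≤ ρ j₀) ≤ v j₀ := by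
  -- The Hasse derivative of order v_(j₀) has constant term a_(v_(j₀)), and this term dominates it
  -- on the whole interval.
  refine countP_roots_le_of_iterate_derivative_ne_zero _ _ _ _ fun x hx1 hx2 h0 => ?_
  rw [← factorial_smul_hasseDeriv, LinearMap.smul_apply, nsmul_eq_mul, eval_mul, eval_natCast] at h0
  have h0' := (mul_eq_zero.1 h0).resolve_left (by exact_mod_cast Nat.factorial_ne_zero _)
  set r := ρ j₀
  set u := v j₀
  have hr : 0 < r := h.radius_pos j₀ le_rfl h.le
  have hu : u ≤ n := h.v_le le_rfl h.le
  have ha : a u ≠ 0 := h.ne_zero j₀ le_rfl h.le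
  have hx : |x| ≤ r := abs_le.2 ⟨hx1, hx2⟩
  have hδ := h.pos
  have hsmall := h.small
  have hn0 : (0 : ℝ) ≤ n := Nat.cast_nonneg n
  rw [eval_hasseDeriv_ofCoeffs,
    ← Finset.add_sum_erase _ _ (Finset.mem_range.2 (Nat.lt_succ_of_le hu))] at h0'
  have hsum := sum_le (s := (Finset.range (n + 1)).erase u)
    (b := fun k => (k.choose u : ℝ) * a k * x ^ (k - u)) (M := |a u|)
    (Finset.erase_subset _ _) h.pos h.small (abs_nonneg _) (by
      intro k hk
      rw [Finset.mem_erase, Finset.mem_range] at hk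
      rcases lt_or_gt_of_ne hk.1 with hlt | hgt
      · rw [Nat.choose_eq_zero_of_lt hlt]
        simp only [Nat.cast_zero, zero_mul, abs_zero]
        positivity
      · have hd := h.dom_first k (by omega) hgt
        change |a k| * r ^ k ≤ δ ^ (k - u) * (|a u| * r ^ u) at hd
        obtain ⟨d, rfl⟩ : ∃ d, k = u + (d + 1) := ⟨k - u - 1, by omega⟩
        have hd' : |a (u + (d + 1))| * r ^ (d + 1) ≤ δ ^ (d + 1) * |a u| := by
          rw [Nat.add_sub_cancel_left, pow_add] at hd
          refine le_of_mul_le_mul_right ?_ (pow_pos hr u)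
          linarith
        -- The binomial coefficient may reach n^(d+1). This is why `dom_first` asks for geometric
        -- decay δ^(d+1), which leaves (n δ)^d ≤ 1.
        have hch : ((u + (d + 1)).choose u : ℝ) ≤ (n : ℝ) ^ (d + 1) := by
          rw [Nat.choose_symm_add]
          have := Nat.choose_le_pow (u + (d + 1)) (d + 1)
          calc ((u + (d + 1)).choose (d + 1) : ℝ) ≤ ((u + (d + 1) : ℕ) : ℝ) ^ (d + 1) := by
                exact_mod_cast this
            _ ≤ (n : ℝ) ^ (d + 1) := by
                gcongr; omega
        simp only [Nat.add_sub_cancel_left]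
        rw [abs_mul, abs_mul, abs_pow, Nat.abs_cast]
        calc ((u + (d + 1)).choose u : ℝ) * |a (u + (d + 1))| * |x| ^ (d + 1)
            ≤ (n : ℝ) ^ (d + 1) * |a (u + (d + 1))| * r ^ (d + 1) := by gcongr
          _ ≤ (n : ℝ) ^ (d + 1) * (δ ^ (d + 1) * |a u|) := by
            rw [mul_assoc]; gcongr
          _ = (n * δ) ^ d * (n * (δ * |a u|)) := by ring
          _ ≤ 1 * ((n + 1) * (δ * |a u|)) := by
            gcongr
            · refine pow_le_one₀ (by positivity) ?_
              nlinarith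
            · linarith
          _ = _ := one_mul _)
  simp only [Nat.choose_self, Nat.cast_one, one_mul, Nat.sub_self, pow_zero, mul_one] at h0'
  rw [eq_neg_of_add_eq_zero_right h0', abs_neg] at hsum
  have : 0 < |a u| := abs_pos.2 ha
  linarith

end Dominated

/-! ### Combining positive, negative and small roots; sign changes -/

theorem SimpleCount.card_filter {p : ℝ[X]} {Q : ℝ → Prop} {k : ℕ} (h : SimpleCount p Q k)
    [DecidablePred Q] : {x ∈ p.roots.toFinset | Q x}.card = k := by
  rw [← h.2, ← Multiset.toFinset_filter, Multiset.countP_eq_card_filter,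
    Multiset.toFinset_card_of_nodup]
  rw [Multiset.nodup_iff_count_le_one]
  intro x
  by_cases hx : Q x
  · rw [Multiset.count_filter_of_pos hx, count_roots]
    exact h.1 x hx
  · rw [Multiset.count_filter_of_neg hx]
    exact zero_le_one

theorem SimpleCount.of_comp_neg_X {p : ℝ[X]} {r : ℝ} {k : ℕ}
    (h : SimpleCount (p.comp (-X)) (fun x => r < x) k) : SimpleCount p (fun x => x < -r) k := by
  refine ⟨fun x hx => ?_, ?_⟩
  · have h1 := h.1 (-x) (by linarith)
    rw [← count_roots, roots_comp_neg_X,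
      Multiset.count_map_eq_count' (fun x : ℝ => -x) _ neg_injective x, count_roots] at h1
    exact h1
  · intro _
    rw [← h.2, roots_comp_neg_X, Multiset.countP_map, Multiset.countP_eq_card_filter]
    congr 1
    refine Multiset.filter_congr fun x _ => ?_
    constructor <;> intro h <;> linarith

theorem add_le_card_roots_toFinset {p : ℝ[X]} {r : ℝ} {k l : ℕ} (hr : 0 ≤ r)
    (h₁ : SimpleCount p (fun x => r < x) k) (h₂ : SimpleCount p (fun x => x < -r) l) :
    k + l ≤ p.roots.toFinset.card := by
  rw [← h₁.card_filter, ← h₂.card_filter, ← Finset.card_union_of_disjoint]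
  · exact Finset.card_le_card (Finset.union_subset (Finset.filter_subset _ _)
      (Finset.filter_subset _ _))
  · refine Finset.disjoint_filter.2 fun x _ h1 h2 => ?_
    linarith

theorem card_roots_eq {p : ℝ[X]} {r : ℝ} {k l : ℕ} (hr : 0 ≤ r)
    (h₁ : SimpleCount p (fun x => r < x) k) (h₂ : SimpleCount p (fun x => x < -r) l) :
    p.roots.card = p.roots.countP (fun x => -r ≤ x ∧ x ≤ r) + k + l := by
  rw [← h₁.2, ← h₂.2]
  generalize p.roots = s
  induction s using Multiset.induction_on with
  | empty => simp
  | cons x s ih =>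
    simp only [Multiset.countP_cons, Multiset.card_cons, ih]
    rcases lt_or_ge r x with h1 | h1 <;> rcases lt_or_ge x (-r) with h2 | h2
    · linarith
    · simp [h1, h2, not_le.2 h1, not_lt.2 h2]; omega
    · simp [h1, h2, not_le.2 h2, not_lt.2 h1]; omega
    · simp [h1, h2, not_lt.2 h2, not_lt.2 h1]; omega

/-- The number of sign changes of `u` between consecutive indices in `[i, j]`. -/
noncomputable def signChanges (u : ℕ → ℝ) (i j : ℕ) : ℕ :=
  {l ∈ Finset.Ico i j | u l * u (l + 1) < 0}.card

theorem signChanges_congr {u w : ℕ → ℝ} {i j : ℕ}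
    (h : ∀ l, i ≤ l → l < j → (u l * u (l + 1) < 0 ↔ w l * w (l + 1) < 0)) :
    signChanges u i j = signChanges w i j := by
  unfold signChanges
  congr 1
  refine Finset.filter_congr fun l hl => ?_
  rw [Finset.mem_Ico] at hl
  exact h l hl.1 hl.2

theorem signChanges_succ {u : ℕ → ℝ} {i j : ℕ} (h : i ≤ j) :
    signChanges u i j ≤ signChanges u i (j + 1) ∧
      signChanges u i (j + 1) ≤ signChanges u i j + 1 := by
  unfold signChanges
  rw [← Finset.insert_Ico_right_eq_Ico_add_one h, Finset.filter_insert]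
  split_ifs with hs
  · rw [Finset.card_insert_of_notMem (by simp)]
    omega
  · omega

theorem signChanges_add {u : ℕ → ℝ} {i j k : ℕ} (h : i ≤ j) (h' : j ≤ k) :
    signChanges u i k = signChanges u i j + signChanges u j k := by
  unfold signChanges
  rw [← Finset.Ico_union_Ico_eq_Ico h h', Finset.filter_union, Finset.card_union_of_disjoint]
  exact Finset.disjoint_filter_filter (Finset.Ico_disjoint_Ico_consecutive i j k)

theorem signChanges_le (u : ℕ → ℝ) (i j : ℕ) : signChanges u i j ≤ j - i :=
  (Finset.card_filter_le _ _).trans (by simp)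

/-- Roots beyond ρ_(j₀) are counted by the sign changes of a_(v_j), those below -ρ_(j₀) by the sign
changes of (-1)^(v_j) a_(v_j). By evenness the two sequences can differ only at the last vertex, so
the two counts differ by at most 1. The lower bound concerns distinct roots and the upper bound
roots with multiplicity, so both ways of counting are covered. -/
theorem Dominated.card_roots_bounds {a : ℕ → ℝ} {n : ℕ} {v : ℕ → ℕ} {ρ : ℕ → ℝ} {j₀ J : ℕ} {δ : ℝ}
    (h : Dominated a n v ρ j₀ J δ) (heven : ∀ j, j < J → Even (v j)) :
    2 * signChanges (fun j => a (v j)) j₀ J ≤ (ofCoeffs a n).roots.toFinset.card + 1 ∧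
    (ofCoeffs a n).roots.card ≤ 2 * signChanges (fun j => a (v j)) j₀ J + v j₀ + 1 := by
  have h₁ := h.simpleCount_Ioi
  have h₂ := h.alternate.simpleCount_Ioi
  rw [← comp_neg_X_ofCoeffs] at h₂
  have h₂' := h₂.of_comp_neg_X
  change SimpleCount _ _ (signChanges (fun j => a (v j)) j₀ J) at h₁
  change SimpleCount _ _ (signChanges (fun j => (-1) ^ v j * a (v j)) j₀ J) at h₂'
  have hr := (h.radius_pos j₀ le_rfl h.le).le
  have e1 := add_le_card_roots_toFinset hr h₁ h₂'
  have e2 := card_roots_eq hr h₁ h₂'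
  have e3 := h.countP_le
  have key : signChanges (fun j => a (v j)) j₀ J ≤
      signChanges (fun j => (-1) ^ v j * a (v j)) j₀ J + 1 ∧
      signChanges (fun j => (-1) ^ v j * a (v j)) j₀ J ≤
      signChanges (fun j => a (v j)) j₀ J + 1 := by
    rcases h.le.eq_or_lt with heq | hlt
    · subst heq
      simp [signChanges]
    · obtain ⟨K, rfl⟩ : ∃ K, J = K + 1 := ⟨J - 1, by omega⟩
      have hK : j₀ ≤ K := by omega
      have hcongr : signChanges (fun j => (-1) ^ v j * a (v j)) j₀ K =
          signChanges (fun j => a (v j)) j₀ K := by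
        refine signChanges_congr fun l _ hl => ?_
        rw [(heven l (by omega)).neg_one_pow, (heven (l + 1) (by omega)).neg_one_pow, one_mul,
          one_mul]
      have s1 := signChanges_succ (u := fun j => a (v j)) hK
      have s2 := signChanges_succ (u := fun j => (-1) ^ v j * a (v j)) hK
      omega
  omega

/-! ### Growth and separation of the slopes -/

/-- The slope `2 ^ l / (m_{l+1} - m_l)` of the `l`-th edge. -/
noncomputable def slope (α : ℝ) (l : ℕ) : ℝ := 2 ^ l / ((m α (l + 1) : ℝ) - m α l)

theorem gap_pos {α : ℝ} (h0 : 0 < α) (h1 : α < 1) (l : ℕ) : (1 : ℝ) ≤ (m α (l + 1) : ℝ) - m α l := by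
  have := m_strictMono h0 h1 (Nat.lt_succ_self l)
  have h : ((m α l : ℕ) : ℝ) + 1 ≤ m α (l + 1) := by exact_mod_cast this
  linarith

theorem slope_pos {α : ℝ} (h0 : 0 < α) (h1 : α < 1) (l : ℕ) : 0 < slope α l :=
  div_pos (by positivity) (zero_lt_one.trans_le (gap_pos h0 h1 l))

theorem slope_le {α : ℝ} (h0 : 0 < α) (h1 : α < 1) (l : ℕ) : slope α l ≤ 2 ^ l :=
  div_le_self (by positivity) (gap_pos h0 h1 l)

/-- Bernoulli's inequality for (1 + 1/x)^β; the upper bound that follows uses it for (1 -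
1/(x+1))^β. -/
theorem rpow_succ_sub_ge {β : ℝ} (hβ : 1 ≤ β) {x : ℝ} (hx : 0 < x) :
    β * x ^ (β - 1) ≤ (x + 1) ^ β - x ^ β := by
  have h := one_add_mul_self_le_rpow_one_add (s := 1 / x) (by have := one_div_pos.2 hx; linarith) hβ
  have h1 : (x + 1) ^ β = x ^ β * (1 + 1 / x) ^ β := by
    rw [← Real.mul_rpow hx.le (by positivity)]; congr 1; field_simp
  rw [h1, Real.rpow_sub_one hx.ne']
  have : 0 < x ^ β := Real.rpow_pos_of_pos hx _
  have h2 := mul_le_mul_of_nonneg_left h this.le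
  calc β * (x ^ β / x) = x ^ β * (1 + β * (1 / x)) - x ^ β := by ring
    _ ≤ _ := by linarith

theorem rpow_succ_sub_le {β : ℝ} (hβ : 1 ≤ β) {x : ℝ} (hx : 0 < x) :
    (x + 1) ^ β - x ^ β ≤ β * (x + 1) ^ (β - 1) := by
  have hx1 : 0 < x + 1 := by linarith
  have h := one_add_mul_self_le_rpow_one_add (s := -(1 / (x + 1)))
    (by rw [neg_le_neg_iff, div_le_one hx1]; linarith) hβ
  have h1 : x ^ β = (x + 1) ^ β * (1 + -(1 / (x + 1))) ^ β := by
    rw [← Real.mul_rpow hx1.le (by rw [← sub_eq_add_neg, sub_nonneg, div_le_one hx1]; linarith)]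
    congr 1; field_simp; ring
  rw [h1, Real.rpow_sub_one hx1.ne']
  have : 0 < (x + 1) ^ β := Real.rpow_pos_of_pos hx1 _
  have h2 := mul_le_mul_of_nonneg_left h this.le
  calc _ ≤ (x + 1) ^ β - (x + 1) ^ β * (1 + β * -(1 / (x + 1))) := by linarith
    _ = _ := by ring

/-- The slopes eventually grow geometrically. -/
theorem eventually_slope_ratio {α : ℝ} (h0 : 0 < α) (h1 : α < 1) :
    ∀ᶠ l : ℕ in atTop, 5 / 4 * slope α l ≤ slope α (l + 1) := by
  set β := 1 / α with hβ
  have hβ1 : 1 < β := by rw [hβ, lt_div_iff₀ h0]; linarith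
  have hlim : Tendsto (fun l : ℕ => β * (l : ℝ) ^ (β - 1)) atTop atTop :=
    Tendsto.const_mul_atTop (by linarith)
      ((tendsto_rpow_atTop (by linarith)).comp tendsto_natCast_atTop_atTop)
  have hratio : Tendsto (fun l : ℕ => (1 + 2 / (l : ℝ)) ^ (β - 1)) atTop (𝓝 1) := by
    have h2 : Tendsto (fun l : ℕ => 1 + 2 / (l : ℝ)) atTop (𝓝 1) := by
      simpa using (tendsto_const_div_atTop_nhds_zero_nat (2 : ℝ)).const_add (1 : ℝ)
    simpa using h2.rpow_const (p := β - 1) (Or.inl one_ne_zero)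
  -- With X = β l^(β-1) and one unit lost to the floors in each gap, the claim reduces to
  -- (5/4)·2((6/5)X + 1) ≤ 2·2(X - 1), that is X ≥ 13/2.
  filter_upwards [hlim.eventually_ge_atTop 7, hratio.eventually_le_const (by norm_num : (1 : ℝ) < 6 / 5),
    eventually_gt_atTop 0] with l hl1 hl2 hl0
  have hl0' : (0 : ℝ) < l := by exact_mod_cast hl0
  have d1 := rpow_succ_sub_ge hβ1.le hl0'
  have d2 := rpow_succ_sub_le hβ1.le (by linarith : (0 : ℝ) < l + 1)
  have d3 : ((l : ℝ) + 1 + 1) ^ (β - 1) ≤ 6 / 5 * (l : ℝ) ^ (β - 1) := by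
    have : (l : ℝ) + 1 + 1 = l * (1 + 2 / l) := by field_simp; ring
    rw [this, Real.mul_rpow hl0'.le (by positivity), mul_comm]
    gcongr
  have f0 := Nat.lt_floor_add_one ((l : ℝ) ^ β)
  have f0' := Nat.floor_le (Real.rpow_nonneg hl0'.le β)
  have f1 := Nat.lt_floor_add_one (((l : ℝ) + 1) ^ β)
  have f1' := Nat.floor_le (Real.rpow_nonneg (by linarith : (0 : ℝ) ≤ (l : ℝ) + 1) β)
  have f2' := Nat.floor_le (Real.rpow_nonneg (by linarith : (0 : ℝ) ≤ (l : ℝ) + 1 + 1) β)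
  have g1 := gap_pos h0 h1 l
  have g2 := gap_pos h0 h1 (l + 1)
  unfold slope
  rw [pow_succ, ← mul_div_assoc, div_le_div_iff₀ (by linarith) (by linarith)]
  have hp : (0 : ℝ) < 2 ^ l := by positivity
  have key : 5 / 4 * ((m α (l + 1 + 1) : ℝ) - m α (l + 1)) ≤
      2 * ((m α (l + 1) : ℝ) - m α l) := by
    have e0 : (m α l : ℝ) = 2 * (⌊(l : ℝ) ^ β⌋₊ : ℝ) := by simp [m, hβ]
    have e1 : (m α (l + 1) : ℝ) = 2 * (⌊((l : ℝ) + 1) ^ β⌋₊ : ℝ) := by simp [m, hβ]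
    have e2 : (m α (l + 1 + 1) : ℝ) = 2 * (⌊((l : ℝ) + 1 + 1) ^ β⌋₊ : ℝ) := by
      simp only [m, hβ]; push_cast; rfl
    rw [e0, e1, e2]
    have d4 : β * ((l : ℝ) + 1 + 1) ^ (β - 1) ≤ 6 / 5 * (β * (l : ℝ) ^ (β - 1)) := by
      nlinarith
    linarith
  nlinarith

/-- Consequences of the growth of the slopes used at scale `log n`. -/
theorem eventually_slope_gap {α : ℝ} (h0 : 0 < α) (h1 : α < 1) (K : ℝ) :
    ∀ᶠ n : ℕ in atTop, ∀ j, ⌊Real.log n⌋₊ ≤ j + 1 →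
      (∀ l ≤ j, slope α l ≤ slope α j) ∧
      ∀ l, j < l → slope α j + K * Real.log n ≤ slope α l := by
  obtain ⟨j₁, hj₁⟩ := eventually_atTop.1 (eventually_slope_ratio h0 h1)
  have hmono : ∀ j, j₁ ≤ j → ∀ l, j ≤ l → slope α j ≤ slope α l := by
    intro j hj l hl
    induction l, hl using Nat.le_induction with
    | base => exact le_rfl
    | succ i hi ih =>
      have h2 := hj₁ i (by omega)
      have h3 := slope_pos h0 h1 i
      linarith
  have hgrow : ∀ d, slope α j₁ * (5 / 4) ^ d ≤ slope α (j₁ + d) := by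
    intro d
    induction d with
    | zero => simp
    | succ d ih =>
      have h2 := hj₁ (j₁ + d) (by omega)
      calc slope α j₁ * (5 / 4) ^ (d + 1) = 5 / 4 * (slope α j₁ * (5 / 4) ^ d) := by ring
        _ ≤ 5 / 4 * slope α (j₁ + d) := by linarith
        _ ≤ _ := h2
  have hlog : Tendsto (fun n : ℕ => Real.log n) atTop atTop :=
    Real.tendsto_log_atTop.comp tendsto_natCast_atTop_atTop
  -- the geometric growth beats linear functions of the logarithm
  set A := slope α j₁ * (5 / 4) ^ (-((j₁ : ℝ) + 2)) with hA
  have hApos : 0 < A := mul_pos (slope_pos h0 h1 j₁) (by positivity)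
  -- One step raises the slope by a quarter at least, hence the factor 4. The term 2^(j₁) dominates
  -- the slopes of index below j₁, where monotonicity is not known. The shift j₁ + 2 in the exponent
  -- of A accounts for log n < j + 2.
  have hexp : ∀ᶠ y : ℝ in atTop, 4 * |K| * y + 2 ^ j₁ ≤ A * (5 / 4) ^ y := by
    have h2 : Tendsto (fun y : ℝ => y * Real.exp (-(Real.log (5 / 4) * y))) atTop (𝓝 0) := by
      have := Real.tendsto_pow_mul_exp_neg_atTop_nhds_zero 1
      have hc : 0 < Real.log (5 / 4) := Real.log_pos (by norm_num)
      have h3 := (this.comp (tendsto_id.const_mul_atTop hc)).const_mul (Real.log (5 / 4))⁻¹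
      rw [mul_zero] at h3
      refine h3.congr fun y => ?_
      simp only [Function.comp, id, pow_one]
      field_simp
    have h4 : Tendsto (fun y : ℝ => Real.exp (-(Real.log (5 / 4) * y))) atTop (𝓝 0) := by
      have hc : 0 < Real.log (5 / 4) := Real.log_pos (by norm_num)
      exact Real.tendsto_exp_neg_atTop_nhds_zero.comp (tendsto_id.const_mul_atTop hc)
    have h5 := (h2.const_mul (4 * |K|)).add (h4.const_mul (2 ^ j₁))
    simp only [mul_zero, add_zero] at h5
    filter_upwards [h5.eventually_le_const hApos] with y hy
    have e1 : (5 / 4 : ℝ) ^ y = Real.exp (Real.log (5 / 4) * y) :=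
      Real.rpow_def_of_pos (by norm_num) y
    rw [e1]
    rw [Real.exp_neg] at hy
    have hpos := Real.exp_pos (Real.log (5 / 4) * y)
    have := mul_le_mul_of_nonneg_right hy hpos.le
    rw [add_mul] at this
    field_simp at this
    rw [mul_comm (Real.log (5 / 4)) y]
    linarith
  filter_upwards [hlog.eventually hexp, hlog.eventually_ge_atTop ((j₁ : ℝ) + 3)] with n hn hn2 j hj
  have hlj : Real.log n < j + 2 := by
    have := Nat.lt_floor_add_one (Real.log n)
    have h3 : (⌊Real.log n⌋₊ : ℝ) ≤ j + 1 := by exact_mod_cast hj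
    linarith
  have hjj₁ : j₁ ≤ j := by
    have : (j₁ : ℝ) ≤ j := by linarith
    exact_mod_cast this
  have hbig : 4 * |K| * Real.log n + 2 ^ j₁ ≤ slope α j := by
    refine hn.trans ?_
    obtain ⟨d, rfl⟩ := Nat.exists_eq_add_of_le hjj₁
    refine le_trans ?_ (hgrow d)
    rw [hA, mul_assoc, ← Real.rpow_add (by norm_num), ← Real.rpow_natCast]
    have hs := (slope_pos h0 h1 j₁).le
    refine mul_le_mul_of_nonneg_left (Real.rpow_le_rpow_of_exponent_le (by norm_num) ?_) hs
    push_cast at hlj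
    linarith
  have hlog0 : 0 ≤ Real.log n := by
    have : (0 : ℝ) ≤ j₁ := Nat.cast_nonneg _
    linarith
  have hK : K * Real.log n ≤ |K| * Real.log n :=
    mul_le_mul_of_nonneg_right (le_abs_self K) hlog0
  have hK' : 0 ≤ |K| * Real.log n := by positivity
  have h2j : (0 : ℝ) < 2 ^ j₁ := by positivity
  constructor
  · intro l hl
    rcases le_or_gt j₁ l with h | h
    · exact hmono l h j hl
    · refine (slope_le h0 h1 l).trans (le_trans ?_ hbig)
      have : (2 : ℝ) ^ l ≤ 2 ^ j₁ := pow_le_pow_right₀ (by norm_num) h.le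
      linarith
  · intro l hl
    refine le_trans ?_ (hmono (j + 1) (by omega) l hl)
    have := hj₁ j hjj₁
    linarith

/-! ### Blocks and vertices -/

/-- The vertices `m_0, …, m_{j_* - 1}, n` of the Newton polygon of `f_n`. -/
noncomputable def vertex (α : ℝ) (n j : ℕ) : ℕ := if j < jStar α n then m α j else n

section Vertex

variable {α : ℝ} (h0 : 0 < α) (h1 : α < 1)
include h0 h1

theorem le_m_blockIndex (k : ℕ) : k ≤ m α (blockIndex α k) := by
  have h := (mem_block_iff h0 h1 k _).2 rfl
  rcases hb : blockIndex α k with _ | i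
  · rw [hb] at h; exact h
  · rw [hb] at h; exact h.2

theorem m_lt_of_lt_blockIndex {i k : ℕ} (hi : i < blockIndex α k) : m α i < k := by
  have h := (mem_block_iff h0 h1 k _).2 rfl
  rcases hb : blockIndex α k with _ | j
  · omega
  · rw [hb] at h hi
    exact ((m_strictMono h0 h1).monotone (by omega : i ≤ j)).trans_lt h.1

theorem blockIndex_eq_of_lt {i k : ℕ} (h : m α i < k) (h' : k ≤ m α (i + 1)) :
    blockIndex α k = i + 1 :=
  (mem_block_iff h0 h1 k (i + 1)).1 ⟨h, h'⟩

theorem blockIndex_m (i : ℕ) : blockIndex α (m α i) = i := by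
  rw [← mem_block_iff h0 h1]
  rcases i with _ | i
  · exact le_refl (m α 0)
  · exact ⟨m_strictMono h0 h1 (Nat.lt_succ_self i), le_rfl⟩

theorem blockIndex_mono {k n : ℕ} (h : k ≤ n) : blockIndex α k ≤ blockIndex α n := by
  by_contra hcon
  have h2 := m_lt_of_lt_blockIndex h0 h1 (not_le.1 hcon)
  have h3 := le_m_blockIndex h0 h1 n
  omega

theorem le_m_jStar (n : ℕ) : n ≤ m α (jStar α n) := by
  rw [(isGreatest_jStar h0 h1 n).2]; exact le_m_blockIndex h0 h1 n

theorem m_lt_of_lt_jStar {i n : ℕ} (hi : i < jStar α n) : m α i < n := by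
  rw [(isGreatest_jStar h0 h1 n).2] at hi; exact m_lt_of_lt_blockIndex h0 h1 hi

theorem vertex_le_m {n j : ℕ} (hj : j ≤ jStar α n) : vertex α n j ≤ m α j := by
  unfold vertex
  split_ifs with h
  · exact le_rfl
  · obtain rfl : j = jStar α n := by omega
    exact le_m_jStar h0 h1 n

theorem vertex_lt {n j : ℕ} (hj : j < jStar α n) : vertex α n j < vertex α n (j + 1) := by
  unfold vertex
  rw [if_pos hj]
  split_ifs with h
  · exact m_strictMono h0 h1 (Nat.lt_succ_self j)
  · exact m_lt_of_lt_jStar h0 h1 hj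

theorem blockIndex_vertex {n j : ℕ} (hj : j ≤ jStar α n) : blockIndex α (vertex α n j) = j := by
  unfold vertex
  split_ifs with h
  · exact blockIndex_m h0 h1 j
  · rw [← (isGreatest_jStar h0 h1 n).2]; omega

theorem le_vertex_blockIndex {n k : ℕ} (hk : k ≤ n) : k ≤ vertex α n (blockIndex α k) := by
  unfold vertex
  split_ifs
  · exact le_m_blockIndex h0 h1 k
  · exact hk

/-- Only the last edge differs from the full one: it stops at n ≤ m_(j_*), so it is shorter and at
least as steep. -/
theorem slope_le_vertex {n l : ℕ} (hl : l < jStar α n) :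
    slope α l ≤ 2 ^ l / ((vertex α n (l + 1) : ℝ) - vertex α n l) := by
  have h2 : (vertex α n l : ℝ) + 1 ≤ vertex α n (l + 1) := by exact_mod_cast vertex_lt h0 h1 hl
  have h3 : (vertex α n (l + 1) : ℝ) ≤ m α (l + 1) := by
    exact_mod_cast vertex_le_m h0 h1 (by omega)
  have h4 : vertex α n l = m α l := if_pos hl
  unfold slope
  rw [h4] at h2 ⊢
  gcongr
  linarith

omit h0 h1 in
theorem vertex_slope_eq {n l : ℕ} (hl : l + 1 < jStar α n) :
    2 ^ l / ((vertex α n (l + 1) : ℝ) - vertex α n l) = slope α l := by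
  unfold slope vertex
  rw [if_pos hl, if_pos (by omega)]

/-- If j_* ≤ log n, then n ≤ m_(j_*) ≤ 2 (log n)^(1/α), which fails for large n. -/
theorem eventually_floor_log_lt_jStar :
    ∀ᶠ n : ℕ in atTop, 1 ≤ ⌊Real.log n⌋₊ ∧ ⌊Real.log n⌋₊ ≤ jStar α n := by
  have hlog : Tendsto (fun n : ℕ => Real.log n) atTop atTop :=
    Real.tendsto_log_atTop.comp tendsto_natCast_atTop_atTop
  have hlim : ∀ᶠ y : ℝ in atTop, 2 * y ^ (1 / α) < Real.exp y := by
    have := (isLittleO_rpow_exp_atTop (1 / α)).bound (c := 1 / 4) (by norm_num)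
    filter_upwards [this, eventually_gt_atTop 0] with y hy hy0
    rw [Real.norm_of_nonneg (Real.rpow_nonneg hy0.le _), Real.norm_of_nonneg (Real.exp_pos y).le]
      at hy
    have := Real.exp_pos y
    linarith
  filter_upwards [hlog.eventually hlim, hlog.eventually_ge_atTop 1, eventually_gt_atTop 0]
    with n hn hn1 hn0
  have hn0' : (0 : ℝ) < n := by exact_mod_cast hn0
  rw [Real.exp_log hn0'] at hn
  refine ⟨Nat.le_floor (by simpa using hn1), ?_⟩
  by_contra hcon
  have h2 : (jStar α n : ℝ) ≤ Real.log n := by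
    have h3 : (jStar α n : ℝ) ≤ ⌊Real.log n⌋₊ := by exact_mod_cast (not_le.1 hcon).le
    exact h3.trans (Nat.floor_le (by linarith))
  have h3 : (n : ℝ) ≤ m α (jStar α n) := by exact_mod_cast le_m_jStar h0 h1 n
  have h4 : (m α (jStar α n) : ℝ) ≤ 2 * (jStar α n : ℝ) ^ (1 / α) := by
    simp only [m]; push_cast
    have := Nat.floor_le (Real.rpow_nonneg (Nat.cast_nonneg (jStar α n)) (1 / α))
    linarith
  have h5 : (jStar α n : ℝ) ^ (1 / α) ≤ Real.log n ^ (1 / α) :=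
    Real.rpow_le_rpow (Nat.cast_nonneg _) h2 (one_div_pos.2 h0).le
  linarith

end Vertex

/-! ### Domination at the vertices and the deterministic root count -/

/-- Convexity: at a slope `t` separated by `D` from the slopes of the polygon with vertices
`(v_i, 2 ^ i)`, the vertex `v_j` is optimal with a margin. -/
theorem polygon_margin {v : ℕ → ℕ} {J j b k : ℕ} {t D : ℝ} (hD : 0 ≤ D) (hDt : D ≤ t)
    (hlow : ∀ l < j, 2 ^ l ≤ ((v (l + 1) : ℝ) - v l) * (t - D))
    (hhigh : ∀ l, j ≤ l → l < J → ((v (l + 1) : ℝ) - v l) * (t + D) ≤ 2 ^ l)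
    (hb : b ≤ J) (hkb : k ≤ v b) (hbj : j < b → v j ≤ k) (hbj' : b ≤ j → k ≤ v j) :
    -(2 : ℝ) ^ b + k * t ≤ -(2 : ℝ) ^ j + v j * t - D * |(k : ℝ) - v j| := by
  have hkb' : (k : ℝ) ≤ v b := by exact_mod_cast hkb
  rcases le_or_gt b j with hle | hlt
  · have key : ∀ i, b ≤ i → i ≤ j →
        -(2 : ℝ) ^ b + v b * t ≤ -(2 : ℝ) ^ i + v i * t - D * ((v i : ℝ) - v b) := by
      intro i hi
      induction i, hi using Nat.le_induction with
      | base => intro _; simp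
      | succ i hi ih =>
        intro h3
        have := ih (by omega)
        have := hlow i (by omega)
        rw [pow_succ]
        linarith
    have h2 := key j hle le_rfl
    have h3 : (k : ℝ) ≤ v j := by exact_mod_cast hbj' hle
    rw [abs_of_nonpos (by linarith)]
    nlinarith
  · have key : ∀ i, j ≤ i → i ≤ J →
        -(2 : ℝ) ^ i + v i * t ≤ -(2 : ℝ) ^ j + v j * t - D * ((v i : ℝ) - v j) := by
      intro i hi
      induction i, hi using Nat.le_induction with
      | base => intro _; simp
      | succ i hi ih =>
        intro h3
        have := ih (by omega)
        have := hhigh i hi (by omega)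
        rw [pow_succ]
        linarith
    have h2 := key b hlt.le hb
    have h3 : (v j : ℝ) ≤ k := by exact_mod_cast hbj hlt
    rw [abs_of_nonneg (by linarith)]
    nlinarith

/-- The logarithms of the separating radii. -/
noncomputable def logRadius (α D : ℝ) (n j : ℕ) : ℝ :=
  2 ^ (j - 1) / ((vertex α n (j - 1 + 1) : ℝ) - vertex α n (j - 1)) + D

/-- The logarithm of the radius ρ_j is the slope of the edge entering v_j plus D = (2A+4) log n.
Later slopes exceed the entering one by 2D, so it lies at distance at least D from the slopes on
either side; the last vertex, with no leaving edge, needs no separate treatment. `polygon_margin`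
then yields the margin D |k - v_j|: of it, 2A log n pays for the sizes of two coefficients, and the
remaining 4 log n gives δ = n^(-4). -/
theorem eventually_dominated {α : ℝ} (h0 : 0 < α) (h1 : α < 1) {A : ℝ} (hA : 0 ≤ A) :
    ∀ᶠ n : ℕ in atTop, ∀ e : ℕ → ℝ,
      (∀ k ≤ n, Real.exp (-(A * Real.log n)) ≤ |e k| ∧ |e k| ≤ Real.exp (A * Real.log n)) →
      Dominated (fun k => coeff α k * e k) n (vertex α n)
        (fun j => Real.exp (logRadius α ((2 * A + 4) * Real.log n) n j))
        ⌊Real.log n⌋₊ (jStar α n) (Real.exp (-(4 * Real.log n))) := by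
  filter_upwards [eventually_slope_gap h0 h1 (2 * (2 * A + 4)),
    eventually_floor_log_lt_jStar h0 h1, eventually_ge_atTop 3] with n hslope hfl hn3 e he
  obtain ⟨hfl1, hflJ⟩ := hfl
  set j₀ := ⌊Real.log n⌋₊ with hj₀
  set J := jStar α n with hJ
  set v := vertex α n with hv
  set D := (2 * A + 4) * Real.log n with hD
  have hlogpos : 0 < Real.log n := Real.log_pos (by exact_mod_cast (by omega : 1 < n))
  have hDpos : 0 < D := by positivity
  have hvlt : ∀ l, l < J → (v l : ℝ) + 1 ≤ v (l + 1) := fun l hl => by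
    exact_mod_cast vertex_lt h0 h1 hl
  have hvmono : ∀ i, ∀ l, i ≤ l → l ≤ J → v i ≤ v l := by
    intro i l hi
    induction l, hi using Nat.le_induction with
    | base => exact fun _ => le_rfl
    | succ l hl ih => exact fun h3 => (ih (by omega)).trans (vertex_lt h0 h1 h3).le
  set t := logRadius α D n with ht
  have htj : ∀ j, j₀ ≤ j → t j = 2 ^ (j - 1) / ((v (j - 1 + 1) : ℝ) - v (j - 1)) + D :=
    fun j _ => rfl
  -- separation of the slopes
  have hlow : ∀ j, j₀ ≤ j → j ≤ J → ∀ l < j, 2 ^ l ≤ ((v (l + 1) : ℝ) - v l) * (t j - D) := by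
    intro j hj hjJ l hl
    have hg := hvlt l (by omega)
    rw [mul_comm, ← div_le_iff₀ (by linarith), htj j hj, add_sub_cancel_right]
    -- Only the entering edge can be the truncated one that ends at n; earlier edges have their full
    -- length.
    rcases (by omega : l = j - 1 ∨ l + 1 < j) with h | h
    · rw [h]
    · rw [vertex_slope_eq (by omega)]
      refine ((hslope (j - 1) (by omega)).1 l (by omega)).trans ?_
      exact slope_le_vertex h0 h1 (by omega)
  have hhigh' : ∀ j, j₀ ≤ j → ∀ l, j ≤ l → l < J →
      t j + D ≤ 2 ^ l / ((v (l + 1) : ℝ) - v l) := by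
    intro j hj l hl hlJ
    rw [htj j hj, vertex_slope_eq (by omega)]
    have h2 := (hslope (j - 1) (by omega)).2 l (by omega)
    have h3 := slope_le_vertex h0 h1 hlJ
    linarith
  have hhigh : ∀ j, j₀ ≤ j → ∀ l, j ≤ l → l < J → ((v (l + 1) : ℝ) - v l) * (t j + D) ≤ 2 ^ l := by
    intro j hj l hl hlJ
    have hg := hvlt l hlJ
    rw [mul_comm, ← le_div_iff₀ (by linarith)]
    exact hhigh' j hj l hl hlJ
  have htD : ∀ j, j₀ ≤ j → j ≤ J → D ≤ t j := by
    intro j hj hjJ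
    rw [htj j hj]
    have hg := hvlt (j - 1) (by omega)
    have : (0 : ℝ) ≤ 2 ^ (j - 1) / ((v (j - 1 + 1) : ℝ) - v (j - 1)) :=
      div_nonneg (by positivity) (by linarith)
    linarith
  -- comparison of the terms
  have habs : ∀ k x, |coeff α k * e k| * x = Real.exp (-(2 : ℝ) ^ blockIndex α k) * |e k| * x := by
    intro k x
    rw [abs_mul, coeff, abs_of_pos (Real.exp_pos _)]
  have hexp : ∀ (s : ℝ) (k : ℕ), Real.exp s ^ k = Real.exp (k * s) := fun s k => (Real.exp_nat_mul s k).symm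
  have hterm : ∀ (k l : ℕ) (s E : ℝ), k ≤ n → l ≤ n →
      -(2 : ℝ) ^ blockIndex α k + k * s ≤ -(2 : ℝ) ^ blockIndex α l + l * s - E →
      |coeff α k * e k| * Real.exp s ^ k ≤
        Real.exp (2 * (A * Real.log n) - E) * (|coeff α l * e l| * Real.exp s ^ l) := by
    intro k l s E hk hl hle
    rw [habs, habs, hexp, hexp]
    have e1 := (he k hk).2
    have e2 := (he l hl).1
    calc Real.exp (-(2 : ℝ) ^ blockIndex α k) * |e k| * Real.exp (k * s)
        ≤ Real.exp (-(2 : ℝ) ^ blockIndex α k) * Real.exp (A * Real.log n) * Real.exp (k * s) := by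
          gcongr
      _ ≤ Real.exp (2 * (A * Real.log n) - E) * (Real.exp (-(2 : ℝ) ^ blockIndex α l) *
            Real.exp (-(A * Real.log n)) * Real.exp (l * s)) := by
          simp only [← Real.exp_add]
          apply Real.exp_le_exp.2
          linarith
      _ ≤ _ := by gcongr
  have hvn : ∀ j, j ≤ J → v j ≤ n := by
    intro j hj
    have := hvmono j J hj le_rfl
    rwa [show v J = n from if_neg (lt_irrefl _)] at this
  have hblockv : ∀ j, j ≤ J → blockIndex α (v j) = j := fun j hj => blockIndex_vertex h0 h1 hj
  have hblockle : ∀ k ≤ n, blockIndex α k ≤ J := by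
    intro k hk
    rw [hJ, (isGreatest_jStar h0 h1 n).2]
    exact blockIndex_mono h0 h1 hk
  have hdom : ∀ j, j₀ ≤ j → j ≤ J → ∀ k ≤ n, |coeff α k * e k| * Real.exp (t j) ^ k ≤
      Real.exp (2 * (A * Real.log n) - D * |(k : ℝ) - v j|) *
        (|coeff α (v j) * e (v j)| * Real.exp (t j) ^ v j) := by
    intro j hj hjJ k hk
    refine hterm k (v j) (t j) _ hk (hvn j hjJ) ?_
    rw [hblockv j hjJ]
    refine polygon_margin hDpos.le (htD j hj hjJ) (hlow j hj hjJ) (hhigh j hj) (hblockle k hk)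
      (le_vertex_blockIndex h0 h1 hk) ?_ ?_
    · intro hlt
      refine (vertex_le_m h0 h1 hjJ).trans ?_
      exact (m_lt_of_lt_blockIndex h0 h1 hlt).le
    · intro hle
      exact (le_vertex_blockIndex h0 h1 hk).trans (hvmono _ _ hle hjJ)
  have hδd : ∀ (d : ℕ) (x : ℝ), 1 ≤ d → (d : ℝ) ≤ x →
      Real.exp (2 * (A * Real.log n) - D * x) ≤ Real.exp (-(4 * Real.log n)) ^ d := by
    intro d x hd hdx
    rw [hexp]
    apply Real.exp_le_exp.2
    have hd' : (1 : ℝ) ≤ d := by exact_mod_cast hd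
    have : D * d ≤ D * x := mul_le_mul_of_nonneg_left hdx hDpos.le
    have h3 : 0 ≤ A * Real.log n := by positivity
    rw [hD] at *
    nlinarith
  refine ⟨hflJ, fun j _ hj => vertex_lt h0 h1 hj, if_neg (lt_irrefl _), fun j _ _ => Real.exp_pos _,
    ?_, ?_, ?_, ?_, ?_, Real.exp_pos _, ?_⟩
  · intro j hj hjJ
    apply Real.exp_lt_exp.2
    have h2 := hhigh' j hj j le_rfl hjJ
    have h3 : t (j + 1) = 2 ^ j / ((v (j + 1) : ℝ) - v j) + D := htj (j + 1) (by omega)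
    change t j < t (j + 1)
    linarith
  · intro j hj hjJ
    have := (he _ (hvn j hjJ)).1
    have h3 := Real.exp_pos (-(A * Real.log n))
    exact mul_ne_zero (Real.exp_pos _).ne' (abs_pos.1 (h3.trans_le this))
  · intro j hj hjJ k hk hkv
    refine (hdom j hj hjJ k hk).trans ?_
    refine mul_le_mul_of_nonneg_right ?_ (by positivity)
    have := hδd 1 |(k : ℝ) - v j| le_rfl ?_
    · simpa using this
    · have : (1 : ℤ) ≤ |(k : ℤ) - v j| := Int.one_le_abs (by omega)
      push_cast
      exact_mod_cast this
  · intro k hk hkv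
    refine (hdom j₀ le_rfl hflJ k hk).trans ?_
    refine mul_le_mul_of_nonneg_right (hδd _ _ (by omega) ?_) (by positivity)
    rw [Nat.cast_sub hkv.le]
    exact le_abs_self _
  · intro j hj hjJ k hk1 hk2 x hx
    have hx0 : 0 < x := (Real.exp_pos _).trans_le hx
    have hs : t j ≤ Real.log x := (Real.le_log_iff_exp_le hx0).2 hx
    have hbk : blockIndex α k = j + 1 := by
      refine blockIndex_eq_of_lt h0 h1 ?_ (hk2.le.trans (vertex_le_m h0 h1 hjJ))
      rwa [show v j = m α j from if_pos hjJ] at hk1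
    have hkn : k ≤ n := hk2.le.trans (hvn _ hjJ)
    -- Here k and v_(j+1) lie in the same block, so the heights cancel, and log x ≥ t_j ≥ D gives
    -- the margin D from a single extra power of x.
    have h2 := hterm k (v (j + 1)) (Real.log x) D hkn (hvn _ hjJ) (by
      rw [hblockv (j + 1) hjJ, hbk]
      have h3 : (k : ℝ) + 1 ≤ v (j + 1) := by exact_mod_cast hk2
      have h4 := htD j hj hjJ.le
      have h5 : Real.log x ≤ ((v (j + 1) : ℝ) - k) * Real.log x :=
        le_mul_of_one_le_left (by linarith) (by linarith)
      linarith)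
    rw [Real.exp_log hx0] at h2
    refine h2.trans (mul_le_mul_of_nonneg_right ?_ (by positivity))
    apply Real.exp_le_exp.2
    rw [hD]; linarith
  · have hn0 : (0 : ℝ) < n := by exact_mod_cast (by omega : 0 < n)
    have e4 : Real.exp (4 * Real.log n) = (n : ℝ) ^ 4 := by
      rw [show (4 : ℝ) * Real.log n = ((4 : ℕ) : ℝ) * Real.log n by norm_num, Real.exp_nat_mul,
        Real.exp_log hn0]
    rw [Real.exp_neg, e4, ← div_eq_mul_inv, div_le_one (by positivity)]
    have h3 : (3 : ℝ) ≤ n := by exact_mod_cast hn3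
    have h4 : (n : ℝ) + 1 ≤ 4 / 3 * n := by linarith
    have h5 : ((n : ℝ) + 1) ^ 2 ≤ (4 / 3 * n) ^ 2 := by gcongr
    have h6 : (9 : ℝ) ≤ n ^ 2 := by nlinarith
    nlinarith

/-- Deterministic root count: if the coefficients are of polynomial size, then the number of real
roots is twice the number of sign changes along the vertices, up to `3 (log n) ^ (1 / α)`. -/
theorem eventually_abs_card_roots_sub_le {α : ℝ} (h0 : 0 < α) (h1 : α < 1) {A : ℝ} (hA : 0 ≤ A) :
    ∀ᶠ n : ℕ in atTop, ∀ e : ℕ → ℝ,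
      (∀ k ≤ n, Real.exp (-(A * Real.log n)) ≤ |e k| ∧ |e k| ≤ Real.exp (A * Real.log n)) →
      ∀ N : ℕ, (ofCoeffs (fun k => coeff α k * e k) n).roots.toFinset.card ≤ N →
        N ≤ (ofCoeffs (fun k => coeff α k * e k) n).roots.card →
        |(N : ℝ) - 2 * (signChanges (fun j => e (vertex α n j)) 0 (jStar α n) : ℝ)| ≤
          3 * Real.log n ^ (1 / α) := by
  have hlog : Tendsto (fun n : ℕ => Real.log n) atTop atTop :=
    Real.tendsto_log_atTop.comp tendsto_natCast_atTop_atTop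
  filter_upwards [eventually_dominated h0 h1 hA, eventually_floor_log_lt_jStar h0 h1,
    hlog.eventually_ge_atTop 1] with n hn hfl hlog1 e he N hN1 hN2
  have hd := hn e he
  obtain ⟨b1, b2⟩ := hd.card_roots_bounds (by
    intro j hj
    rw [show vertex α n j = m α j from if_pos hj]
    exact even_two_mul _)
  have hsc : signChanges (fun j => coeff α (vertex α n j) * e (vertex α n j)) ⌊Real.log n⌋₊
      (jStar α n) = signChanges (fun j => e (vertex α n j)) ⌊Real.log n⌋₊ (jStar α n) := by
    refine signChanges_congr fun l _ _ => ?_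
    have hc : ∀ k, 0 < coeff α k := fun k => Real.exp_pos _
    rw [mul_mul_mul_comm]
    exact ⟨fun h => (pos_iff_neg_of_mul_neg h).1 (mul_pos (hc _) (hc _)),
      fun h => mul_neg_of_pos_of_neg (mul_pos (hc _) (hc _)) h⟩
  rw [hsc] at b1 b2
  have hadd := signChanges_add (u := fun j => e (vertex α n j)) (Nat.zero_le ⌊Real.log n⌋₊) hfl.2
  have hle := signChanges_le (fun j => e (vertex α n j)) 0 ⌊Real.log n⌋₊
  have hβ : 1 ≤ 1 / α := by rw [le_div_iff₀ h0]; linarith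
  have hL1 : (1 : ℝ) ≤ Real.log n ^ (1 / α) := Real.one_le_rpow hlog1 (by linarith)
  have hL2 : Real.log n ≤ Real.log n ^ (1 / α) := by
    conv_lhs => rw [← Real.rpow_one (Real.log n)]
    exact Real.rpow_le_rpow_of_exponent_le hlog1 hβ
  have hfl0 : (⌊Real.log n⌋₊ : ℝ) ≤ Real.log n := Nat.floor_le (by linarith)
  have hv : (vertex α n ⌊Real.log n⌋₊ : ℝ) ≤ 2 * Real.log n ^ (1 / α) := by
    have h2 : (vertex α n ⌊Real.log n⌋₊ : ℝ) ≤ m α ⌊Real.log n⌋₊ := by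
      exact_mod_cast vertex_le_m h0 h1 hfl.2
    have h3 : (m α ⌊Real.log n⌋₊ : ℝ) ≤ 2 * (⌊Real.log n⌋₊ : ℝ) ^ (1 / α) := by
      simp only [m]; push_cast
      have := Nat.floor_le (Real.rpow_nonneg (Nat.cast_nonneg ⌊Real.log n⌋₊) (1 / α))
      linarith
    have h4 : (⌊Real.log n⌋₊ : ℝ) ^ (1 / α) ≤ Real.log n ^ (1 / α) :=
      Real.rpow_le_rpow (Nat.cast_nonneg _) hfl0 (by linarith)
    linarith
  set S := signChanges (fun j => e (vertex α n j)) 0 (jStar α n)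
  set S₀ := signChanges (fun j => e (vertex α n j)) 0 ⌊Real.log n⌋₊
  -- The sign changes before index ⌊log n⌋ are not seen by the root count, and there are at most
  -- ⌊log n⌋ of them. The deviations 1 + 2 log n below and 1 + 2 (log n)^(1/α) above both fit into 3
  -- (log n)^(1/α).
  have c1 : 2 * S ≤ N + 1 + 2 * ⌊Real.log n⌋₊ := by omega
  have c2 : N ≤ 2 * S + vertex α n ⌊Real.log n⌋₊ + 1 := by omega
  have c1' : 2 * (S : ℝ) ≤ N + 1 + 2 * ⌊Real.log n⌋₊ := by exact_mod_cast c1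
  have c2' : (N : ℝ) ≤ 2 * S + vertex α n ⌊Real.log n⌋₊ + 1 := by exact_mod_cast c2
  rw [abs_le]
  constructor <;> linarith

/-! ### Changes in a Bernoulli sequence: martingale part, variance, strong law -/

variable {Ω : Type*} [MeasurableSpace Ω]

/-- A function of `X 0, …, X J` is independent of `X (J + 1)`. -/
theorem indepFun_past {P : Measure Ω} {X : ℕ → Ω → ℝ} (hX : ∀ i, Measurable (X i))
    (hind : iIndepFun X P) (J : ℕ) {E : Type*} [MeasurableSpace E] {Φ : (ℕ → ℝ) → E}
    (hΦ : Measurable Φ) (hdep : ∀ x y : ℕ → ℝ, (∀ i ≤ J, x i = y i) → Φ x = Φ y) :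
    IndepFun (fun ω => Φ (fun i => X i ω)) (X (J + 1)) P := by
  have h := hind.indepFun_finset (Finset.range (J + 1)) {J + 1} (by simp) hX
  -- Independence is available for finite tuples; extending a tuple by zero is harmless because Φ
  -- ignores later coordinates.
  let ext : (Finset.range (J + 1) → ℝ) → ℕ → ℝ :=
    fun u i => if hi : i ∈ Finset.range (J + 1) then u ⟨i, hi⟩ else 0
  have hext : Measurable ext := by
    refine measurable_pi_lambda _ fun i => ?_
    by_cases hi : i ∈ Finset.range (J + 1)
    · simp only [ext, dif_pos hi]; exact measurable_pi_apply _
    · simp only [ext, dif_neg hi]; exact measurable_const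
  have h2 := h.comp (hΦ.comp hext)
    (measurable_pi_apply (⟨J + 1, Finset.mem_singleton_self _⟩ : ({J + 1} : Finset ℕ)))
  have e1 : (fun ω => Φ (fun i => X i ω)) =
      (Φ ∘ ext) ∘ fun a (i : Finset.range (J + 1)) => X i a := by
    funext ω
    refine hdep _ _ fun i hi => ?_
    simp only [ext]
    rw [dif_pos (Finset.mem_range.2 (Nat.lt_succ_of_le hi))]
  rw [e1]
  exact h2

/-- Independent Bernoulli variables of parameter `p`. -/
structure BernoulliSeq (P : Measure Ω) (Y : ℕ → Ω → ℝ) (p : ℝ) : Prop where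
  measurable : ∀ j, Measurable (Y j)
  indep : iIndepFun Y P
  zero_or_one : ∀ j ω, Y j ω = 0 ∨ Y j ω = 1
  mean : ∀ j, ∫ ω, Y j ω ∂P = p
  ident : ∀ j, IdentDistrib (Y j) (Y 0) P P

/-- The number of changes in the 0-1 sequence `y_0, …, y_J`. -/
noncomputable def changes (J : ℕ) (y : ℕ → ℝ) : ℝ :=
  ∑ j ∈ Finset.range J, (y j + y (j + 1) - 2 * (y j * y (j + 1)))

theorem changes_congr {J : ℕ} {x y : ℕ → ℝ} (h : ∀ i ≤ J, x i = y i) :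
    changes J x = changes J y := by
  refine Finset.sum_congr rfl fun j hj => ?_
  rw [Finset.mem_range] at hj
  rw [h j hj.le, h (j + 1) hj]

@[fun_prop]
theorem measurable_changes (J : ℕ) : Measurable (changes J) := by
  unfold changes
  fun_prop

/-- The martingale part of the number of changes. -/
noncomputable def changesMart (p : ℝ) (J : ℕ) (y : ℕ → ℝ) : ℝ :=
  ∑ j ∈ Finset.range J, (2 * (1 - 2 * p) - 2 * (y j - p)) * (y (j + 1) - p)

@[fun_prop]
theorem measurable_changesMart (p : ℝ) (J : ℕ) : Measurable (changesMart p J) := by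
  unfold changesMart
  fun_prop

/-- With u = y_j - p and u' = y_(j+1) - p, each summand is 2p(1-p) + (1-2p)(u + u') - 2uu'.
Replacing u by u' in the linear part telescopes to (1-2p)(y_0 - y_J) and leaves u' times a function
of the past. -/
theorem changes_eq (p : ℝ) (J : ℕ) (y : ℕ → ℝ) :
    changes J y = 2 * p * (1 - p) * J + changesMart p J y + (1 - 2 * p) * (y 0 - y J) := by
  induction J with
  | zero => simp [changes, changesMart]
  | succ J ih =>
    unfold changes changesMart at *
    rw [Finset.sum_range_succ, Finset.sum_range_succ, ih]
    push_cast
    ring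

namespace BernoulliSeq

variable {P : Measure Ω} [IsProbabilityMeasure P] {Y : ℕ → Ω → ℝ} {p : ℝ}

omit [IsProbabilityMeasure P] in
theorem abs_le (h : BernoulliSeq P Y p) (j : ℕ) (ω : Ω) : |Y j ω| ≤ 1 := by
  rcases h.zero_or_one j ω with h | h <;> rw [h] <;> norm_num

theorem integrable (h : BernoulliSeq P Y p) (j : ℕ) : Integrable (Y j) P :=
  Integrable.of_bound (h.measurable j).aestronglyMeasurable 1
    (ae_of_all _ fun ω => by simpa using h.abs_le j ω)

theorem mem_Icc (h : BernoulliSeq P Y p) : 0 ≤ p ∧ p ≤ 1 := by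
  rw [← h.mean 0]
  constructor
  · refine integral_nonneg fun ω => ?_
    rcases h.zero_or_one 0 ω with h | h <;> rw [h] <;> norm_num
  · calc ∫ ω, Y 0 ω ∂P ≤ ∫ _, (1 : ℝ) ∂P :=
        integral_mono (h.integrable 0) (integrable_const 1) fun ω => (le_abs_self _).trans (h.abs_le 0 ω)
      _ = 1 := by simp

theorem integral_centered (h : BernoulliSeq P Y p) (j : ℕ) : ∫ ω, (Y j ω - p) ∂P = 0 := by
  rw [integral_sub (h.integrable j) (integrable_const p), h.mean]; simp

theorem integral_centered_sq (h : BernoulliSeq P Y p) (j : ℕ) :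
    ∫ ω, (Y j ω - p) ^ 2 ∂P = p * (1 - p) := by
  have : ∀ ω, (Y j ω - p) ^ 2 = (1 - 2 * p) * Y j ω + p ^ 2 := by
    intro ω
    rcases h.zero_or_one j ω with h | h <;> rw [h] <;> ring
  simp_rw [this]
  rw [integral_add ((h.integrable j).const_mul _) (integrable_const _), integral_const_mul, h.mean]
  simp; ring

theorem abs_centered_le (h : BernoulliSeq P Y p) (j : ℕ) (ω : Ω) : |Y j ω - p| ≤ 1 := by
  have := h.mem_Icc
  rw [_root_.abs_le]
  rcases h.zero_or_one j ω with h | h <;> rw [h] <;> constructor <;> linarith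

theorem abs_changesMart_le (h : BernoulliSeq P Y p) (J : ℕ) (ω : Ω) :
    |changesMart p J (fun i => Y i ω)| ≤ 4 * J := by
  unfold changesMart
  refine (Finset.abs_sum_le_sum_abs _ _).trans ?_
  refine (Finset.sum_le_card_nsmul _ _ 4 fun j _ => ?_).trans (by simp [mul_comm])
  rw [abs_mul]
  have h1 := h.abs_centered_le (j + 1) ω
  have h2 : |2 * (1 - 2 * p) - 2 * (Y j ω - p)| ≤ 4 := by
    have := h.mem_Icc
    rw [_root_.abs_le]
    rcases h.zero_or_one j ω with h | h <;> rw [h] <;> constructor <;> linarith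
  have := mul_le_mul h2 h1 (abs_nonneg _) (by norm_num)
  linarith

omit [IsProbabilityMeasure P] in
theorem measurable_changesMart_comp (h : BernoulliSeq P Y p) (J : ℕ) :
    Measurable fun ω => changesMart p J (fun i => Y i ω) :=
  (measurable_changesMart p J).comp (measurable_pi_lambda _ h.measurable)

omit [IsProbabilityMeasure P] in
theorem measurable_changes_comp (h : BernoulliSeq P Y p) (J : ℕ) :
    Measurable fun ω => changes J (fun i => Y i ω) :=
  (measurable_changes J).comp (measurable_pi_lambda _ h.measurable)

omit [IsProbabilityMeasure P] in
/-- Product formula for a function of the past times a function of the next variable. -/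
theorem integral_past_mul {𝕜 : Type*} [RCLike 𝕜] (h : BernoulliSeq P Y p) (J : ℕ)
    {Φ : (ℕ → ℝ) → 𝕜} (hΦ : Measurable Φ)
    (hdep : ∀ x y : ℕ → ℝ, (∀ i ≤ J, x i = y i) → Φ x = Φ y) {g : ℝ → 𝕜} (hg : Measurable g) :
    ∫ ω, Φ (fun i => Y i ω) * g (Y (J + 1) ω) ∂P =
      (∫ ω, Φ (fun i => Y i ω) ∂P) * ∫ ω, g (Y (J + 1) ω) ∂P := by
  have hi := (indepFun_past h.measurable h.indep J hΦ hdep).comp measurable_id hg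
  exact hi.integral_fun_mul_eq_mul_integral
    (hΦ.comp (measurable_pi_lambda _ h.measurable)).aestronglyMeasurable
    (hg.comp (h.measurable _)).aestronglyMeasurable

/-- The increments are orthogonal, because Y_(J+1) - p is centred and independent of the past. Each
has second moment (4(1-2p)² + 4p(1-p)) p(1-p) = q(2-3q), with q = 2p(1-p). -/
theorem integral_changesMart_sq (h : BernoulliSeq P Y p) (J : ℕ) :
    ∫ ω, changesMart p J (fun i => Y i ω) ^ 2 ∂P =
      2 * p * (1 - p) * (2 - 3 * (2 * p * (1 - p))) * J := by
  induction J with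
  | zero => simp [changesMart]
  | succ J ih =>
    set V : (ℕ → ℝ) → ℝ := fun y => 2 * (1 - 2 * p) - 2 * (y J - p) with hV
    have hVm : Measurable V := by fun_prop
    have hsucc : ∀ y : ℕ → ℝ, changesMart p (J + 1) y = changesMart p J y + V y * (y (J + 1) - p) :=
      fun y => by simp only [changesMart, Finset.sum_range_succ, hV]
    have hdepM : ∀ x y : ℕ → ℝ, (∀ i ≤ J, x i = y i) → changesMart p J x = changesMart p J y := by
      intro x y hxy
      refine Finset.sum_congr rfl fun j hj => ?_
      rw [Finset.mem_range] at hj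
      rw [hxy j hj.le, hxy (j + 1) hj]
    have hdepV : ∀ x y : ℕ → ℝ, (∀ i ≤ J, x i = y i) → V x = V y := by
      intro x y hxy
      simp only [hV, hxy J le_rfl]
    have hpI := h.mem_Icc
    have hVb : ∀ ω, |V (fun i => Y i ω)| ≤ 4 := by
      intro ω
      simp only [hV]
      rw [_root_.abs_le]
      rcases h.zero_or_one J ω with h | h <;> rw [h] <;> constructor <;> linarith
    have hYm := measurable_pi_lambda (fun ω i => Y i ω) h.measurable
    have m1 := h.measurable_changesMart_comp J
    have m2 : Measurable fun ω => V (fun i => Y i ω) := hVm.comp hYm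
    have m3 := h.measurable (J + 1)
    have i1 : Integrable (fun ω => changesMart p J (fun i => Y i ω) ^ 2) P := by
      refine Integrable.of_bound (m1.pow_const 2).aestronglyMeasurable ((4 * J) ^ 2) (ae_of_all _ fun ω => ?_)
      rw [norm_pow, Real.norm_eq_abs]
      have := h.abs_changesMart_le J ω
      gcongr
    have i2 : Integrable (fun ω => (changesMart p J (fun i => Y i ω) * V (fun i => Y i ω)) *
        (Y (J + 1) ω - p)) P := by
      refine Integrable.of_bound ((m1.mul m2).mul (m3.sub_const p)).aestronglyMeasurable ((4 * J) * 4 * 1) (ae_of_all _ fun ω => ?_)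
      rw [norm_mul, norm_mul, Real.norm_eq_abs, Real.norm_eq_abs, Real.norm_eq_abs]
      have := h.abs_changesMart_le J ω
      have := hVb ω
      have := h.abs_centered_le (J + 1) ω
      gcongr
    have i3 : Integrable (fun ω => V (fun i => Y i ω) ^ 2 * (Y (J + 1) ω - p) ^ 2) P := by
      refine Integrable.of_bound ((m2.pow_const 2).mul ((m3.sub_const p).pow_const 2)).aestronglyMeasurable (4 ^ 2 * 1 ^ 2) (ae_of_all _ fun ω => ?_)
      rw [norm_mul, norm_pow, norm_pow, Real.norm_eq_abs, Real.norm_eq_abs]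
      have := hVb ω
      have := h.abs_centered_le (J + 1) ω
      gcongr
    have e2 : ∫ ω, (changesMart p J (fun i => Y i ω) * V (fun i => Y i ω)) *
        (Y (J + 1) ω - p) ∂P = 0 := by
      have := h.integral_past_mul J (Φ := fun y => changesMart p J y * V y)
        ((measurable_changesMart p J).mul hVm)
        (fun x y hxy => by rw [hdepM x y hxy, hdepV x y hxy]) (g := fun u => u - p) (by fun_prop)
      rw [this, h.integral_centered, mul_zero]
    have e3 : ∫ ω, V (fun i => Y i ω) ^ 2 * (Y (J + 1) ω - p) ^ 2 ∂P =
        (4 * (1 - 2 * p) ^ 2 + 4 * (p * (1 - p))) * (p * (1 - p)) := by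
      have := h.integral_past_mul J (Φ := fun y => V y ^ 2) (hVm.pow_const 2)
        (fun x y hxy => by rw [hdepV x y hxy]) (g := fun u => (u - p) ^ 2) (by fun_prop)
      rw [this, h.integral_centered_sq]
      congr 1
      have e : ∀ ω, V (fun i => Y i ω) ^ 2 =
          4 * (1 - 2 * p) ^ 2 - 8 * (1 - 2 * p) * (Y J ω - p) + 4 * (Y J ω - p) ^ 2 := by
        intro ω; simp only [hV]; ring
      have j1 : Integrable (fun ω => Y J ω - p) P := (h.integrable J).sub (integrable_const p)
      have j2 : Integrable (fun ω => (Y J ω - p) ^ 2) P := by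
        have m4 := h.measurable J
        refine Integrable.of_bound (by fun_prop) (1 ^ 2) (ae_of_all _ fun ω => ?_)
        rw [norm_pow, Real.norm_eq_abs]
        have := h.abs_centered_le J ω
        gcongr
      have j3 : Integrable (fun ω => 4 * (1 - 2 * p) ^ 2 - 8 * (1 - 2 * p) * (Y J ω - p)) P :=
        (integrable_const _).sub (j1.const_mul _)
      simp_rw [e]
      rw [integral_add j3 (j2.const_mul _), integral_sub (integrable_const _) (j1.const_mul _), integral_const_mul, integral_const_mul,
        integral_const_mul, h.integral_centered, h.integral_centered_sq]
      simp
    have e : ∀ ω, changesMart p (J + 1) (fun i => Y i ω) ^ 2 =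
        changesMart p J (fun i => Y i ω) ^ 2 + 2 * ((changesMart p J (fun i => Y i ω) *
          V (fun i => Y i ω)) * (Y (J + 1) ω - p)) +
          V (fun i => Y i ω) ^ 2 * (Y (J + 1) ω - p) ^ 2 := by
      intro ω; rw [hsucc]; ring
    have i4 : Integrable (fun ω => changesMart p J (fun i => Y i ω) ^ 2 +
        2 * ((changesMart p J (fun i => Y i ω) * V (fun i => Y i ω)) * (Y (J + 1) ω - p))) P :=
      i1.add (i2.const_mul 2)
    simp_rw [e]
    rw [integral_add i4 i3, integral_add i1 (i2.const_mul 2),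
      integral_const_mul, e2, e3, ih]
    push_cast
    ring

/-- The number of changes is its mean plus a bounded perturbation of the martingale part. -/
theorem abs_changes_sub_le (h : BernoulliSeq P Y p) (J : ℕ) (ω : Ω) :
    |changes J (fun i => Y i ω) - 2 * p * (1 - p) * J - changesMart p J (fun i => Y i ω)| ≤ 1 := by
  rw [changes_eq p]
  have := h.mem_Icc
  rw [_root_.abs_le]
  rcases h.zero_or_one 0 ω with h0 | h0 <;> rcases h.zero_or_one J ω with h1 | h1 <;>
    rw [h0, h1] <;> constructor <;> linarith

/-- Strong law of large numbers for the number of changes. -/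
theorem tendsto_changes_div (h : BernoulliSeq P Y p) :
    ∀ᵐ ω ∂P, Tendsto (fun J : ℕ => changes J (fun i => Y i ω) / J) atTop
      (𝓝 (2 * p * (1 - p))) := by
  set g : ℝ × ℝ → ℝ := fun u => u.1 + u.2 - 2 * (u.1 * u.2) with hg
  have hgm : Measurable g := by fun_prop
  have hpair : ∀ j, IdentDistrib (fun ω => g (Y j ω, Y (j + 1) ω)) (fun ω => g (Y 0 ω, Y 1 ω)) P P := by
    intro j
    exact ((h.ident j).prodMk ((h.ident (j + 1)).trans (h.ident 1).symm)
      (h.indep.indepFun (by omega)) (h.indep.indepFun (by omega))).comp hgm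
  have hbound : ∀ j ω, 0 ≤ g (Y j ω, Y (j + 1) ω) ∧ g (Y j ω, Y (j + 1) ω) ≤ 1 := by
    intro j ω
    rcases h.zero_or_one j ω with h0 | h0 <;> rcases h.zero_or_one (j + 1) ω with h1 | h1 <;>
      simp only [hg, h0, h1] <;> norm_num
  have hgY : ∀ j, Measurable fun ω => g (Y j ω, Y (j + 1) ω) := fun j =>
    hgm.comp ((h.measurable j).prodMk (h.measurable (j + 1)))
  have hint : ∀ j, Integrable (fun ω => g (Y j ω, Y (j + 1) ω)) P := fun j =>
    Integrable.of_bound (hgY j).aestronglyMeasurable 1 (ae_of_all _ fun ω => by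
      rw [Real.norm_eq_abs, abs_of_nonneg (hbound j ω).1]; exact (hbound j ω).2)
  have hmean : ∫ ω, g (Y 0 ω, Y 1 ω) ∂P = 2 * p * (1 - p) := by
    have h01 : ∫ ω, Y 0 ω * Y 1 ω ∂P = p * p := by
      have := (h.indep.indepFun (by omega : 0 ≠ 1)).integral_fun_mul_eq_mul_integral
        (h.measurable 0).aestronglyMeasurable (h.measurable 1).aestronglyMeasurable
      rw [this, h.mean, h.mean]
    have i01 : Integrable (fun ω => Y 0 ω * Y 1 ω) P :=
      (h.indep.indepFun (by omega : 0 ≠ 1)).integrable_mul (h.integrable 0) (h.integrable 1)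
    have iadd : Integrable (fun ω => Y 0 ω + Y 1 ω) P := (h.integrable 0).add (h.integrable 1)
    simp only [hg]
    rw [integral_sub iadd (i01.const_mul 2),
      integral_add (h.integrable 0) (h.integrable 1), integral_const_mul, h01, h.mean, h.mean]
    ring
  -- Neighbouring pairs share a variable, but pairs starting at indices of the same parity are
  -- disjoint, so the strong law applies to each parity class.
  have hslln : ∀ c : ℕ, ∀ᵐ ω ∂P, Tendsto (fun n : ℕ =>
      (∑ i ∈ Finset.range n, g (Y (2 * i + c) ω, Y (2 * i + c + 1) ω)) / n) atTop
      (𝓝 (2 * p * (1 - p))) := by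
    intro c
    have := strong_law_ae_real (fun (i : ℕ) ω => g (Y (2 * i + c) ω, Y (2 * i + c + 1) ω))
      (hint _) (fun i j hij => ?_) (fun i => (hpair _).trans (hpair _).symm)
    · rwa [(hpair (2 * 0 + c)).integral_eq, hmean] at this
    · exact (h.indep.indepFun_prodMk_prodMk h.measurable (2 * i + c) (2 * i + c + 1) (2 * j + c)
        (2 * j + c + 1) (by omega) (by omega) (by omega) (by omega)).comp hgm hgm
  filter_upwards [hslln 0, hslln 1] with ω h0 h1
  have hsplit : ∀ n, changes (2 * n) (fun i => Y i ω) =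
      ∑ i ∈ Finset.range n, g (Y (2 * i + 0) ω, Y (2 * i + 0 + 1) ω) +
        ∑ i ∈ Finset.range n, g (Y (2 * i + 1) ω, Y (2 * i + 1 + 1) ω) := by
    intro n
    induction n with
    | zero => simp [changes]
    | succ n ih =>
      rw [show 2 * (n + 1) = 2 * n + 1 + 1 by ring]
      unfold changes at *
      rw [Finset.sum_range_succ, Finset.sum_range_succ, Finset.sum_range_succ,
        Finset.sum_range_succ, ih]
      simp only [hg, add_zero]
      ring
  set q := 2 * p * (1 - p)
  set a : ℕ → ℝ := fun n => (∑ i ∈ Finset.range n, g (Y (2 * i + 0) ω, Y (2 * i + 0 + 1) ω)) / n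
  set b : ℕ → ℝ := fun n => (∑ i ∈ Finset.range n, g (Y (2 * i + 1) ω, Y (2 * i + 1 + 1) ω)) / n
  have hhalf : Tendsto (fun J : ℕ => J / 2) atTop atTop := Nat.tendsto_div_const_atTop two_ne_zero
  have hlim : Tendsto (fun J : ℕ => |a (J / 2) - q| + |b (J / 2) - q| + (1 + |q|) / J) atTop
      (𝓝 0) := by
    have ha := ((h0.comp hhalf).sub_const q).abs
    have hb := ((h1.comp hhalf).sub_const q).abs
    have hc := tendsto_const_div_atTop_nhds_zero_nat (1 + |q|)
    simpa using (ha.add hb).add hc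
  rw [tendsto_iff_norm_sub_tendsto_zero]
  refine squeeze_zero' (Eventually.of_forall fun _ => norm_nonneg _) ?_ hlim
  filter_upwards [eventually_ge_atTop 2] with J hJ
  have hJ0 : (0 : ℝ) < J := by exact_mod_cast (by omega : 0 < J)
  set n := J / 2 with hn
  have hn0 : (0 : ℝ) < n := by exact_mod_cast (by omega : 0 < n)
  have hr : ∃ r : ℝ, |r| ≤ 1 + |q| ∧
      changes J (fun i => Y i ω) - q * J = n * (a n - q) + n * (b n - q) + r := by
    have hab : n * (a n - q) + n * (b n - q) = changes (2 * n) (fun i => Y i ω) - q * (2 * n) := by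
      rw [hsplit]; simp only [a, b]; field_simp; ring
    rcases (by omega : J = 2 * n ∨ J = 2 * n + 1) with h2 | h2
    · refine ⟨0, by simp; positivity, ?_⟩
      rw [hab, h2]; push_cast; ring
    · refine ⟨g (Y (2 * n) ω, Y (2 * n + 1) ω) - q, ?_, ?_⟩
      · refine (abs_sub _ _).trans ?_
        have := hbound (2 * n) ω
        rw [abs_of_nonneg this.1]
        linarith
      · rw [hab, h2]
        unfold changes
        rw [Finset.sum_range_succ]
        simp only [hg]
        push_cast; ring
  obtain ⟨r, hr1, hr2⟩ := hr
  have e1 : changes J (fun i => Y i ω) / J - q = (changes J (fun i => Y i ω) - q * J) / J := by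
    field_simp
  have hnJ : (n : ℝ) ≤ J := by exact_mod_cast (by omega : n ≤ J)
  rw [Real.norm_eq_abs, e1, hr2, abs_div, abs_of_pos hJ0, div_le_iff₀ hJ0]
  refine (abs_add_le _ _).trans ?_
  have h3 := abs_add_le (n * (a n - q)) (n * (b n - q))
  rw [abs_mul, abs_mul, abs_of_pos hn0] at h3
  have h4 : (|a n - q| + |b n - q| + (1 + |q|) / J) * J =
      J * |a n - q| + J * |b n - q| + (1 + |q|) := by field_simp
  rw [h4]
  have h5 := mul_le_mul_of_nonneg_right hnJ (abs_nonneg (a n - q))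
  have h6 := mul_le_mul_of_nonneg_right hnJ (abs_nonneg (b n - q))
  linarith

end BernoulliSeq

/-! ### Central limit theorem for the number of changes -/

variable {Ω : Type*} [MeasurableSpace Ω]

/-- The pair of partial generating functions of the number of changes, according to the last value,
at `e = exp z`. -/
noncomputable def genPair (p : ℝ) (e : ℂ) : ℕ → ℂ × ℂ
  | 0 => (p, 1 - p)
  | J + 1 => (p * ((genPair p e J).1 + e * (genPair p e J).2),
      (1 - p) * (e * (genPair p e J).1 + (genPair p e J).2))

/-- The generating function of the number of changes. -/
noncomputable def genFun (p : ℝ) (e : ℂ) (J : ℕ) : ℂ := (genPair p e J).1 + (genPair p e J).2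

/-- Cayley–Hamilton for the 2 × 2 transfer matrix, whose trace is 1 and whose determinant is
p(1-p)(1-e²). -/
theorem genFun_add_two (p : ℝ) (e : ℂ) (J : ℕ) :
    genFun p e (J + 2) = genFun p e (J + 1) - p * (1 - p) * (1 - e ^ 2) * genFun p e J := by
  simp only [genFun, genPair]
  ring

theorem genFun_zero (p : ℝ) (e : ℂ) : genFun p e 0 = 1 := by simp [genFun, genPair]

theorem genFun_one (p : ℝ) (e : ℂ) : genFun p e 1 = 1 + 2 * p * (1 - p) * (e - 1) := by
  simp only [genFun, genPair]; ring

/-- Split the expectation by the last value: the next variable is independent of the past and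
contributes a factor e exactly when the value changes, which is the recursion of `genPair`. -/
theorem BernoulliSeq.integral_exp_changes {P : Measure Ω} [IsProbabilityMeasure P]
    {Y : ℕ → Ω → ℝ} {p : ℝ} (h : BernoulliSeq P Y p) (t : ℝ) (J : ℕ) :
    ∫ ω, Complex.exp ((t * changes J (fun i => Y i ω) : ℝ) * Complex.I) ∂P =
      genFun p (Complex.exp (t * Complex.I)) J := by
  set e := Complex.exp (t * Complex.I) with he
  set F : ℕ → (ℕ → ℝ) → ℂ := fun J y => Complex.exp ((t * changes J y : ℝ) * Complex.I) with hF
  have hFm : ∀ J, Measurable (F J) := fun J => by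
    simp only [hF]
    fun_prop
  have hFdep : ∀ J, ∀ x y : ℕ → ℝ, (∀ i ≤ J, x i = y i) → F J x = F J y := fun J x y hxy => by
    simp only [hF, changes_congr hxy]
  have hYm := measurable_pi_lambda (fun ω i => Y i ω) h.measurable
  have hFstep : ∀ J y, F (J + 1) y = F J y * Complex.exp
      ((t * (y J + y (J + 1) - 2 * (y J * y (J + 1))) : ℝ) * Complex.I) := by
    intro J y
    simp only [hF, changes, Finset.sum_range_succ, mul_add]
    rw [← Complex.exp_add]
    congr 1
    push_cast
    ring
  have hmeanC : ∀ j, ∫ ω, ((Y j ω : ℝ) : ℂ) ∂P = p := fun j => by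
    rw [integral_complex_ofReal, h.mean]
  have hintC : ∀ j, Integrable (fun ω => ((Y j ω : ℝ) : ℂ)) P := fun j => (h.integrable j).ofReal
  have key : ∀ J, ∫ ω, F J (fun i => Y i ω) * (Y J ω : ℂ) ∂P = (genPair p e J).1 ∧
      ∫ ω, F J (fun i => Y i ω) * (1 - (Y J ω : ℂ)) ∂P = (genPair p e J).2 := by
    have hint1 : ∀ J, Integrable (fun ω => F J (fun i => Y i ω) * (Y J ω : ℂ)) P := by
      intro J
      have m2 := h.measurable J
      refine Integrable.of_bound (((hFm J).comp hYm).mul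
        (by fun_prop)).aestronglyMeasurable 1 (ae_of_all _ fun ω => ?_)
      rw [norm_mul, Complex.norm_exp_ofReal_mul_I, one_mul, Complex.norm_real]
      exact h.abs_le J ω
    have hint2 : ∀ J, Integrable (fun ω => F J (fun i => Y i ω) * (1 - (Y J ω : ℂ))) P := by
      intro J
      have m2 := h.measurable J
      refine Integrable.of_bound (((hFm J).comp hYm).mul
        (by fun_prop)).aestronglyMeasurable 1 (ae_of_all _ fun ω => ?_)
      rw [norm_mul, Complex.norm_exp_ofReal_mul_I, one_mul]
      rcases h.zero_or_one J ω with h | h <;> rw [h] <;> simp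
    intro J
    induction J with
    | zero =>
      have hF0 : ∀ y, F 0 y = 1 := fun y => by simp [hF, changes]
      simp only [hF0, one_mul, genPair]
      refine ⟨hmeanC 0, ?_⟩
      rw [integral_sub (integrable_const _) (hintC 0), hmeanC]
      simp
    | succ J ih =>
      constructor
      · have e1 : ∀ ω, F (J + 1) (fun i => Y i ω) * (Y (J + 1) ω : ℂ) =
            (F J (fun i => Y i ω) * (Y J ω : ℂ) + e * (F J (fun i => Y i ω) * (1 - (Y J ω : ℂ)))) *
              (Y (J + 1) ω : ℂ) := by
          intro ω
          rw [hFstep]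
          rcases h.zero_or_one J ω with h0 | h0 <;> rcases h.zero_or_one (J + 1) ω with h1 | h1 <;>
            simp only [h0, h1] <;> (norm_num [he]; try ring)
        simp_rw [e1]
        have := h.integral_past_mul J (𝕜 := ℂ)
          (Φ := fun y => F J y * (y J : ℂ) + e * (F J y * (1 - (y J : ℂ))))
          (by have := hFm J; fun_prop) (fun x y hxy => by
            simp only [hFdep J x y hxy, hxy J le_rfl]) (g := fun u => (u : ℂ)) (by fun_prop)
        rw [this, hmeanC, integral_add (hint1 J) ((hint2 J).const_mul e), integral_const_mul,
          ih.1, ih.2]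
        simp only [genPair]; ring
      · have e1 : ∀ ω, F (J + 1) (fun i => Y i ω) * (1 - (Y (J + 1) ω : ℂ)) =
            (e * (F J (fun i => Y i ω) * (Y J ω : ℂ)) + (F J (fun i => Y i ω) * (1 - (Y J ω : ℂ)))) *
              (1 - (Y (J + 1) ω : ℂ)) := by
          intro ω
          rw [hFstep]
          rcases h.zero_or_one J ω with h0 | h0 <;> rcases h.zero_or_one (J + 1) ω with h1 | h1 <;>
            simp only [h0, h1] <;> (norm_num [he]; try ring)
        simp_rw [e1]
        have := h.integral_past_mul J (𝕜 := ℂ)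
          (Φ := fun y => e * (F J y * (y J : ℂ)) + F J y * (1 - (y J : ℂ)))
          (by have := hFm J; fun_prop) (fun x y hxy => by
            simp only [hFdep J x y hxy, hxy J le_rfl]) (g := fun u => 1 - (u : ℂ)) (by fun_prop)
        rw [this, integral_add ((hint1 J).const_mul e) (hint2 J), integral_const_mul,
          ih.1, ih.2, integral_sub (integrable_const _) (hintC _), hmeanC]
        simp only [genPair]; simp; ring
  have hI1 : Integrable (fun ω => F J (fun i => Y i ω)) P := by
    refine Integrable.of_bound ((hFm J).comp hYm).aestronglyMeasurable 1 (ae_of_all _ fun ω => ?_)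
    rw [Complex.norm_exp_ofReal_mul_I]
  rw [genFun, ← (key J).1, ← (key J).2, ← integral_add]
  · refine integral_congr_ae (ae_of_all _ fun ω => ?_)
    simp only [hF]; ring
  · have m2 := h.measurable J
    refine Integrable.of_bound (((hFm J).comp hYm).mul
      (by fun_prop)).aestronglyMeasurable 1 (ae_of_all _ fun ω => ?_)
    rw [norm_mul, Complex.norm_exp_ofReal_mul_I, one_mul, Complex.norm_real]
    exact h.abs_le J ω
  · have m2 := h.measurable J
    refine Integrable.of_bound (((hFm J).comp hYm).mul
      (by fun_prop)).aestronglyMeasurable 1 (ae_of_all _ fun ω => ?_)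
    rw [norm_mul, Complex.norm_exp_ofReal_mul_I, one_mul]
    rcases h.zero_or_one J ω with h | h <;> rw [h] <;> simp

/-- Explicit solution of the recursion. -/
theorem genFun_eq {p : ℝ} {e s : ℂ} (hs : s ≠ 0) (hs2 : s ^ 2 = 1 - 4 * (p * (1 - p) * (1 - e ^ 2)))
    (J : ℕ) : genFun p e J =
      ((genFun p e 1 - (1 - s) / 2) * ((1 + s) / 2) ^ J -
        (genFun p e 1 - (1 + s) / 2) * ((1 - s) / 2) ^ J) / s := by
  set w := (p : ℂ) * (1 - p) * (1 - e ^ 2) with hw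
  -- The numbers (1 ± s)/2 are the roots of λ² = λ - w, the characteristic equation of the
  -- recursion.
  have hl : ((1 + s) / 2) ^ 2 = (1 + s) / 2 - w := by linear_combination (1 / 4 : ℂ) * hs2
  have hm : ((1 - s) / 2) ^ 2 = (1 - s) / 2 - w := by linear_combination (1 / 4 : ℂ) * hs2
  induction J using Nat.strong_induction_on with
  | _ J ih =>
    rcases J with _ | _ | J
    · rw [genFun_zero]; field_simp; ring
    · field_simp; ring
    · rw [genFun_add_two, ih (J + 1) (by omega), ih J (by omega), ← hw]
      rw [pow_add _ J 2, pow_add _ J 2, hl, hm]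
      field_simp
      ring

theorem tendsto_exp_taylor (a : ℂ) {z : ℕ → ℂ} (hz : Tendsto z atTop (𝓝 0)) (hz0 : ∀ᶠ n in atTop, z n ≠ 0) :
    Tendsto (fun n => (Complex.exp (a * z n) - 1 - a * z n) / z n ^ 2) atTop (𝓝 (a ^ 2 / 2)) := by
  have h1 := (Complex.exp_sub_sum_range_isBigO_pow 3)
  have haz : Tendsto (fun n => a * z n) atTop (𝓝 0) := by simpa using hz.const_mul a
  have h2 := h1.comp_tendsto haz
  have h3 : (fun n => Complex.exp (a * z n) - 1 - a * z n - a ^ 2 / 2 * z n ^ 2) =o[atTop]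
      fun n => z n ^ 2 := by
    have h4 : (fun n => Complex.exp (a * z n) - 1 - a * z n - a ^ 2 / 2 * z n ^ 2) =O[atTop]
        fun n => z n ^ 3 := by
      refine (h2.congr_left fun n => ?_).trans ?_
      · simp [Finset.sum_range_succ, Nat.factorial]; ring
      · refine Asymptotics.IsBigO.of_bound (‖a‖ ^ 3) (Eventually.of_forall fun n => ?_)
        simp [mul_pow]
    refine h4.trans_isLittleO ?_
    have h5 : (fun n => z n ^ 3) = fun n => z n * z n ^ 2 := by funext n; ring
    rw [h5]
    simpa using ((Asymptotics.isLittleO_one_iff ℂ).2 hz).mul_isBigO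
      (Asymptotics.isBigO_refl (fun n => z n ^ 2) atTop)
  have h6 := h3.tendsto_div_nhds_zero
  have h7 := h6.add_const (a ^ 2 / 2)
  rw [zero_add] at h7
  refine h7.congr' ?_
  filter_upwards [hz0] with n this
  field_simp
  ring

/-- Normal limit of the characteristic function of the centred number of changes. -/
theorem tendsto_genFun {p : ℝ} {q : ℂ} (hq : q = 2 * p * (1 - p)) {z : ℕ → ℂ} {κ : ℂ}
    (hz : Tendsto z atTop (𝓝 0)) (hz0 : ∀ᶠ n in atTop, z n ≠ 0)
    (hκ : Tendsto (fun n : ℕ => n * z n ^ 2) atTop (𝓝 κ)) :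
    Tendsto (fun n : ℕ => genFun p (Complex.exp (z n)) n * Complex.exp (-q * z n) ^ n) atTop
      (𝓝 (Complex.exp (κ * (q * (2 - 3 * q) / 2)))) := by
  have hexp : ∀ a : ℂ, Tendsto (fun n => Complex.exp (a * z n)) atTop (𝓝 1) := by
    intro a
    have : Tendsto (fun n => a * z n) atTop (𝓝 0) := by simpa using hz.const_mul a
    simpa [Function.comp_def] using (Complex.continuous_exp.tendsto 0).comp this
  have hexp1 : Tendsto (fun n => Complex.exp (z n)) atTop (𝓝 1) := by simpa using hexp 1
  set w : ℕ → ℂ := fun n => p * (1 - p) * (1 - Complex.exp (z n) ^ 2) with hw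
  have hwlim : Tendsto w atTop (𝓝 0) := by
    have := ((hexp1.pow 2).const_sub 1).const_mul ((p : ℂ) * (1 - p))
    simpa using this
  set s : ℕ → ℂ := fun n => (1 - 4 * w n) ^ (((2 : ℕ) : ℂ)⁻¹) with hs
  have hs2 : ∀ n, s n ^ 2 = 1 - 4 * w n := fun n => Complex.cpow_nat_inv_pow _ two_ne_zero
  have hslim : Tendsto s atTop (𝓝 1) := by
    have h1 : Tendsto (fun n => 1 - 4 * w n) atTop (𝓝 1) := by
      simpa using (hwlim.const_mul 4).const_sub 1
    have h2 := (continuousAt_cpow_const (b := ((2 : ℕ) : ℂ)⁻¹) Complex.one_mem_slitPlane).tendsto.comp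
      h1
    rw [Complex.one_cpow] at h2
    exact h2
  have hsne : ∀ᶠ n in atTop, s n ≠ 0 := hslim.eventually_ne one_ne_zero
  -- G is the dominant eigenvalue with the drift e^(qz) removed. It suffices that G = 1 +
  -- (q(2-3q)/2) z² + o(z²), for then G^n has the required limit.
  set G : ℕ → ℂ := fun n => (1 + s n) / 2 * Complex.exp (-q * z n) with hG
  have hGlim : Tendsto G atTop (𝓝 1) := by
    have := ((hslim.const_add 1).div_const 2).mul (hexp (-q))
    rw [show ((1 : ℂ) + 1) / 2 * 1 = 1 by norm_num] at this
    exact this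
  -- second order expansion of `G`
  have hquad : ∀ n, (G n - 1) * (2 + (G n - 1) - Complex.exp (-q * z n)) =
      -(1 - Complex.exp (-q * z n) + w n * Complex.exp (-q * z n) ^ 2) := by
    intro n
    simp only [hG]
    linear_combination (Complex.exp (-q * z n) ^ 2 / 4) * hs2 n
  -- The quadratic equation of G, in the form `hquad`, presents G - 1 as a quotient with denominator
  -- tending to 1, so the square root need not be expanded.
  have hden : Tendsto (fun n => 2 + (G n - 1) - Complex.exp (-q * z n)) atTop (𝓝 1) := by
    have := ((hGlim.sub_const 1).const_add 2).sub (hexp (-q))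
    convert this using 2; norm_num
  have hnum : Tendsto (fun n => -(1 - Complex.exp (-q * z n) + w n * Complex.exp (-q * z n) ^ 2) /
      z n ^ 2) atTop (𝓝 (q * (2 - 3 * q) / 2)) := by
    -- The numerator is a combination of three exponentials. Its first-order coefficient is -q + q²
    -- + q(1-q) = 0, so only the second-order terms remain.
    have t1 := tendsto_exp_taylor (-q) hz hz0
    have t2 := tendsto_exp_taylor (-2 * q) hz hz0
    have t3 := tendsto_exp_taylor (2 - 2 * q) hz hz0
    have t4 := (t1.sub (t2.const_mul (q / 2))).add (t3.const_mul (q / 2))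
    have e : (-q) ^ 2 / 2 - q / 2 * ((-2 * q) ^ 2 / 2) + q / 2 * ((2 - 2 * q) ^ 2 / 2) =
      q * (2 - 3 * q) / 2 := by ring
    rw [e] at t4
    refine t4.congr' ?_
    filter_upwards [hz0] with n hzn
    have e1 : w n * Complex.exp (-q * z n) ^ 2 =
        q / 2 * (Complex.exp (-2 * q * z n) - Complex.exp ((2 - 2 * q) * z n)) := by
      have e2 : Complex.exp (-2 * q * z n) = Complex.exp (-q * z n) ^ 2 := by
        rw [← Complex.exp_nat_mul]; congr 1; push_cast; ring
      have e3 : Complex.exp ((2 - 2 * q) * z n) =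
          Complex.exp (z n) ^ 2 * Complex.exp (-q * z n) ^ 2 := by
        rw [← Complex.exp_nat_mul, ← Complex.exp_nat_mul, ← Complex.exp_add]
        congr 1; push_cast; ring
      rw [e2, e3, hw, hq]; ring
    rw [e1]
    field_simp
    ring
  have hη : Tendsto (fun n => (G n - 1) / z n ^ 2) atTop (𝓝 (q * (2 - 3 * q) / 2)) := by
    have := hnum.div hden one_ne_zero
    rw [div_one] at this
    refine this.congr' ?_
    filter_upwards [hden.eventually_ne one_ne_zero, hz0] with n hn hzn
    rw [Pi.div_apply, ← hquad n, div_right_comm, mul_div_cancel_right₀ _ hn]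
  have hpow : Tendsto (fun n => G n ^ n) atTop (𝓝 (Complex.exp (κ * (q * (2 - 3 * q) / 2)))) := by
    have h1 : Tendsto (fun n : ℕ => n * (G n - 1)) atTop (𝓝 (κ * (q * (2 - 3 * q) / 2))) := by
      refine (hκ.mul hη).congr' ?_
      filter_upwards [hz0] with n hzn
      field_simp
    have h2 := Complex.tendsto_one_add_pow_exp_of_tendsto h1
    simpa using h2
  have hφ1 : Tendsto (fun n => genFun p (Complex.exp (z n)) 1) atTop (𝓝 1) := by
    simp_rw [genFun_one]
    have := ((hexp1.sub_const 1).const_mul (2 * (p : ℂ) * (1 - p))).const_add 1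
    simpa using this
  have hμ : Tendsto (fun n => (1 - s n) / 2) atTop (𝓝 0) := by
    simpa using (hslim.const_sub 1).div_const 2
  have hlam : Tendsto (fun n => (1 + s n) / 2) atTop (𝓝 1) := by
    simpa using (hslim.const_add 1).div_const 2
  have hsmall : Tendsto (fun n => (genFun p (Complex.exp (z n)) 1 - (1 + s n) / 2) *
      ((1 - s n) / 2 * Complex.exp (-q * z n)) ^ n) atTop (𝓝 0) := by
    have h1 := hφ1.sub hlam
    rw [sub_self] at h1
    have h2 := hμ.mul (hexp (-q))
    rw [zero_mul] at h2
    refine Tendsto.zero_mul_isBoundedUnder_le h1 ?_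
    refine isBoundedUnder_of_eventually_le (a := 1) ?_
    have h3 := h2.norm
    rw [norm_zero] at h3
    filter_upwards [h3.eventually_le_const zero_lt_one] with n hn
    simp only [Function.comp, norm_pow]
    exact pow_le_one₀ (norm_nonneg _) hn
  have hfin := (((hφ1.sub hμ).mul hpow).sub hsmall).div hslim one_ne_zero
  simp only [sub_zero, one_mul, div_one] at hfin
  refine hfin.congr' ?_
  filter_upwards [hsne] with n hn
  rw [genFun_eq hn (hs2 n) n]
  simp only [Pi.div_apply, hG, mul_pow]
  ring

/-- Central limit theorem for the number of changes, along arrays. -/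
theorem tendstoInDistribution_changes {P : Measure Ω} [IsProbabilityMeasure P] {p : ℝ}
    (hp0 : 0 < p) (hp1 : p < 1) {Y : ℕ → ℕ → Ω → ℝ} (hY : ∀ n, BernoulliSeq P (Y n) p)
    {J : ℕ → ℕ} (hJ : Tendsto J atTop atTop) {q : ℝ} (hq : q = 2 * p * (1 - p)) :
    TendstoInDistribution (fun n ω => (changes (J n) (fun i => Y n i ω) - q * J n) /
      √(q * (2 - 3 * q) * J n)) atTop (id : ℝ → ℝ) (fun _ => P) (gaussianReal 0 1) := by
  have hmeas : ∀ n, Measurable (fun ω => (changes (J n) (fun i => Y n i ω) - q * J n) /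
      √(q * (2 - 3 * q) * J n)) := fun n =>
    (((hY n).measurable_changes_comp (J n)).sub_const _).div_const _
  have hqpos : 0 < q := by rw [hq]; have := mul_pos hp0 (sub_pos.2 hp1); linarith
  have hq1 : 0 < 2 - 3 * q := by rw [hq]; nlinarith [sq_nonneg (2 * p - 1)]
  set v := q * (2 - 3 * q) with hv
  have hvpos : 0 < v := mul_pos hqpos hq1
  refine ⟨fun n => (hmeas n).aemeasurable, aemeasurable_id, ?_⟩
  refine ProbabilityMeasure.tendsto_iff_tendsto_charFun.2 fun t => ?_
  simp only [ProbabilityMeasure.coe_mk, Measure.map_id, charFun_gaussianReal]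
  -- The second-order expansion divides by z_n², so the case t = 0 is treated apart.
  rcases eq_or_ne t 0 with rfl | ht
  · have h1 : ∀ n, charFun (Measure.map (fun ω => (changes (J n) (fun i => Y n i ω) - q * J n) /
      √(v * J n)) P) 0 = 1 := by
      intro n
      have := Measure.isProbabilityMeasure_map (μ := P) (hmeas n).aemeasurable
      rw [charFun_zero, probReal_univ, Complex.ofReal_one]
    convert (tendsto_const_nhds (x := (1 : ℂ)) (f := atTop)).congr fun n => (h1 n).symm using 2
    simp
  set τ : ℕ → ℝ := fun n => t / √(v * n) with hτ
  have hsqrt : Tendsto (fun n : ℕ => √(v * n)) atTop atTop :=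
    Real.tendsto_sqrt_atTop.comp (tendsto_natCast_atTop_atTop.const_mul_atTop hvpos)
  have hτlim : Tendsto τ atTop (𝓝 0) := hsqrt.const_div_atTop t
  have hz : Tendsto (fun n => (τ n : ℂ) * Complex.I) atTop (𝓝 0) := by
    have := ((Complex.continuous_ofReal.tendsto 0).comp hτlim).mul_const Complex.I
    simpa [Function.comp_def] using this
  have hsq : ∀ n : ℕ, 0 < n → √(v * n) ≠ 0 := fun n hn => by
    have : (0 : ℝ) < n := by exact_mod_cast hn
    positivity
  have hz0 : ∀ᶠ n in atTop, (τ n : ℂ) * Complex.I ≠ 0 := by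
    filter_upwards [eventually_gt_atTop 0] with n hn
    refine mul_ne_zero ?_ Complex.I_ne_zero
    exact_mod_cast div_ne_zero ht (hsq n hn)
  have hκ : Tendsto (fun n : ℕ => (n : ℂ) * ((τ n : ℂ) * Complex.I) ^ 2) atTop
      (𝓝 ((-(t ^ 2 / v) : ℝ) : ℂ)) := by
    refine tendsto_const_nhds.congr' ?_
    filter_upwards [eventually_gt_atTop 0] with n hn
    have hn' : (0 : ℝ) < n := by exact_mod_cast hn
    rw [mul_pow, Complex.I_sq]
    have : (n : ℝ) * τ n ^ 2 = t ^ 2 / v := by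
      simp only [hτ]
      rw [div_pow, Real.sq_sqrt (by positivity)]
      field_simp
    rw [← this]
    push_cast
    ring
  -- The characteristic function of the number of changes depends on n only through J n, so the
  -- limit over all lengths can be composed with J.
  have hmain := (tendsto_genFun (p := p) (q := (q : ℂ)) (by rw [hq]; push_cast; ring) hz hz0
    hκ).comp hJ
  have hlim : Complex.exp (((-(t ^ 2 / v) : ℝ) : ℂ) * ((q : ℂ) * (2 - 3 * q) / 2)) =
      Complex.exp (t * (0 : ℝ) * Complex.I - ((1 : NNReal) : ℝ) * t ^ 2 / 2) := by
    congr 1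
    have : ((q : ℂ) * (2 - 3 * q)) = (v : ℂ) := by rw [hv]; push_cast; ring
    rw [this]
    have hv0 : (v : ℂ) ≠ 0 := by exact_mod_cast hvpos.ne'
    push_cast
    field_simp
    simp [sq]
  rw [hlim] at hmain
  refine hmain.congr fun n => ?_
  rw [charFun_apply_real, integral_map (hmeas n).aemeasurable (by fun_prop)]
  simp only [Function.comp]
  rw [← (hY n).integral_exp_changes, ← integral_mul_const]
  refine integral_congr_ae (ae_of_all _ fun ω => ?_)
  simp only [hτ]
  rw [← Complex.exp_nat_mul, ← Complex.exp_add]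
  congr 1
  push_cast
  ring

/-! ### Measurability of the number of roots -/

variable {Ω : Type*} [MeasurableSpace Ω]

/-- By compactness a root exists as soon as |q| takes arbitrarily small values; testing these at
rational points makes the condition countable. -/
theorem exists_isRoot_Icc_iff (q : ℝ[X]) {a b : ℝ} (hab : a < b) :
    (∃ x ∈ Set.Icc a b, q.eval x = 0) ↔
      ∀ k : ℕ, ∃ r : ℚ, (a < r ∧ r < b) ∧ |q.eval (r : ℝ)| < 1 / ((k : ℝ) + 1) := by
  constructor
  · rintro ⟨x, hx, hx0⟩ k
    have hopen : IsOpen {y : ℝ | |q.eval y| < 1 / ((k : ℝ) + 1)} :=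
      isOpen_lt q.continuous.abs continuous_const
    have hxm : x ∈ {y : ℝ | |q.eval y| < 1 / ((k : ℝ) + 1)} := by
      simp only [Set.mem_ofPred_eq, hx0, abs_zero]; positivity
    rw [← closure_Ioo hab.ne] at hx
    obtain ⟨y, hy1, hy2⟩ := mem_closure_iff.1 hx _ hopen hxm
    obtain ⟨r, hr⟩ := Rat.denseRange_cast.exists_mem_open (hopen.inter isOpen_Ioo) ⟨y, hy1, hy2⟩
    exact ⟨r, hr.2, hr.1⟩
  · intro h
    obtain ⟨x, hx, hmin⟩ := isCompact_Icc.exists_isMinOn (Set.nonempty_Icc.2 hab.le)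
      (q.continuous.abs.continuousOn (s := Set.Icc a b))
    refine ⟨x, hx, ?_⟩
    by_contra hne
    obtain ⟨k, hk⟩ := exists_nat_one_div_lt (abs_pos.2 hne)
    obtain ⟨r, hr, hr2⟩ := h k
    have h3 : |q.eval x| ≤ |q.eval (r : ℝ)| := hmin ⟨hr.1.le, hr.2.le⟩
    linarith

theorem measurableSet_exists_isRoot {Q : Ω → ℝ[X]} (hQ : ∀ x, Measurable fun ω => (Q ω).eval x)
    {a b : ℝ} (hab : a < b) : MeasurableSet {ω | ∃ x ∈ Set.Icc a b, (Q ω).eval x = 0} := by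
  simp_rw [exists_isRoot_Icc_iff _ hab]
  simp only [Set.ofPred_forall, Set.ofPred_exists, Set.ofPred_and]
  exact MeasurableSet.iInter fun k => MeasurableSet.iUnion fun r =>
    ((MeasurableSet.const _).inter (MeasurableSet.const _)).inter
      (measurableSet_lt (hQ r).norm measurable_const)

theorem measurableSet_eq_zero {Q : Ω → ℝ[X]} (hQ : ∀ x, Measurable fun ω => (Q ω).eval x) :
    MeasurableSet {ω | Q ω = 0} := by
  have : {ω | Q ω = 0} = ⋂ k : ℕ, {ω | (Q ω).eval (k : ℝ) = 0} := by
    ext ω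
    simp only [Set.mem_ofPred_eq, Set.mem_iInter]
    constructor
    · intro h k; rw [h, eval_zero]
    · intro h
      refine eq_zero_of_infinite_isRoot _ ?_
      refine (Set.infinite_range_of_injective (Nat.cast_injective (R := ℝ))).mono ?_
      rintro _ ⟨k, rfl⟩
      exact h k
  rw [this]
  exact MeasurableSet.iInter fun k => hQ k (measurableSet_singleton 0)

/-- The smallest root above a is separated from the others by a rational interval [c, b]. Peeling it
off allows an induction on k with countable unions. -/
theorem succ_le_card_roots_iff {q : ℝ[X]} (hq : q ≠ 0) (k : ℕ) (a : ℝ) :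
    k + 1 ≤ {x ∈ q.roots.toFinset | a < x}.card ↔
      ∃ c b : ℚ, (a < c ∧ (c : ℝ) < b) ∧ (∃ x ∈ Set.Icc (c : ℝ) b, q.eval x = 0) ∧
        k ≤ {x ∈ q.roots.toFinset | (b : ℝ) < x}.card := by
  constructor
  · intro h
    set s := {x ∈ q.roots.toFinset | a < x} with hs
    have hne : s.Nonempty := Finset.card_pos.1 (by omega)
    set x := s.min' hne with hx
    have hxs : x ∈ s := s.min'_mem hne
    have hxs' := hxs
    rw [hs, Finset.mem_filter, Multiset.mem_toFinset, mem_roots hq] at hxs'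
    obtain ⟨c, hc1, hc2⟩ := exists_rat_btwn hxs'.2
    have hev : ∀ᶠ b in 𝓝[>] x, ∀ y ∈ s, x < y → b < y := by
      rw [Filter.eventually_all_finset]
      intro y _
      by_cases hxy : x < y
      · filter_upwards [Ioo_mem_nhdsGT hxy] with b hb _
        exact hb.2
      · exact Eventually.of_forall fun b h => absurd h hxy
    obtain ⟨b', hb', hsub⟩ := (mem_nhdsGT_iff_exists_Ioo_subset).1 hev
    obtain ⟨b, hb1, hb2⟩ := exists_rat_btwn (Set.mem_Ioi.1 hb')
    refine ⟨c, b, ⟨hc1, hc2.trans hb1⟩, ⟨x, ⟨hc2.le, hb1.le⟩, hxs'.1⟩, ?_⟩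
    have hb3 : ∀ y ∈ s, x < y → (b : ℝ) < y := hsub ⟨hb1, hb2⟩
    have : s.erase x ⊆ {y ∈ q.roots.toFinset | (b : ℝ) < y} := by
      intro y hy
      rw [Finset.mem_erase] at hy
      have hxy : x < y := lt_of_le_of_ne (s.min'_le y hy.2) hy.1.symm
      exact Finset.mem_filter.2 ⟨(Finset.mem_filter.1 hy.2).1, hb3 y hy.2 hxy⟩
    have h2 := Finset.card_le_card this
    rw [Finset.card_erase_of_mem hxs] at h2
    omega
  · rintro ⟨c, b, ⟨hac, hcb⟩, ⟨x, hx, hx0⟩, hk⟩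
    have hx' : x ∉ {y ∈ q.roots.toFinset | (b : ℝ) < y} := by
      rw [Finset.mem_filter]; exact fun h => absurd h.2 (not_lt.2 hx.2)
    have hsub : insert x {y ∈ q.roots.toFinset | (b : ℝ) < y} ⊆
        {y ∈ q.roots.toFinset | a < y} := by
      intro y hy
      rcases Finset.mem_insert.1 hy with rfl | hy
      · exact Finset.mem_filter.2 ⟨by rw [Multiset.mem_toFinset, mem_roots hq]; exact hx0,
          hac.trans_le hx.1⟩
      · rw [Finset.mem_filter] at hy ⊢
        exact ⟨hy.1, (hac.trans hcb).trans hy.2⟩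
    have h2 := Finset.card_le_card hsub
    rw [Finset.card_insert_of_notMem hx'] at h2
    omega

theorem measurableSet_le_card_roots {Q : Ω → ℝ[X]} (hQ : ∀ x, Measurable fun ω => (Q ω).eval x)
    (k : ℕ) (a : ℝ) : MeasurableSet {ω | k ≤ {x ∈ (Q ω).roots.toFinset | a < x}.card} := by
  induction k generalizing a with
  | zero => simp
  | succ k ih =>
    have : {ω | k + 1 ≤ {x ∈ (Q ω).roots.toFinset | a < x}.card} = {ω | Q ω = 0}ᶜ ∩
        ⋃ (c : ℚ) (b : ℚ) (_ : a < c ∧ (c : ℝ) < b),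
          {ω | ∃ x ∈ Set.Icc (c : ℝ) b, (Q ω).eval x = 0} ∩
            {ω | k ≤ {x ∈ (Q ω).roots.toFinset | (b : ℝ) < x}.card} := by
      ext ω
      by_cases h0 : Q ω = 0
      · simp [h0]
      · rw [Set.mem_ofPred_eq, succ_le_card_roots_iff h0]
        simp only [Set.mem_inter_iff, Set.mem_compl_iff, Set.mem_ofPred_eq, h0, not_false_eq_true,
          true_and, Set.mem_iUnion, exists_prop]
    rw [this]
    refine (measurableSet_eq_zero hQ).compl.inter (MeasurableSet.iUnion fun c =>
      MeasurableSet.iUnion fun b => MeasurableSet.iUnion fun h => ?_)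
    exact (measurableSet_exists_isRoot hQ h.2).inter (ih b)

/-- The number of distinct real roots depends measurably on a random polynomial. -/
theorem measurable_card_roots_toFinset {Q : Ω → ℝ[X]}
    (hQ : ∀ x, Measurable fun ω => (Q ω).eval x) :
    Measurable fun ω => (Q ω).roots.toFinset.card := by
  refine measurable_of_Ici fun k => ?_
  have : (fun ω => (Q ω).roots.toFinset.card) ⁻¹' Set.Ici k =
      ⋃ l : ℕ, {ω | k ≤ {x ∈ (Q ω).roots.toFinset | -(l : ℝ) < x}.card} := by
    ext ω
    simp only [Set.mem_preimage, Set.mem_Ici, Set.mem_iUnion, Set.mem_ofPred_eq]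
    constructor
    · intro h
      obtain ⟨A, hA⟩ := (Q ω).roots.toFinset.finite_toSet.bddBelow
      obtain ⟨l, hl⟩ := exists_nat_gt (-A)
      refine ⟨l, ?_⟩
      rwa [Finset.filter_true_of_mem]
      intro x hx
      have : A ≤ x := hA hx
      linarith
    · rintro ⟨l, hl⟩
      exact hl.trans (Finset.card_filter_le _ _)
  rw [this]
  exact MeasurableSet.iUnion fun l => measurableSet_le_card_roots hQ k _

/-- A root of multiplicity μ is counted once for each i < μ: the real zeros of the i-th sum of
squares are the common zeros of q and its first i derivatives. This reduces counting with
multiplicity to counting distinct roots. -/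
theorem card_roots_eq_sum (q : ℝ[X]) {n : ℕ} (hn : q.natDegree ≤ n) :
    q.roots.card = ∑ i ∈ Finset.range n,
      (∑ l ∈ Finset.range (i + 1), (derivative^[l] q) ^ 2).roots.toFinset.card := by
  rcases eq_or_ne q 0 with rfl | hq
  · simp
  have hroot : ∀ i x, (∑ l ∈ Finset.range (i + 1), (derivative^[l] q) ^ 2).eval x = 0 ↔
      i < q.rootMultiplicity x := by
    intro i x
    rw [lt_rootMultiplicity_iff_isRoot_iterate_derivative hq, eval_finsetSum]
    simp only [eval_pow]
    rw [Finset.sum_eq_zero_iff_of_nonneg fun _ _ => sq_nonneg _]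
    simp [IsRoot]
  have hfin : ∀ i, (∑ l ∈ Finset.range (i + 1), (derivative^[l] q) ^ 2).roots.toFinset =
      {x ∈ q.roots.toFinset | i < q.rootMultiplicity x} := by
    intro i
    have hne : (∑ l ∈ Finset.range (i + 1), (derivative^[l] q) ^ 2) ≠ 0 := by
      intro h0
      apply hq
      refine Polynomial.funext fun x => ?_
      have := (hroot i x).1 (by rw [h0, eval_zero])
      rw [eval_zero]
      exact (rootMultiplicity_pos hq).1 (by omega)
    ext x
    rw [Multiset.mem_toFinset, mem_roots hne, IsRoot, hroot, Finset.mem_filter,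
      Multiset.mem_toFinset, mem_roots hq, ← rootMultiplicity_pos hq]
    omega
  simp_rw [hfin, Finset.card_filter]
  rw [Finset.sum_comm, ← Multiset.toFinset_sum_count_eq]
  refine Finset.sum_congr rfl fun x _ => ?_
  rw [count_roots, ← Finset.card_filter]
  have hle : q.rootMultiplicity x ≤ n := by
    rw [← count_roots]
    exact (Multiset.count_le_card _ _).trans ((card_roots' q).trans hn)
  have : {i ∈ Finset.range n | i < q.rootMultiplicity x} = Finset.range (q.rootMultiplicity x) := by
    ext i; simp only [Finset.mem_filter, Finset.mem_range]; omega
  rw [this, Finset.card_range]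

theorem natDegree_ofCoeffs_le (a : ℕ → ℝ) (n : ℕ) : (ofCoeffs a n).natDegree ≤ n := by
  refine natDegree_sum_le_of_forall_le _ _ fun k hk => ?_
  exact (natDegree_C_mul_X_pow_le _ _).trans (by simpa [Nat.lt_succ_iff] using hk)

theorem measurable_eval_iterate_derivative {a : ℕ → Ω → ℝ} (ha : ∀ k, Measurable (a k)) (n l : ℕ)
    (x : ℝ) : Measurable fun ω => (derivative^[l] (ofCoeffs (fun k => a k ω) n)).eval x := by
  simp_rw [← factorial_smul_hasseDeriv, LinearMap.smul_apply, nsmul_eq_mul, eval_mul, eval_natCast,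
    eval_hasseDeriv_ofCoeffs]
  fun_prop

theorem measurable_card_roots_toFinset_ofCoeffs {a : ℕ → Ω → ℝ} (ha : ∀ k, Measurable (a k))
    (n : ℕ) : Measurable fun ω => (ofCoeffs (fun k => a k ω) n).roots.toFinset.card :=
  measurable_card_roots_toFinset fun x => measurable_eval_iterate_derivative ha n 0 x

theorem measurable_card_roots_ofCoeffs {a : ℕ → Ω → ℝ} (ha : ∀ k, Measurable (a k)) (n : ℕ) :
    Measurable fun ω => (ofCoeffs (fun k => a k ω) n).roots.card := by
  simp_rw [card_roots_eq_sum _ (natDegree_ofCoeffs_le _ n)]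
  refine Finset.measurable_fun_sum _ fun i _ => measurable_card_roots_toFinset fun x => ?_
  simp_rw [eval_finsetSum, eval_pow]
  exact Finset.measurable_fun_sum _ fun l _ =>
    (measurable_eval_iterate_derivative ha n l x).pow_const 2

/-! ### Mean, variance and normal limit under an L²-negligible remainder -/

section Perturbation

variable {Ω : Type*} [MeasurableSpace Ω] {P : Measure Ω} [IsProbabilityMeasure P]

theorem sq_integral_le {X : Ω → ℝ} (hX : MemLp X 2 P) : (∫ ω, X ω ∂P) ^ 2 ≤ ∫ ω, X ω ^ 2 ∂P := by
  have h1 := variance_eq_sub hX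
  have h2 := variance_nonneg X P
  simp only [Pi.pow_apply] at h1
  linarith

omit [IsProbabilityMeasure P] in
-- Cauchy–Schwarz, read off from ∫ (A Y - C X)² ≥ 0.
theorem abs_integral_mul_le {X Y : Ω → ℝ} (hX : MemLp X 2 P) (hY : MemLp Y 2 P)
    (hpos : 0 < ∫ ω, X ω ^ 2 ∂P) :
    |∫ ω, X ω * Y ω ∂P| ≤ √((∫ ω, X ω ^ 2 ∂P) * ∫ ω, Y ω ^ 2 ∂P) := by
  set A := ∫ ω, X ω ^ 2 ∂P with hA
  set B := ∫ ω, Y ω ^ 2 ∂P with hB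
  set C := ∫ ω, X ω * Y ω ∂P with hC
  have iX := hX.integrable_sq
  have iY := hY.integrable_sq
  have iXY : Integrable (fun ω => X ω * Y ω) P := hX.integrable_mul hY
  have h0 : 0 ≤ ∫ ω, (A * Y ω - C * X ω) ^ 2 ∂P := integral_nonneg fun ω => sq_nonneg _
  have e : ∀ ω, (A * Y ω - C * X ω) ^ 2 =
      A ^ 2 * Y ω ^ 2 - 2 * A * C * (X ω * Y ω) + C ^ 2 * X ω ^ 2 := fun ω => by ring
  have i1 : Integrable (fun ω => A ^ 2 * Y ω ^ 2 - 2 * A * C * (X ω * Y ω)) P :=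
    (iY.const_mul _).sub (iXY.const_mul _)
  simp_rw [e] at h0
  rw [integral_add i1 (iX.const_mul _), integral_sub (iY.const_mul _) (iXY.const_mul _),
    integral_const_mul, integral_const_mul, integral_const_mul, ← hA, ← hB, ← hC] at h0
  have h1 : 0 ≤ A * (A * B - C ^ 2) := by linarith
  have h2 := nonneg_of_mul_nonneg_right h1 hpos
  exact Real.abs_le_sqrt (by linarith)

variable {j : ℕ → ℝ} {M E R : ℕ → Ω → ℝ} {μ v : ℝ}

/-- A sequence of square integrable variables, decomposed as a constant, a centred main part of
variance `4 v j_n`, and a remainder that is negligible in `L²`. -/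
structure MainPart (P : Measure Ω) (j : ℕ → ℝ) (M E R : ℕ → Ω → ℝ) (μ v : ℝ) : Prop where
  tendsto : Tendsto j atTop atTop
  pos : 0 < v
  memLp_main : ∀ n, MemLp (M n) 2 P
  memLp_rem : ∀ n, MemLp (E n) 2 P
  integral_main : ∀ n, ∫ ω, M n ω ∂P = 0
  integral_main_sq : ∀ n, ∫ ω, M n ω ^ 2 ∂P = v * j n
  rem : Tendsto (fun n => (∫ ω, E n ω ^ 2 ∂P) / j n) atTop (𝓝 0)
  eq : ∀ n ω, R n ω = μ * j n + 2 * M n ω + E n ω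

namespace MainPart

theorem memLp (h : MainPart P j M E R μ v) (n : ℕ) : MemLp (R n) 2 P := by
  have : R n = fun ω => μ * j n + 2 * M n ω + E n ω := funext (h.eq n)
  rw [this]
  have h1 : MemLp (fun ω => 2 * M n ω) 2 P := (h.memLp_main n).const_mul 2
  have h2 : MemLp (fun ω => μ * j n + 2 * M n ω) 2 P := (memLp_const (μ * j n)).add h1
  exact h2.add (h.memLp_rem n)

theorem integral_eq (h : MainPart P j M E R μ v) (n : ℕ) :
    ∫ ω, R n ω ∂P = μ * j n + ∫ ω, E n ω ∂P := by
  have i1 := (h.memLp_main n).integrable one_le_two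
  have i2 := (h.memLp_rem n).integrable one_le_two
  have i3 : Integrable (fun ω => μ * j n + 2 * M n ω) P := (integrable_const _).add (i1.const_mul 2)
  simp_rw [h.eq n]
  rw [integral_add i3 i2, integral_add (integrable_const _) (i1.const_mul 2), integral_const_mul (2 : ℝ),
    h.integral_main]
  simp

omit [IsProbabilityMeasure P] in
theorem tendsto_sqrt_rem (h : MainPart P j M E R μ v) :
    Tendsto (fun n => √((∫ ω, E n ω ^ 2 ∂P) / j n)) atTop (𝓝 0) := by
  simpa using h.rem.sqrt

theorem tendsto_integral_div (h : MainPart P j M E R μ v) :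
    Tendsto (fun n => (∫ ω, R n ω ∂P) / j n) atTop (𝓝 μ) := by
  have h1 : Tendsto (fun n => (∫ ω, E n ω ∂P) / j n) atTop (𝓝 0) := by
    refine squeeze_zero_norm' ?_ h.tendsto_sqrt_rem
    filter_upwards [h.tendsto.eventually_ge_atTop 1] with n hn
    rw [Real.norm_eq_abs]
    refine Real.abs_le_sqrt ?_
    have h2 := sq_integral_le (h.memLp_rem n)
    have h3 : 0 ≤ ∫ ω, E n ω ^ 2 ∂P := integral_nonneg fun ω => sq_nonneg _
    rw [div_pow, div_le_div_iff₀ (by positivity) (by linarith)]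
    have h4 : j n ≤ j n ^ 2 := by nlinarith
    exact mul_le_mul h2 h4 (by linarith) h3
  have h2 := h1.const_add μ
  rw [add_zero] at h2
  refine h2.congr' ?_
  filter_upwards [h.tendsto.eventually_gt_atTop 0] with n hn
  rw [h.integral_eq]
  field_simp

theorem variance_eq (h : MainPart P j M E R μ v) (n : ℕ) :
    variance (R n) P = 4 * (v * j n) + 4 * (∫ ω, M n ω * E n ω ∂P) + variance (E n) P := by
  have hM := h.memLp_main n
  have hE := h.memLp_rem n
  have e : R n = fun ω => μ * j n + ((fun ω => 2 * M n ω) + E n) ω := by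
    funext ω; rw [h.eq]; simp [add_assoc]
  have h2M : MemLp (fun ω => 2 * M n ω) 2 P := hM.const_mul 2
  rw [e, variance_const_add (h2M.add hE).aestronglyMeasurable, variance_add h2M hE,
    variance_const_mul, variance_of_integral_eq_zero hM.aestronglyMeasurable.aemeasurable
      (h.integral_main n), h.integral_main_sq, covariance_const_mul_left, covariance_eq_sub hM hE,
    h.integral_main]
  simp only [Pi.mul_apply]
  ring

theorem variance_rem_le (h : MainPart P j M E R μ v) (n : ℕ) :
    variance (E n) P ≤ ∫ ω, E n ω ^ 2 ∂P := by
  have := variance_le_expectation_sq (h.memLp_rem n).aestronglyMeasurable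
  simpa using this

/-- By Cauchy–Schwarz the cross term is at most √(v j · o(j)) = o(j). -/
theorem tendsto_variance_div (h : MainPart P j M E R μ v) :
    Tendsto (fun n => variance (R n) P / j n) atTop (𝓝 (4 * v)) := by
  have h1 : Tendsto (fun n => (∫ ω, M n ω * E n ω ∂P) / j n) atTop (𝓝 0) := by
    have h2 := h.tendsto_sqrt_rem.const_mul √v
    rw [mul_zero] at h2
    refine squeeze_zero_norm' ?_ h2
    filter_upwards [h.tendsto.eventually_gt_atTop 0] with n hn
    have hpos : 0 < ∫ ω, M n ω ^ 2 ∂P := by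
      rw [h.integral_main_sq]; exact mul_pos h.pos hn
    have h3 := abs_integral_mul_le (h.memLp_main n) (h.memLp_rem n) hpos
    rw [h.integral_main_sq] at h3
    rw [Real.norm_eq_abs, abs_div, abs_of_pos hn, div_le_iff₀ hn]
    refine h3.trans (le_of_eq ?_)
    have h4 : v * j n * ∫ ω, E n ω ^ 2 ∂P = v * ((∫ ω, E n ω ^ 2 ∂P) / j n) * j n ^ 2 := by
      field_simp
    rw [h4, Real.sqrt_mul' _ (sq_nonneg _), Real.sqrt_sq hn.le, Real.sqrt_mul h.pos.le]
  have h2 : Tendsto (fun n => variance (E n) P / j n) atTop (𝓝 0) := by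
    refine squeeze_zero' ?_ ?_ h.rem
    · filter_upwards [h.tendsto.eventually_gt_atTop 0] with n hn
      exact div_nonneg (variance_nonneg _ _) hn.le
    · filter_upwards [h.tendsto.eventually_gt_atTop 0] with n hn
      have := h.variance_rem_le n
      gcongr
  have h3 := ((h1.const_mul 4).const_add (4 * v)).add h2
  simp only [mul_zero, add_zero] at h3
  refine h3.congr' ?_
  filter_upwards [h.tendsto.eventually_gt_atTop 0] with n hn
  rw [h.variance_eq]
  field_simp

/-- The standardization of `R` is close in probability to that of its main part. -/
theorem tendstoInMeasure_sub (h : MainPart P j M E R μ v) {X : ℕ → Ω → ℝ}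
    (hXm : ∀ n, Measurable (X n))
    (hX : ∀ n ω, |X n ω - M n ω / √(v * j n)| ≤ 1 / √(v * j n)) :
    TendstoInMeasure P ((fun n ω => (R n ω - ∫ ω', R n ω' ∂P) / √(variance (R n) P)) - X) atTop
      0 := by
  have hv := h.pos
  set V := fun n => variance (R n) P with hV
  set b : ℕ → ℝ := fun n => (2 * √(v * j n / V n) - 1) ^ 2 with hb
  have hVlim : Tendsto (fun n => V n / j n) atTop (𝓝 (4 * v)) := h.tendsto_variance_div
  have hratio : Tendsto (fun n => j n / V n) atTop (𝓝 (4 * v)⁻¹) := by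
    have := hVlim.inv₀ (by positivity)
    simpa using this
  have hb0 : Tendsto b atTop (𝓝 0) := by
    have h1 := (hratio.const_mul v).sqrt
    have h2 : √(v * (4 * v)⁻¹) = 1 / 2 := by
      rw [show v * (4 * v)⁻¹ = (1 / 2) ^ 2 by field_simp; norm_num, Real.sqrt_sq (by norm_num)]
    rw [h2] at h1
    have h3 := ((h1.const_mul 2).sub_const 1).pow 2
    norm_num at h3
    refine h3.congr fun n => ?_
    rw [hb]; simp only [mul_div_assoc]
  have hc0 : Tendsto (fun n => (∫ ω, E n ω ^ 2 ∂P) / V n) atTop (𝓝 0) := by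
    have h1 := h.rem.mul hratio
    rw [zero_mul] at h1
    refine h1.congr' ?_
    filter_upwards [h.tendsto.eventually_gt_atTop 0] with n hn
    field_simp
  have hd0 : Tendsto (fun n => 1 / (v * j n)) atTop (𝓝 0) :=
    (h.tendsto.const_mul_atTop hv).const_div_atTop 1
  have hsum := ((hb0.add hc0).add hd0).const_mul 3
  simp only [add_zero, mul_zero] at hsum
  have hVpos : ∀ᶠ n in atTop, 0 < V n := by
    filter_upwards [hVlim.eventually_const_lt (by linarith : (0 : ℝ) < 4 * v),
      h.tendsto.eventually_gt_atTop 0] with n hn hn'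
    exact (div_pos_iff_of_pos_right hn').1 hn
  rw [tendstoInMeasure_iff_measureReal_norm]
  intro δ hδ
  have hsum' := hsum.div_const (δ ^ 2)
  rw [zero_div] at hsum'
  refine squeeze_zero' (Eventually.of_forall fun n => measureReal_nonneg) ?_ hsum'
  filter_upwards [hVpos, h.tendsto.eventually_gt_atTop 0] with n hVn hjn
  have hvj : 0 < v * j n := mul_pos hv hjn
  set r := √(v * j n) with hr
  set u := √(V n) with hu
  have hrpos : 0 < r := Real.sqrt_pos.2 hvj
  have hupos : 0 < u := Real.sqrt_pos.2 hVn
  have hr2 : r ^ 2 = v * j n := Real.sq_sqrt hvj.le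
  have hu2 : u ^ 2 = V n := Real.sq_sqrt hVn.le
  have hM := h.memLp_main n
  have hE := h.memLp_rem n
  set m := ∫ ω, E n ω ∂P with hm
  set Z : Ω → ℝ := fun ω => (R n ω - ∫ ω', R n ω' ∂P) / u - X n ω with hZ
  have hcent : MemLp (fun ω => E n ω - m) 2 P := hE.sub (memLp_const m)
  -- Z splits into three errors: the change of normalization from r to u/2, the centred remainder,
  -- and the distance from X to M/r. Each tends to 0 in L², and Markov's inequality for Z²
  -- concludes.
  have hpoint : ∀ ω, Z ω ^ 2 ≤ 3 * ((2 / u - 1 / r) ^ 2 * M n ω ^ 2 +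
      1 / V n * (E n ω - m) ^ 2 + 1 / (v * j n)) := by
    intro ω
    have e1 : Z ω = (2 / u - 1 / r) * M n ω + (E n ω - m) / u - (X n ω - M n ω / r) := by
      simp only [hZ]
      rw [h.integral_eq, h.eq]
      ring
    have e2 : (X n ω - M n ω / r) ^ 2 ≤ 1 / (v * j n) := by
      rw [← hr2, ← sq_abs, ← one_div_pow]
      exact pow_le_pow_left₀ (abs_nonneg _) (hX n ω) 2
    have e3 : ∀ x y z : ℝ, (x + y - z) ^ 2 ≤ 3 * (x ^ 2 + y ^ 2 + z ^ 2) := fun x y z => by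
      nlinarith [sq_nonneg (x - y), sq_nonneg (x + z), sq_nonneg (y + z)]
    rw [e1]
    refine (e3 _ _ _).trans ?_
    rw [mul_pow, div_pow, hu2, div_eq_mul_one_div ((E n ω - m) ^ 2), mul_comm ((E n ω - m) ^ 2)]
    linarith
  have iM := hM.integrable_sq
  have iE := hcent.integrable_sq
  have i1 : Integrable (fun ω => (2 / u - 1 / r) ^ 2 * M n ω ^ 2 + 1 / V n * (E n ω - m) ^ 2) P :=
    (iM.const_mul _).add (iE.const_mul _)
  have i2 : Integrable (fun ω => 3 * ((2 / u - 1 / r) ^ 2 * M n ω ^ 2 +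
      1 / V n * (E n ω - m) ^ 2 + 1 / (v * j n))) P := (i1.add (integrable_const _)).const_mul 3
  have hZm : AEStronglyMeasurable Z P :=
    (((h.memLp n).aestronglyMeasurable.sub aestronglyMeasurable_const).mul_const u⁻¹).sub
      (hXm n).aestronglyMeasurable
  have iZ : Integrable (fun ω => Z ω ^ 2) P := by
    refine i2.mono' (hZm.pow 2) (ae_of_all _ fun ω => ?_)
    rw [Real.norm_eq_abs, abs_of_nonneg (sq_nonneg _)]
    exact hpoint ω
  have hEvar : ∫ ω, (E n ω - m) ^ 2 ∂P ≤ ∫ ω, E n ω ^ 2 ∂P := by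
    rw [hm, ← variance_eq_integral hE.aestronglyMeasurable.aemeasurable]
    exact h.variance_rem_le n
  have hint : ∫ ω, Z ω ^ 2 ∂P ≤ 3 * (b n + (∫ ω, E n ω ^ 2 ∂P) / V n + 1 / (v * j n)) := by
    refine (integral_mono iZ i2 hpoint).trans ?_
    rw [integral_const_mul, integral_add i1 (integrable_const _),
      integral_add (iM.const_mul _) (iE.const_mul _), integral_const_mul, integral_const_mul,
      h.integral_main_sq]
    have e1 : (2 / u - 1 / r) ^ 2 * (v * j n) = b n := by
      rw [hb]
      simp only
      rw [Real.sqrt_div hvj.le, ← hr, ← hu, ← hr2, ← mul_pow]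
      congr 1
      field_simp
    have e2 : 1 / V n * ∫ ω, (E n ω - m) ^ 2 ∂P ≤ (∫ ω, E n ω ^ 2 ∂P) / V n := by
      rw [one_div_mul_eq_div]
      gcongr
    rw [e1]
    simp only [integral_const, probReal_univ, one_smul]
    linarith
  have hmk := mul_meas_ge_le_integral_of_nonneg (ae_of_all P fun ω => sq_nonneg (Z ω)) iZ (δ ^ 2)
  have hset : {x | δ ≤ ‖((fun n ω => (R n ω - ∫ ω', R n ω' ∂P) / √(variance (R n) P)) - X) n x -
      (0 : ℕ → Ω → ℝ) n x‖} ⊆ {x | δ ^ 2 ≤ Z x ^ 2} := by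
    intro x hx
    have h1 : δ ≤ |Z x| := by simpa [hZ, hu, hV] using hx
    change δ ^ 2 ≤ Z x ^ 2
    rw [← sq_abs (Z x)]
    gcongr
  rw [le_div_iff₀ (by positivity), mul_comm]
  refine le_trans ?_ (hmk.trans hint)
  exact mul_le_mul_of_nonneg_left (measureReal_mono hset) (by positivity)

end MainPart

end Perturbation

/-! ### Asymptotics of the number of blocks -/

section IndexAsymptotics

variable {α : ℝ}

theorem rpow_le_jStar (h0 : 0 < α) (h1 : α < 1) (n : ℕ) : ((n : ℝ) / 2) ^ α ≤ jStar α n := by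
  have h2 : (n : ℝ) ≤ 2 * (jStar α n : ℝ) ^ (1 / α) := by
    have h3 : (n : ℝ) ≤ m α (jStar α n) := by exact_mod_cast le_m_jStar h0 h1 n
    refine h3.trans ?_
    have h4 := Nat.floor_le (Real.rpow_nonneg (Nat.cast_nonneg (α := ℝ) (jStar α n)) (1 / α))
    simp only [m, Nat.cast_mul, Nat.cast_ofNat]
    linarith
  calc ((n : ℝ) / 2) ^ α ≤ ((jStar α n : ℝ) ^ (1 / α)) ^ α :=
        Real.rpow_le_rpow (by positivity) (by linarith) h0.le
    _ = jStar α n := by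
        rw [← Real.rpow_mul (Nat.cast_nonneg _), one_div_mul_cancel h0.ne', Real.rpow_one]

/-- From m_(j_*-1) < n one gets (j_*-1)^(1/α) ≤ n/2 + 1; subadditivity of x ↦ x^α extracts the 1
lost to the floor. -/
theorem jStar_le_rpow_add (h0 : 0 < α) (h1 : α < 1) (n : ℕ) :
    (jStar α n : ℝ) ≤ ((n : ℝ) / 2) ^ α + 2 := by
  have hn : (0 : ℝ) ≤ ((n : ℝ) / 2) ^ α := by positivity
  rcases hJ : jStar α n with _ | i
  · push_cast; linarith
  · have h2 : m α i < n := m_lt_of_lt_jStar h0 h1 (by omega)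
    have h3 : (i : ℝ) ^ (1 / α) ≤ (n : ℝ) / 2 + 1 := by
      have h4 := Nat.lt_floor_add_one ((i : ℝ) ^ (1 / α))
      have h5 : (m α i : ℝ) < n := by exact_mod_cast h2
      simp only [m, Nat.cast_mul, Nat.cast_ofNat] at h5
      linarith
    have h6 : (i : ℝ) ≤ ((n : ℝ) / 2 + 1) ^ α := by
      calc (i : ℝ) = ((i : ℝ) ^ (1 / α)) ^ α := by
            rw [← Real.rpow_mul (Nat.cast_nonneg _), one_div_mul_cancel h0.ne', Real.rpow_one]
        _ ≤ _ := Real.rpow_le_rpow (by positivity) h3 h0.le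
    have h7 := Real.rpow_add_le_add_rpow (by positivity : (0 : ℝ) ≤ (n : ℝ) / 2) zero_le_one h0.le
      h1.le
    rw [Real.one_rpow] at h7
    push_cast
    linarith

theorem tendsto_half_rpow (h0 : 0 < α) :
    Tendsto (fun n : ℕ => ((n : ℝ) / 2) ^ α) atTop atTop :=
  (tendsto_rpow_atTop h0).comp
    (tendsto_natCast_atTop_atTop.atTop_div_const two_pos)

theorem tendsto_jStar (h0 : 0 < α) (h1 : α < 1) : Tendsto (jStar α) atTop atTop := by
  rw [← tendsto_natCast_atTop_iff (R := ℝ)]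
  exact tendsto_atTop_mono (rpow_le_jStar h0 h1) (tendsto_half_rpow h0)

theorem tendsto_jStar_div (h0 : 0 < α) (h1 : α < 1) :
    Tendsto (fun n : ℕ => (jStar α n : ℝ) / ((n : ℝ) / 2) ^ α) atTop (𝓝 1) := by
  have h2 := ((tendsto_half_rpow h0).const_div_atTop 2).const_add 1
  rw [add_zero] at h2
  refine tendsto_of_tendsto_of_tendsto_of_le_of_le' tendsto_const_nhds h2 ?_ ?_ <;>
    filter_upwards [(tendsto_half_rpow h0).eventually_gt_atTop 0] with n hn
  · rw [le_div_iff₀ hn, one_mul]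
    exact rpow_le_jStar h0 h1 n
  · rw [div_le_iff₀ hn, add_mul, one_mul, div_mul_cancel₀ _ hn.ne']
    exact jStar_le_rpow_add h0 h1 n

theorem jStar_le (h0 : 0 < α) (h1 : α < 1) (n : ℕ) : jStar α n ≤ n := by
  rcases hJ : jStar α n with _ | i
  · exact Nat.zero_le n
  · have h2 : m α i < n := m_lt_of_lt_jStar h0 h1 (by omega)
    have h3 := (m_strictMono h0 h1).le_apply (x := i)
    omega

theorem tendsto_log_rpow_div_jStar (h0 : 0 < α) (h1 : α < 1) (s : ℝ) :
    Tendsto (fun n : ℕ => Real.log n ^ s / jStar α n) atTop (𝓝 0) := by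
  have h2 : Tendsto (fun n : ℕ => Real.log n ^ s / (n : ℝ) ^ α) atTop (𝓝 0) :=
    ((isLittleO_log_rpow_rpow_atTop s h0).tendsto_div_nhds_zero).comp
      tendsto_natCast_atTop_atTop
  have h3 := h2.const_mul (2 ^ α)
  rw [mul_zero] at h3
  refine squeeze_zero' ?_ ?_ h3
  · filter_upwards [eventually_ge_atTop 1] with n hn
    have : 0 ≤ Real.log n := Real.log_natCast_nonneg n
    positivity
  · filter_upwards [eventually_ge_atTop 1] with n hn
    have h4 : 0 ≤ Real.log n ^ s := Real.rpow_nonneg (Real.log_natCast_nonneg n) s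
    have h5 : (0 : ℝ) < n := by exact_mod_cast hn
    have h6 := rpow_le_jStar h0 h1 n
    have h7 : (0 : ℝ) < ((n : ℝ) / 2) ^ α := by positivity
    calc Real.log n ^ s / jStar α n ≤ Real.log n ^ s / ((n : ℝ) / 2) ^ α := by gcongr
      _ = _ := by
        rw [Real.div_rpow h5.le zero_le_two]
        field_simp

end IndexAsymptotics

/-! ### The event that all coefficients have polynomial size -/

section Tail

variable {Ω : Type*} [MeasurableSpace Ω] {P : Measure Ω} {ε : ℕ → Ω → ℝ}
  {p : ℝ}

/-- The variables with index at most `n` lie between `n ^ (-A)` and `n ^ A` in absolute value. -/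
def Moderate (ε : ℕ → Ω → ℝ) (A : ℝ) (n : ℕ) : Set Ω :=
  {ω | ∀ k ≤ n, Real.exp (-(A * Real.log n)) ≤ |ε k ω| ∧ |ε k ω| ≤ Real.exp (A * Real.log n)}

theorem Admissible.measurableSet_moderate (h : Admissible P ε p) (A : ℝ) (n : ℕ) :
    MeasurableSet (Moderate ε A n) := by
  have e : Moderate ε A n = ⋂ k ∈ Set.Iic n, {ω | Real.exp (-(A * Real.log n)) ≤ |ε k ω| ∧
      |ε k ω| ≤ Real.exp (A * Real.log n)} := by
    ext ω; simp [Moderate]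
  rw [e]
  refine MeasurableSet.biInter (Set.to_countable _) fun k _ => ?_
  have := (h.measurable k).abs
  exact (measurableSet_le measurable_const this).inter (measurableSet_le this measurable_const)

theorem Admissible.measureReal_mem_eq (h : Admissible P ε p) (k : ℕ) {s : Set ℝ}
    (hs : MeasurableSet s) : P.real {ω | ε k ω ∈ s} = P.real {ω | ε 0 ω ∈ s} :=
  congrArg ENNReal.toReal ((h.identDistrib k).measure_mem_eq hs)

variable [IsProbabilityMeasure P]

/-- A union bound over n+1 variables: the small-ball hypothesis handles small values and Markov's
inequality large ones, each with probability O(n^(-A)). -/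
theorem Admissible.measureReal_compl_moderate_le (h : Admissible P ε p) :
    ∃ C : ℝ, 0 < C ∧ ∀ A : ℝ, ∀ n : ℕ, 1 ≤ n →
      P.real (Moderate ε A n)ᶜ ≤ C * (n : ℝ) ^ (1 - A) := by
  obtain ⟨C₀, hC₀, hac⟩ := h.anticoncentration
  refine ⟨2 * (C₀ + 1), by positivity, fun A n hn => ?_⟩
  have hn0 : (0 : ℝ) < n := by exact_mod_cast hn
  set t := Real.exp (-(A * Real.log n)) with ht
  have htpos : 0 < t := Real.exp_pos _
  have hsmall : ∀ k, P.real {ω | |ε k ω| ≤ t} ≤ C₀ * t := fun k => by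
    have h1 := h.measureReal_mem_eq k
      (measurableSet_le measurable_abs measurable_const : MeasurableSet {x : ℝ | |x| ≤ t})
    exact h1.trans_le (hac t htpos.le)
  have hlarge : ∀ k, P.real {ω | t⁻¹ ≤ |ε k ω|} ≤ t := fun k => by
    have h1 := h.measureReal_mem_eq k
      (measurableSet_le measurable_const measurable_abs : MeasurableSet {x : ℝ | t⁻¹ ≤ |x|})
    refine h1.trans_le ?_
    have h2 := mul_meas_ge_le_integral_of_nonneg (ae_of_all P fun ω => abs_nonneg (ε 0 ω))
      h.integrable.abs t⁻¹
    have h3 := h2.trans h.mean_abs_le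
    rw [inv_mul_le_iff₀ htpos, mul_one] at h3
    exact h3
  have hsub : (Moderate ε A n)ᶜ ⊆ ⋃ k ∈ Finset.range (n + 1),
      ({ω | |ε k ω| ≤ t} ∪ {ω | t⁻¹ ≤ |ε k ω|}) := by
    intro ω hω
    by_contra hcon
    refine hω fun k hk => ?_
    simp only [Set.mem_iUnion, not_exists] at hcon
    have h1 := hcon k (Finset.mem_range.2 (by omega))
    have h2 : ¬ |ε k ω| ≤ t := fun h => h1 (Or.inl h)
    have h3 : ¬ t⁻¹ ≤ |ε k ω| := fun h => h1 (Or.inr h)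
    rw [ht, ← Real.exp_neg, neg_neg] at h3
    exact ⟨(not_le.1 h2).le, (not_le.1 h3).le⟩
  have hte : t = (n : ℝ) ^ (-A) := by
    rw [Real.rpow_def_of_pos hn0, ht]; ring_nf
  calc P.real (Moderate ε A n)ᶜ ≤ _ := measureReal_mono hsub (measure_ne_top _ _)
    _ ≤ ∑ k ∈ Finset.range (n + 1), P.real ({ω | |ε k ω| ≤ t} ∪ {ω | t⁻¹ ≤ |ε k ω|}) :=
        measureReal_biUnion_finset_le _ _
    _ ≤ ∑ k ∈ Finset.range (n + 1), (C₀ * t + t) := Finset.sum_le_sum fun k _ =>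
        (measureReal_union_le _ _).trans (add_le_add (hsmall k) (hlarge k))
    _ = (n + 1) * ((C₀ + 1) * t) := by
        rw [Finset.sum_const, Finset.card_range, nsmul_eq_mul]; push_cast; ring
    _ ≤ (2 * n) * ((C₀ + 1) * t) := by
        have : (1 : ℝ) ≤ n := by exact_mod_cast hn
        gcongr; linarith
    _ = 2 * (C₀ + 1) * (n : ℝ) ^ (1 - A) := by
        rw [hte, sub_eq_add_neg, Real.rpow_add hn0, Real.rpow_one]; ring

/-- Borel–Cantelli: for A > 2 the bounds n^(1-A) are summable. -/
theorem Admissible.ae_eventually_moderate (h : Admissible P ε p) {A : ℝ} (hA : 2 < A) :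
    ∀ᵐ ω ∂P, ∀ᶠ n in atTop, ω ∈ Moderate ε A n := by
  obtain ⟨C, hC, hle⟩ := h.measureReal_compl_moderate_le
  have hs : Summable fun n : ℕ => C * (n : ℝ) ^ (1 - A) :=
    (Real.summable_nat_rpow.2 (by linarith)).mul_left C
  have h1 : ∑' n, P ((Moderate ε A n)ᶜ) ≠ ⊤ := by
    have h2 : ∀ n, P ((Moderate ε A n)ᶜ) = ENNReal.ofReal (P.real (Moderate ε A n)ᶜ) := fun n =>
      (ofReal_measureReal).symm
    simp_rw [h2]
    refine Summable.tsum_ofReal_ne_top ?_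
    refine (summable_nat_add_iff 1).1 ?_
    refine Summable.of_nonneg_of_le (fun n => measureReal_nonneg) (fun n => hle A (n + 1) (by omega))
      ((summable_nat_add_iff 1).2 hs)
  filter_upwards [ae_eventually_notMem h1] with ω hω
  filter_upwards [hω] with n hn
  exact not_not.1 hn

theorem Admissible.ae_ne_zero (h : Admissible P ε p) : ∀ᵐ ω ∂P, ∀ k, ε k ω ≠ 0 := by
  obtain ⟨C₀, hC₀, hac⟩ := h.anticoncentration
  rw [ae_all_iff]
  intro k
  have h1 := h.measureReal_mem_eq k
    (measurableSet_le measurable_abs measurable_const : MeasurableSet {x : ℝ | |x| ≤ 0})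
  have h2 := hac 0 le_rfl
  rw [mul_zero] at h2
  have h3 : P.real {ω | |ε k ω| ≤ 0} = 0 := le_antisymm (h1.trans_le h2) measureReal_nonneg
  rw [measureReal_eq_zero_iff] at h3
  rw [ae_iff]
  refine measure_mono_null (fun ω hω => ?_) h3
  have h4 : ε k ω = 0 := by simpa using hω
  change |ε k ω| ≤ 0
  simp [h4]

end Tail

theorem BernoulliSeq.integral_changesMart {Ω : Type*} [MeasurableSpace Ω] {P : Measure Ω}
    [IsProbabilityMeasure P] {Y : ℕ → Ω → ℝ} {p : ℝ} (h : BernoulliSeq P Y p) (J : ℕ) :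
    ∫ ω, changesMart p J (fun i => Y i ω) ∂P = 0 := by
  have hi : ∀ j, Integrable (fun ω => (2 * (1 - 2 * p) - 2 * (Y j ω - p)) * (Y (j + 1) ω - p)) P :=
    fun j => by
    have hm : Measurable fun ω => (2 * (1 - 2 * p) - 2 * (Y j ω - p)) * (Y (j + 1) ω - p) := by
      have := h.measurable j
      have := h.measurable (j + 1)
      fun_prop
    refine Integrable.of_bound hm.aestronglyMeasurable ((2 * |1 - 2 * p| + 2) * 1)
      (ae_of_all _ fun ω => ?_)
    rw [Real.norm_eq_abs, abs_mul]
    refine mul_le_mul ?_ (h.abs_centered_le _ ω) (abs_nonneg _) (by positivity)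
    refine (abs_sub _ _).trans ?_
    have := h.abs_centered_le j ω
    rw [abs_mul, abs_mul, abs_two]
    linarith
  unfold changesMart
  rw [integral_finsetSum _ fun j _ => hi j]
  refine Finset.sum_eq_zero fun j _ => ?_
  have hind : IndepFun (fun ω => 2 * (1 - 2 * p) - 2 * (Y j ω - p)) (fun ω => Y (j + 1) ω - p) P :=
    (h.indep.indepFun (show j ≠ j + 1 by omega)).comp
      (φ := fun x => 2 * (1 - 2 * p) - 2 * (x - p)) (ψ := fun x => x - p) (by fun_prop) (by fun_prop)
  rw [hind.integral_fun_mul_eq_mul_integral, h.integral_centered, mul_zero]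
  · have := h.measurable j
    exact Measurable.aestronglyMeasurable (by fun_prop)
  · have := h.measurable (j + 1)
    exact Measurable.aestronglyMeasurable (by fun_prop)

/-! ### From sign changes to the number of real roots -/

/-- The indicator of the positive half-line. -/
noncomputable def posInd (x : ℝ) : ℝ := if 0 < x then 1 else 0

theorem measurable_posInd : Measurable posInd :=
  Measurable.ite measurableSet_Ioi measurable_const measurable_const

theorem signChanges_eq_changes {u : ℕ → ℝ} {J : ℕ} (hu : ∀ j ≤ J, u j ≠ 0) :
    (signChanges u 0 J : ℝ) = changes J (fun j => posInd (u j)) := by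
  unfold signChanges changes
  rw [Finset.card_filter, Nat.Ico_zero_eq_range]
  push_cast
  refine Finset.sum_congr rfl fun j hj => ?_
  rw [Finset.mem_range] at hj
  rcases (hu j hj.le).lt_or_gt with h1 | h1 <;> rcases (hu (j + 1) hj).lt_or_gt with h2 | h2
  · simp [posInd, h1.not_gt, h2.not_gt, (mul_pos_of_neg_of_neg h1 h2).not_gt]
  · simp [posInd, h1.not_gt, h2, mul_neg_of_neg_of_pos h1 h2]
  · simp [posInd, h1, h2.not_gt, mul_neg_of_pos_of_neg h1 h2]
  · simp [posInd, h1, h2, (mul_pos h1 h2).not_gt]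
    norm_num

theorem abs_changes_sub_changes_le {J : ℕ} {x y : ℕ → ℝ} (hx : ∀ j, x j = 0 ∨ x j = 1)
    (hy : ∀ j, y j = 0 ∨ y j = 1) (h : ∀ j < J, x j = y j) : |changes J x - changes J y| ≤ 1 := by
  rcases J with _ | J
  · simp [changes]
  · unfold changes
    rw [Finset.sum_range_succ, Finset.sum_range_succ, Finset.sum_congr rfl (g := fun j =>
      y j + y (j + 1) - 2 * (y j * y (j + 1))), add_sub_add_left_eq_sub, h J (by omega)]
    · rcases hy J with h0 | h0 <;> rcases hx (J + 1) with h1 | h1 <;>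
        rcases hy (J + 1) with h2 | h2 <;> rw [h0, h1, h2] <;> norm_num
    · intro j hj
      rw [Finset.mem_range] at hj
      rw [h j (by omega), h (j + 1) (by omega)]

section

variable {Ω : Type*} [MeasurableSpace Ω] {P : Measure Ω} {ε : ℕ → Ω → ℝ}
  {p : ℝ}

theorem Admissible.bernoulliSeq [IsProbabilityMeasure P] (h : Admissible P ε p) {φ : ℕ → ℕ}
    (hφ : Function.Injective φ) : BernoulliSeq P (fun j ω => posInd (ε (φ j) ω)) p where
  measurable j := measurable_posInd.comp (h.measurable _)
  indep := (h.indep.precomp hφ).comp (fun _ => posInd) fun _ => measurable_posInd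
  zero_or_one j ω := by unfold posInd; split_ifs <;> simp
  mean j := by
    have e : (fun ω => posInd (ε (φ j) ω)) = Set.indicator {ω | 0 < ε (φ j) ω} 1 := by
      funext ω
      simp [posInd, Set.indicator_apply]
    rw [e, integral_indicator_one (measurableSet_lt measurable_const (h.measurable _)),
      ← h.prob_pos]
    exact h.measureReal_mem_eq (φ j) measurableSet_Ioi
  ident j := ((h.identDistrib _).trans (h.identDistrib _).symm).comp measurable_posInd

end

/-- An injective continuation of the sequence of vertices beyond its last index. -/
noncomputable def vertexExt (α : ℝ) (n j : ℕ) : ℕ :=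
  if j < jStar α n then m α j else n + (j - jStar α n)

theorem vertexExt_eq {α : ℝ} {n j : ℕ} (hj : j ≤ jStar α n) : vertexExt α n j = vertex α n j := by
  unfold vertexExt vertex
  split_ifs with h
  · rfl
  · omega

theorem vertexExt_injective {α : ℝ} (h0 : 0 < α) (h1 : α < 1) (n : ℕ) :
    Function.Injective (vertexExt α n) := by
  refine StrictMono.injective (strictMono_nat_of_lt_succ fun j => ?_)
  have h2 := m_strictMono h0 h1 (Nat.lt_succ_self j)
  unfold vertexExt
  split_ifs with h3 h4 h4
  · exact h2
  · have := m_lt_of_lt_jStar h0 h1 h3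
    omega
  · omega
  · omega

theorem numSignChanges_eq_signChanges {Ω : Type*} (α : ℝ) (ε : ℕ → Ω → ℝ) (n : ℕ) (ω : Ω) :
    numSignChanges α ε n ω = signChanges (fun j => ε (vertex α n j) ω) 0 (jStar α n) := by
  have e : ∀ j, endpointSeq α ε n ω j = ε (vertex α n j) ω := fun j => by
    unfold endpointSeq vertex; split_ifs <;> rfl
  unfold numSignChanges signChanges
  simp_rw [e, Nat.Ico_zero_eq_range]

section

variable {Ω : Type*} [MeasurableSpace Ω] {P : Measure Ω} {ε : ℕ → Ω → ℝ}
  {p : ℝ} {α : ℝ} {R : ℕ → Ω → ℕ}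

omit [MeasurableSpace Ω] in
theorem numSignChanges_eq_changes {n : ℕ} {ω : Ω} (hω : ∀ k, ε k ω ≠ 0) :
    (numSignChanges α ε n ω : ℝ) =
      changes (jStar α n) (fun j => posInd (ε (vertexExt α n j) ω)) := by
  rw [numSignChanges_eq_signChanges, signChanges_eq_changes fun j _ => hω _]
  exact changes_congr fun j hj => by rw [vertexExt_eq hj]

theorem measurable_of_eq_numRoots (hε : ∀ k, Measurable (ε k))
    (hR : R = numRoots α ε ∨ R = numDistinctRoots α ε) (n : ℕ) : Measurable (R n) := by
  have ha : ∀ k, Measurable fun ω => coeff α k * ε k ω := fun k => (hε k).const_mul _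
  rcases hR with rfl | rfl
  · exact measurable_card_roots_ofCoeffs ha n
  · exact measurable_card_roots_toFinset_ofCoeffs ha n

omit [MeasurableSpace Ω] in
theorem card_roots_le_of_eq_numRoots (hR : R = numRoots α ε ∨ R = numDistinctRoots α ε) (n : ℕ)
    (ω : Ω) : (ofCoeffs (fun k => coeff α k * ε k ω) n).roots.toFinset.card ≤ R n ω ∧
      R n ω ≤ (ofCoeffs (fun k => coeff α k * ε k ω) n).roots.card := by
  rcases hR with rfl | rfl
  · exact ⟨Multiset.toFinset_card_le _, le_rfl⟩
  · exact ⟨le_rfl, Multiset.toFinset_card_le _⟩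

omit [MeasurableSpace Ω] in
theorem numRoots_le (hR : R = numRoots α ε ∨ R = numDistinctRoots α ε) (n : ℕ) (ω : Ω) :
    R n ω ≤ n :=
  (card_roots_le_of_eq_numRoots hR n ω).2.trans ((card_roots' _).trans (natDegree_ofCoeffs_le _ _))

omit [MeasurableSpace Ω] in
theorem eventually_moderate_subset (h0 : 0 < α) (h1 : α < 1)
    (hR : R = numRoots α ε ∨ R = numDistinctRoots α ε) {A : ℝ} (hA : 0 ≤ A) :
    ∀ᶠ n : ℕ in atTop, Moderate ε A n ⊆ {ω | |(R n ω : ℝ) - 2 * (numSignChanges α ε n ω : ℝ)|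
      ≤ 3 * Real.log n ^ (1 / α)} := by
  filter_upwards [eventually_abs_card_roots_sub_le h0 h1 hA] with n hn ω hω
  have h2 := card_roots_le_of_eq_numRoots hR n ω
  have h3 := hn (fun k => ε k ω) hω (R n ω) h2.1 h2.2
  rw [← numSignChanges_eq_signChanges] at h3
  exact h3

omit [MeasurableSpace Ω] in
theorem abs_sub_numSignChanges_le (h0 : 0 < α) (h1 : α < 1)
    (hR : R = numRoots α ε ∨ R = numDistinctRoots α ε) (n : ℕ) (ω : Ω) :
    |(R n ω : ℝ) - 2 * (numSignChanges α ε n ω : ℝ)| ≤ 2 * n := by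
  have h2 : (R n ω : ℝ) ≤ n := by exact_mod_cast numRoots_le hR n ω
  have h3 : numSignChanges α ε n ω ≤ n := by
    rw [numSignChanges_eq_signChanges]
    exact (signChanges_le _ _ _).trans ((Nat.sub_le _ _).trans (jStar_le h0 h1 n))
  have h4 : (numSignChanges α ε n ω : ℝ) ≤ n := by exact_mod_cast h3
  have h5 : (0 : ℝ) ≤ numSignChanges α ε n ω := Nat.cast_nonneg _
  have h6 : (0 : ℝ) ≤ R n ω := Nat.cast_nonneg _
  have h7 : (0 : ℝ) ≤ n := Nat.cast_nonneg _
  rw [abs_le]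
  constructor <;> linarith

variable [IsProbabilityMeasure P]

theorem Admissible.withOverwhelmingProb (h : Admissible P ε p) (h0 : 0 < α) (h1 : α < 1)
    (hR : R = numRoots α ε ∨ R = numDistinctRoots α ε) :
    WithOverwhelmingProb P (fun n => {ω | |(R n ω : ℝ) - 2 * (numSignChanges α ε n ω : ℝ)|
      ≤ 3 * Real.log n ^ (1 / α)}) := by
  intro κ hκ
  obtain ⟨C, hC, hle⟩ := h.measureReal_compl_moderate_le
  -- The choice A = κ + 1 turns the exceptional probability into O(n^(-κ)). Adding N to the constant
  -- excludes the n where the deterministic count is not yet valid.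
  obtain ⟨N, hN⟩ := eventually_atTop.1
    (eventually_moderate_subset h0 h1 hR (by linarith : (0 : ℝ) ≤ κ + 1))
  refine ⟨C + N, by positivity, fun n hn => ?_⟩
  have hNn : N ≤ n := by
    have : (N : ℝ) < n := by linarith
    exact_mod_cast this.le
  have hn0 : (0 : ℝ) < n := lt_of_le_of_lt (by positivity) hn
  have h2 := hle (κ + 1) n (by exact_mod_cast hn0)
  rw [show 1 - (κ + 1) = -κ by ring, probReal_compl_eq_one_sub (h.measurableSet_moderate _ _)] at h2
  have h3 : P.real (Moderate ε (κ + 1) n) ≤ _ := measureReal_mono (hN n hNn)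
  have h4 : 0 ≤ (N : ℝ) * (n : ℝ) ^ (-κ) := by positivity
  linarith

/-- On `Moderate ε 3 n` the square is O((log n)^(2/α)) = o(j_*). Off it, the bound 4n² meets a
probability O(n^(-2)), which contributes O(1). -/
theorem Admissible.tendsto_integral_sq (h : Admissible P ε p) (h0 : 0 < α) (h1 : α < 1)
    {D : ℕ → Ω → ℝ} (hDm : ∀ n, AEStronglyMeasurable (D n) P) (hD : ∀ n, ∀ᵐ ω ∂P, |D n ω| ≤ 2 * n)
    (hM : ∀ᶠ n in atTop, ∀ᵐ ω ∂P, ω ∈ Moderate ε 3 n → |D n ω| ≤ 3 * Real.log n ^ (1 / α)) :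
    Tendsto (fun n => (∫ ω, D n ω ^ 2 ∂P) / jStar α n) atTop (𝓝 0) := by
  obtain ⟨C, hC, hle⟩ := h.measureReal_compl_moderate_le
  have l1 := (tendsto_log_rpow_div_jStar h0 h1 (2 * (1 / α))).const_mul 9
  have l2 : Tendsto (fun n => 4 * C / (jStar α n : ℝ)) atTop (𝓝 0) :=
    (tendsto_natCast_atTop_atTop.comp (tendsto_jStar h0 h1)).const_div_atTop _
  have l3 := l1.add l2
  rw [mul_zero, add_zero] at l3
  refine squeeze_zero' (Eventually.of_forall fun n => div_nonneg
    (integral_nonneg fun ω => sq_nonneg _) (Nat.cast_nonneg _)) ?_ l3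
  filter_upwards [hM, eventually_ge_atTop 1] with n hn hn1
  have hn0 : (0 : ℝ) < n := by exact_mod_cast hn1
  have hlog : 0 ≤ Real.log n := Real.log_natCast_nonneg n
  have hms := (h.measurableSet_moderate 3 n).compl
  have hbound : ∀ᵐ ω ∂P, D n ω ^ 2 ≤ 9 * Real.log n ^ (2 * (1 / α)) +
      (Moderate ε 3 n)ᶜ.indicator (fun _ => (4 * n ^ 2 : ℝ)) ω := by
    filter_upwards [hn, hD n] with ω h2 h3
    rw [← sq_abs]
    by_cases hω : ω ∈ Moderate ε 3 n
    · rw [Set.indicator_of_notMem (Set.notMem_compl_iff.2 hω), add_zero, mul_comm 2, Real.rpow_mul hlog,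
        Real.rpow_two]
      calc |D n ω| ^ 2 ≤ (3 * Real.log n ^ (1 / α)) ^ 2 :=
            pow_le_pow_left₀ (abs_nonneg _) (h2 hω) 2
        _ = _ := by ring
    · rw [Set.indicator_of_mem hω]
      have h4 : 0 ≤ 9 * Real.log n ^ (2 * (1 / α)) := by positivity
      have h5 := pow_le_pow_left₀ (abs_nonneg _) h3 2
      linarith
  have hi : Integrable ((Moderate ε 3 n)ᶜ.indicator (fun _ => (4 * n ^ 2 : ℝ))) P :=
    (integrable_const _).indicator hms
  have hi' : Integrable (fun ω => 9 * Real.log n ^ (2 * (1 / α)) +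
      (Moderate ε 3 n)ᶜ.indicator (fun _ => (4 * n ^ 2 : ℝ)) ω) P := (integrable_const _).add hi
  have iD : Integrable (fun ω => D n ω ^ 2) P := by
    refine hi'.mono' ((hDm n).pow 2) ?_
    filter_upwards [hbound] with ω hω
    rwa [Real.norm_eq_abs, abs_of_nonneg (sq_nonneg _)]
  have h2 := integral_mono_ae iD hi' hbound
  rw [integral_add (integrable_const _) hi, integral_indicator_const _ hms] at h2
  simp only [integral_const, probReal_univ, smul_eq_mul, one_mul] at h2
  have h3 := hle 3 n hn1
  have h4 : P.real (Moderate ε 3 n)ᶜ * (4 * n ^ 2) ≤ 4 * C := by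
    calc P.real (Moderate ε 3 n)ᶜ * (4 * n ^ 2) ≤ C * (n : ℝ) ^ (1 - 3 : ℝ) * (4 * n ^ 2) := by
          gcongr
      _ = 4 * C := by
        rw [show (1 - 3 : ℝ) = -2 by norm_num, Real.rpow_neg hn0.le, Real.rpow_two]
        field_simp
  calc (∫ ω, D n ω ^ 2 ∂P) / jStar α n
      ≤ (9 * Real.log n ^ (2 * (1 / α)) + 4 * C) / jStar α n := by gcongr; linarith
    _ = _ := by ring

/-- The number of real roots is `2 (q J + M)` up to a remainder that is small in `L²`, where `M`
is the martingale part of the number of sign changes. -/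
theorem Admissible.mainPart (h : Admissible P ε p) (h0 : 0 < α) (h1 : α < 1)
    (hR : R = numRoots α ε ∨ R = numDistinctRoots α ε) :
    MainPart P (fun n => (jStar α n : ℝ))
      (fun n ω => changesMart p (jStar α n) (fun j => posInd (ε (vertexExt α n j) ω)))
      (fun n ω => R n ω - 2 * (2 * p * (1 - p)) * jStar α n -
        2 * changesMart p (jStar α n) (fun j => posInd (ε (vertexExt α n j) ω)))
      (fun n ω => (R n ω : ℝ)) (2 * (2 * p * (1 - p)))
      (2 * p * (1 - p) * (2 - 3 * (2 * p * (1 - p)))) := by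
  have hY := fun n => h.bernoulliSeq (vertexExt_injective h0 h1 n)
  have hRm : ∀ n, Measurable fun ω => (R n ω : ℝ) := fun n =>
    (measurable_from_top).comp (measurable_of_eq_numRoots h.measurable hR n)
  have hq : 0 < p * (1 - p) := mul_pos h.p_pos (sub_pos.2 h.p_lt_one)
  have hM : ∀ n, MemLp (fun ω => changesMart p (jStar α n)
      (fun j => posInd (ε (vertexExt α n j) ω))) 2 P := fun n =>
    MemLp.of_bound ((hY n).measurable_changesMart_comp _).aestronglyMeasurable _
      (ae_of_all _ fun ω => (hY n).abs_changesMart_le _ ω)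
  have hRL : ∀ n, MemLp (fun ω => (R n ω : ℝ)) 2 P := fun n =>
    MemLp.of_bound (hRm n).aestronglyMeasurable n (ae_of_all _ fun ω => by
      rw [Real.norm_natCast]; exact_mod_cast numRoots_le hR n ω)
  have hE : ∀ n, MemLp (fun ω => (R n ω : ℝ) - 2 * (2 * p * (1 - p)) * jStar α n -
      2 * changesMart p (jStar α n) (fun j => posInd (ε (vertexExt α n j) ω))) 2 P := fun n =>
    ((hRL n).sub (memLp_const _)).sub ((hM n).const_mul 2)
  refine ⟨tendsto_natCast_atTop_atTop.comp (tendsto_jStar h0 h1), ?_, hM, hE,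
    fun n => (hY n).integral_changesMart _, fun n => (hY n).integral_changesMart_sq _, ?_,
    fun n ω => by ring⟩
  · have : 0 < 2 - 3 * (2 * p * (1 - p)) := by nlinarith [sq_nonneg (2 * p - 1)]
    have : 0 < 2 * p * (1 - p) := by linarith
    positivity
  · set D : ℕ → Ω → ℝ := fun n ω =>
      R n ω - 2 * changes (jStar α n) (fun j => posInd (ε (vertexExt α n j) ω)) with hD
    have hDm : ∀ n, Measurable (D n) := fun n =>
      (hRm n).sub (((hY n).measurable_changes_comp _).const_mul 2)
    have hD2 : ∀ n, ∀ᵐ ω ∂P, |D n ω| ≤ 2 * n := fun n => by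
      filter_upwards [h.ae_ne_zero] with ω hω
      simp only [hD]
      rw [← numSignChanges_eq_changes hω]
      exact abs_sub_numSignChanges_le h0 h1 hR n ω
    have l1 : Tendsto (fun n => (∫ ω, D n ω ^ 2 ∂P) / jStar α n) atTop (𝓝 0) := by
      refine h.tendsto_integral_sq h0 h1 (fun n => (hDm n).aestronglyMeasurable) hD2 ?_
      filter_upwards [eventually_moderate_subset h0 h1 hR (by norm_num : (0 : ℝ) ≤ 3)] with n hn
      filter_upwards [h.ae_ne_zero] with ω hω hω'
      simp only [hD]
      rw [← numSignChanges_eq_changes hω]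
      exact hn hω'
    have l2 : Tendsto (fun n => 8 / (jStar α n : ℝ)) atTop (𝓝 0) :=
      (tendsto_natCast_atTop_atTop.comp (tendsto_jStar h0 h1)).const_div_atTop _
    have l3 := (l1.const_mul 2).add l2
    rw [mul_zero, add_zero] at l3
    refine squeeze_zero (fun n => div_nonneg (integral_nonneg fun ω => sq_nonneg _)
      (Nat.cast_nonneg _)) (fun n => ?_) l3
    have iD : Integrable (fun ω => D n ω ^ 2) P :=
      (MemLp.of_bound (hDm n).aestronglyMeasurable (2 * n) (hD2 n)).integrable_sq
    have hle : ∫ ω, ((R n ω : ℝ) - 2 * (2 * p * (1 - p)) * jStar α n -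
        2 * changesMart p (jStar α n) (fun j => posInd (ε (vertexExt α n j) ω))) ^ 2 ∂P ≤
        2 * (∫ ω, D n ω ^ 2 ∂P) + 8 := by
      have e : 2 * (∫ ω, D n ω ^ 2 ∂P) + 8 = ∫ ω, (2 * D n ω ^ 2 + 8) ∂P := by
        rw [integral_add (iD.const_mul 2) (integrable_const _), integral_const_mul]
        simp
      rw [e]
      refine integral_mono (hE n).integrable_sq ((iD.const_mul 2).add (integrable_const _))
        fun ω => ?_
      have h2 := abs_le.1 ((hY n).abs_changes_sub_le (jStar α n) ω)
      simp only [hD]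
      set x := changes (jStar α n) (fun j => posInd (ε (vertexExt α n j) ω))
      set y := changesMart p (jStar α n) (fun j => posInd (ε (vertexExt α n j) ω))
      -- The remainder is D + 2(x - qJ - y) with |x - qJ - y| ≤ 1, so (a + b)² ≤ 2a² + 2b² gives 2D²
      -- + 8.
      nlinarith [sq_nonneg ((R n ω : ℝ) - 2 * x - 2 * (x - 2 * p * (1 - p) * jStar α n - y)), h2.1,
        h2.2]
    calc _ ≤ (2 * (∫ ω, D n ω ^ 2 ∂P) + 8) / jStar α n := by gcongr
      _ = _ := by ring

/-- The signs at the vertices change with n only in the last entry, so up to 1 the count is that of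
the fixed sequence ε_(m_j), to which the strong law applies. -/
theorem Admissible.ae_tendsto_div (h : Admissible P ε p) (h0 : 0 < α) (h1 : α < 1)
    (hR : R = numRoots α ε ∨ R = numDistinctRoots α ε) :
    ∀ᵐ ω ∂P, Tendsto (fun n : ℕ => (R n ω : ℝ) / jStar α n) atTop (𝓝 (2 * (2 * p * (1 - p)))) := by
  have hJ := tendsto_jStar h0 h1
  have hY := h.bernoulliSeq (m_strictMono h0 h1).injective
  filter_upwards [h.ae_ne_zero, h.ae_eventually_moderate (by norm_num : (2 : ℝ) < 3),
    hY.tendsto_changes_div] with ω hne hmod hlln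
  have l1 := ((hlln.comp hJ).const_mul 2)
  have l2 : Tendsto (fun n : ℕ => (3 * Real.log n ^ (1 / α) + 2) / jStar α n) atTop (𝓝 0) := by
    have := ((tendsto_log_rpow_div_jStar h0 h1 (1 / α)).const_mul 3).add
      ((tendsto_natCast_atTop_atTop (R := ℝ).comp hJ).const_div_atTop 2)
    rw [mul_zero, add_zero] at this
    refine this.congr fun n => ?_
    simp only [Function.comp_apply]
    ring
  have l3 : Tendsto (fun n : ℕ => (R n ω : ℝ) / jStar α n -
      2 * (changes (jStar α n) (fun j => posInd (ε (m α j) ω)) / jStar α n)) atTop (𝓝 0) := by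
    refine squeeze_zero_norm' ?_ l2
    filter_upwards [hmod, eventually_moderate_subset h0 h1 hR (by norm_num : (0 : ℝ) ≤ 3)]
      with n hn hs
    have h2 : |(R n ω : ℝ) - 2 * (numSignChanges α ε n ω : ℝ)| ≤ 3 * Real.log n ^ (1 / α) := hs hn
    rw [numSignChanges_eq_changes hne] at h2
    have h3 : |changes (jStar α n) (fun j => posInd (ε (vertexExt α n j) ω)) -
        changes (jStar α n) (fun j => posInd (ε (m α j) ω))| ≤ 1 := by
      refine abs_changes_sub_changes_le
        ((h.bernoulliSeq (vertexExt_injective h0 h1 n)).zero_or_one · ω) (hY.zero_or_one · ω)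
        fun j hj => ?_
      rw [vertexExt, if_pos hj]
    rw [Real.norm_eq_abs, ← mul_div_assoc, ← sub_div, abs_div, Nat.abs_cast]
    gcongr
    rw [abs_le] at h2 h3 ⊢
    constructor <;> linarith
  have l4 := l1.add l3
  rw [add_zero] at l4
  refine l4.congr fun n => ?_
  simp only [Function.comp_apply]
  ring

/-- Slutsky's theorem: the standardized R_n and the standardized number of changes differ by a
quantity tending to 0 in probability. -/
theorem Admissible.tendstoInDistribution (h : Admissible P ε p) (h0 : 0 < α) (h1 : α < 1)
    (hR : R = numRoots α ε ∨ R = numDistinctRoots α ε) :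
    TendstoInDistribution
      (fun (n : ℕ) (ω : Ω) => ((R n ω : ℝ) - ∫ ω', (R n ω' : ℝ) ∂P) /
        √(variance (fun ω' => (R n ω' : ℝ)) P))
      atTop (id : ℝ → ℝ) (fun _ => P) (gaussianReal 0 1) := by
  have hY := fun n => h.bernoulliSeq (vertexExt_injective h0 h1 n)
  have hX := tendstoInDistribution_changes h.p_pos h.p_lt_one hY (tendsto_jStar h0 h1) rfl
  have hRm : ∀ n, Measurable fun ω => (R n ω : ℝ) := fun n =>
    (measurable_from_top).comp (measurable_of_eq_numRoots h.measurable hR n)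
  refine tendstoInDistribution_of_tendstoInMeasure_sub _ _ hX
    ((h.mainPart h0 h1 hR).tendstoInMeasure_sub (fun n => ?_) fun n ω => ?_)
    fun n => (((hRm n).sub_const _).div_const _).aemeasurable
  · exact (((hY n).measurable_changes_comp _).sub_const _).div_const _
  · rw [← sub_div, abs_div, abs_of_nonneg (Real.sqrt_nonneg _)]
    gcongr
    exact (hY n).abs_changes_sub_le _ ω

end

/-! ### Conclusion -/

theorem isEquivalent_of_tendsto_div {u j w : ℕ → ℝ} {c : ℝ} (hc : c ≠ 0)
    (hu : Tendsto (fun n => u n / j n) atTop (𝓝 c)) (hj : Tendsto (fun n => j n / w n) atTop (𝓝 1))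
    (hj0 : ∀ᶠ n in atTop, j n ≠ 0) (hw0 : ∀ᶠ n in atTop, w n ≠ 0) :
    Asymptotics.IsEquivalent atTop u (fun n => c * w n) := by
  rw [Asymptotics.isEquivalent_iff_tendsto_one (hw0.mono fun n hn => mul_ne_zero hc hn)]
  have h1 := (hu.mul hj).div_const c
  rw [mul_one, div_self hc] at h1
  refine h1.congr' ?_
  filter_upwards [hj0, hw0] with n h2 h3
  simp only [Pi.div_apply]
  field_simp

end RandomPoly

theorem theorem2 :
    ∃ C : ℝ, 0 < C ∧ ∃ c c' : ℝ → ℝ, (∀ p, 0 < p → p < 1 → 0 < c p ∧ 0 < c' p) ∧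
      ∀ (α : ℝ), 0 < α → α < 1 →
      ∀ (Ω : Type*) [MeasurableSpace Ω] (P : Measure Ω) [IsProbabilityMeasure P]
        (ε : ℕ → Ω → ℝ) (p : ℝ), RandomPoly.Admissible P ε p →
      -- real roots may be counted with or without multiplicity
      ∀ R : ℕ → Ω → ℕ,
        (R = RandomPoly.numRoots α ε ∨ R = RandomPoly.numDistinctRoots α ε) →
        (∀ n, Measurable (R n)) ∧
        RandomPoly.WithOverwhelmingProb P (fun n => {ω |
          |(R n ω : ℝ) - 2 * (RandomPoly.numSignChanges α ε n ω : ℝ)|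
            ≤ C * (Real.log n) ^ (1 / α)}) ∧
        Asymptotics.IsEquivalent atTop (fun n : ℕ => ∫ ω, (R n ω : ℝ) ∂P)
          (fun n : ℕ => c p * ((n : ℝ) / 2) ^ α) ∧
        Asymptotics.IsEquivalent atTop
          (fun n : ℕ => variance (fun ω => (R n ω : ℝ)) P)
          (fun n : ℕ => c' p * ((n : ℝ) / 2) ^ α) ∧
        (∀ᵐ ω ∂P, Tendsto (fun n : ℕ => (R n ω : ℝ) / (c p * ((n : ℝ) / 2) ^ α)) atTop (𝓝 1)) ∧
        TendstoInDistribution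
          (fun (n : ℕ) (ω : Ω) => ((R n ω : ℝ) - ∫ ω', (R n ω' : ℝ) ∂P) /
            √(variance (fun ω' => (R n ω' : ℝ)) P))
          atTop (id : ℝ → ℝ) (fun _ => P) (gaussianReal 0 1) := by
  have hpos : ∀ p : ℝ, 0 < p → p < 1 → 0 < 2 * (2 * p * (1 - p)) ∧
      0 < 4 * (2 * p * (1 - p) * (2 - 3 * (2 * p * (1 - p)))) := fun p hp0 hp1 => by
    have h1 : 0 < p * (1 - p) := mul_pos hp0 (sub_pos.2 hp1)
    have h2 : 0 < 2 - 3 * (2 * p * (1 - p)) := by nlinarith [sq_nonneg (2 * p - 1)]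
    have h3 : 0 < 2 * p * (1 - p) := by linarith
    exact ⟨by linarith, by positivity⟩
  -- The constant 3 is that of the deterministic count. With q = 2p(1-p), the probability that two
  -- consecutive signs differ, each change is worth two roots, hence c = 2q and c' = 4q(2-3q); both
  -- are positive because q ≤ 1/2.
  refine ⟨3, by norm_num, fun p => 2 * (2 * p * (1 - p)),
    fun p => 4 * (2 * p * (1 - p) * (2 - 3 * (2 * p * (1 - p)))), hpos, ?_⟩
  intro α h0 h1 Ω _ P _ ε p h R hR
  obtain ⟨hc, hc'⟩ := hpos p h.p_pos h.p_lt_one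
  have hmain := h.mainPart h0 h1 hR
  have hj := RandomPoly.tendsto_jStar_div h0 h1
  have hj0 : ∀ᶠ n in atTop, (RandomPoly.jStar α n : ℝ) ≠ 0 :=
    (hmain.tendsto.eventually_gt_atTop 0).mono fun n hn => hn.ne'
  have hw0 : ∀ᶠ n : ℕ in atTop, ((n : ℝ) / 2) ^ α ≠ 0 :=
    ((RandomPoly.tendsto_half_rpow h0).eventually_gt_atTop 0).mono fun n hn => hn.ne'
  refine ⟨RandomPoly.measurable_of_eq_numRoots h.measurable hR, h.withOverwhelmingProb h0 h1 hR,
    RandomPoly.isEquivalent_of_tendsto_div hc.ne' hmain.tendsto_integral_div hj hj0 hw0,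
    RandomPoly.isEquivalent_of_tendsto_div hc'.ne' hmain.tendsto_variance_div hj hj0 hw0, ?_,
    h.tendstoInDistribution h0 h1 hR⟩
  filter_upwards [h.ae_tendsto_div h0 h1 hR] with ω hω
  exact (Asymptotics.isEquivalent_iff_tendsto_one (hw0.mono fun n hn => mul_ne_zero hc.ne' hn)).1
    (RandomPoly.isEquivalent_of_tendsto_div hc.ne' hω hj hj0 hw0)
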